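/- Let $H,K$ be nonzero complex Hilbert spaces of arbitrary dimension and fix an orthonormal basis of $K$, with transposition $b\mapsto b^t$ on $B(K)$. Let $\mathfrak K$ and $\mathfrak T$ be the compact and the trace class operators on $K$ (the latter with the trace norm), let $\otimes_\pi,\otimes_\varepsilon$ be the projective and injective tensor products of Banach spaces, and let $B(H)\otimes\mathfrak K$ be the C*-algebra obtained as the operator norm closure of the algebraic tensor product $B(H)\odot\mathfrak K$ in $B(H\otimes K)$. Let $u\mapsto\hat u$, $\widehat{a\otimes b}=a\otimes b$, be the canonical contraction $B(H)\otimes_\pi\mathfrak T\to B(H)\otimes\mathfrak K$. A bounded functional on $B(H)\otimes\mathfrak K$ is called normal if it is ultraweakly continuous (that is, continuous for $\sigma(B(H\otimes K),\mathfrak T(H\otimes K))$), and singular if it is a linear combination of positive functionals none of which dominates a nonzero positive normal functional. A bounded functional $\psi$ on $B(H)\otimes_\pi\mathfrak T$ is called normal if it is the restriction $u\mapsto\rho(\hat u)$ of a normal functional $\rho$ on $B(H)\otimes\mathfrak K$. For a trace class operator $\varrho$ on $H\otimes K$ write $\varrho\ge_{bp}0$ if $(f\otimes g,\varrho\, f\otimes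 g)\ge 0$ for all $f\in H$, $g\in K$, and let $\alpha(\varrho)=\sup\{|\mathrm{Tr}(\varrho\hat u)|/\|u\|_\pi: 0\ne u\in B(H)\otimes_\pi\mathfrak T\}$. Put $$\mathfrak D_0=\{\varrho:\ \alpha(\varrho)=1,\ \varrho=\varrho^*,\ \varrho\ge_{bp}0\},\qquad \mathfrak D=\{\varrho\in\mathfrak D_0:\ \mathrm{Tr}_H\varrho=1_K\}.$$ A point $x$ of a subset $C$ of a real normed space is called exposed if some bounded real-linear functional attains its maximum on $C$ at $x$ and only at $x$. Then: (1) Restriction is an injective map $(B(H)\otimes\mathfrak K)^*\to(B(H)\otimes_\pi\mathfrak T)^*$ which does not increase norms, and there is an injective linear map $(B(H)\otimes_\varepsilon\mathfrak K)^*\to(B(H)\otimes\mathfrak K)^*$ which does not increase norms and preserves the values on the elements $a\otimes k$; in this sense $(B(H)\otimes_\pi\mathfrak T)^*\supseteq(B(H)\otimes\mathfrak K)^*\supseteq(B(H)\otimes_\varepsilon\mathfrak K)^*$. (2) Every bounded functional on $B(H)\otimes\mathfrak K$ is in a unique way the sum of a normal and a singular functional. (3) A bounded functional $\psi$ on $B(H)\otimes_\pi\mathfrak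 T$ is normal if and only if there is a (then unique) trace class operator $\varrho$ on $H\otimes K$ with $\psi(u)=\mathrm{Tr}(\varrho\hat u)$ for all $u$. (4) There is an isometric linear isomorphism $\phi\mapsto\tilde\phi$ from the bounded linear maps $B(H)\to B(K)$ onto $(B(H)\otimes_\pi\mathfrak T)^*$ with $\tilde\phi(a\otimes b)=\mathrm{Tr}(\phi(a)b^t)$, and $\phi$ is positive if and only if $\tilde\phi$ is positive on $B(H)^+\otimes_\pi\mathfrak T^+$. The maps $\phi$ with $\tilde\phi$ normal are exactly the maps $\phi_\varrho$ with $\tilde\phi_\varrho(u)=\mathrm{Tr}(\varrho\hat u)$, $\varrho$ of trace class on $H\otimes K$; the map $\varrho\mapsto\phi_\varrho$ is linear and injective, $\|\phi_\varrho\|=\alpha(\varrho)$, and $\phi_\varrho$ is positive if and only if $\varrho\ge_{bp}0$. (5) $\mathfrak D_0$ is not empty, and $\varrho\mapsto\phi_\varrho$ maps $\mathfrak D_0$ onto the set of positive maps $\phi$ of norm one with $\tilde\phi$ normal, and the exposed points of $\mathfrak D_0$ (for the norm $\alpha$) onto the exposed points of that set (for the operator norm). (6) $\mathfrak D$ is convex,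 and $\varrho\mapsto\phi_\varrho$ maps $\mathfrak D$ onto the set of unital positive maps $\phi$ with $\tilde\phi$ normal, and the exposed points of $\mathfrak D$ onto the exposed points of that set. If $\dim K=n<\infty$, then $\mathfrak D=\{\varrho\in\mathfrak D_0:\mathrm{Tr}\,\varrho=n\}$. The set $\mathfrak D$ is nonempty if and only if $K$ is finite-dimensional. -/

import Mathlib

open scoped TensorProduct ComplexOrder InnerProductSpace

noncomputable section

namespace PosMaps

/-! ## Operators, trace, trace class -/

section TraceClassSection

variable (L : Type*) [NormedAddCommGroup L] [InnerProductSpace ℂ L]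

/-- The numbers `∑ i, |⟪f i, T (e i)⟫|` for finite orthonormal families `e`, `f` of equal length. -/
def traceNormSet {L : Type*} [NormedAddCommGroup L] [InnerProductSpace ℂ L]
    (T : L →L[ℂ] L) : Set ℝ :=
  {r | ∃ (n : ℕ) (e f : Fin n → L), Orthonormal ℂ e ∧ Orthonormal ℂ f ∧
    r = ∑ i, ‖⟪f i, T (e i)⟫_ℂ‖}

/-- The trace norm, `‖T‖₁ = sup ∑ i, |⟪f i, T (e i)⟫|` over pairs of (finite) orthonormal
families, that is `Tr |T|`. -/
def traceNorm {L : Type*} [NormedAddCommGroup L] [InnerProductSpace ℂ L]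
    (T : L →L[ℂ] L) : ℝ := sSup (traceNormSet T)

/-- `T` is of trace class when its trace norm is finite. -/
def IsTraceClass {L : Type*} [NormedAddCommGroup L] [InnerProductSpace ℂ L]
    (T : L →L[ℂ] L) : Prop := BddAbove (traceNormSet T)

variable {L}

theorem zero_mem_traceNormSet (T : L →L[ℂ] L) : (0 : ℝ) ∈ traceNormSet T :=
  ⟨0, Fin.elim0, Fin.elim0, ⟨fun i => i.elim0, fun i => i.elim0⟩,
    ⟨fun i => i.elim0, fun i => i.elim0⟩, by simp⟩

theorem le_traceNorm {T : L →L[ℂ] L} (hT : IsTraceClass T) {n : ℕ} {e f : Fin n → L}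
    (he : Orthonormal ℂ e) (hf : Orthonormal ℂ f) :
    ∑ i, ‖⟪f i, T (e i)⟫_ℂ‖ ≤ traceNorm T :=
  le_csSup hT ⟨n, e, f, he, hf, rfl⟩

theorem traceNorm_nonneg (T : L →L[ℂ] L) : 0 ≤ traceNorm T :=
  Real.sSup_nonneg' ⟨0, zero_mem_traceNormSet T, le_rfl⟩

theorem mem_upperBounds_add {S T : L →L[ℂ] L} (hS : IsTraceClass S) (hT : IsTraceClass T) :
    traceNorm S + traceNorm T ∈ upperBounds (traceNormSet (S + T)) := by
  rintro r ⟨n, e, f, he, hf, rfl⟩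
  calc ∑ i, ‖⟪f i, (S + T) (e i)⟫_ℂ‖
      ≤ ∑ i, (‖⟪f i, S (e i)⟫_ℂ‖ + ‖⟪f i, T (e i)⟫_ℂ‖) := by
        refine Finset.sum_le_sum fun i _ => ?_
        rw [add_apply, inner_add_right]
        exact norm_add_le _ _
    _ = ∑ i, ‖⟪f i, S (e i)⟫_ℂ‖ + ∑ i, ‖⟪f i, T (e i)⟫_ℂ‖ := Finset.sum_add_distrib
    _ ≤ _ := add_le_add (le_traceNorm hS he hf) (le_traceNorm hT he hf)

theorem mem_upperBounds_smul (c : ℂ) {T : L →L[ℂ] L} (hT : IsTraceClass T) :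
    ‖c‖ * traceNorm T ∈ upperBounds (traceNormSet (c • T)) := by
  rintro r ⟨n, e, f, he, hf, rfl⟩
  have : ∑ i, ‖⟪f i, (c • T) (e i)⟫_ℂ‖ = ‖c‖ * ∑ i, ‖⟪f i, T (e i)⟫_ℂ‖ := by
    rw [Finset.mul_sum]
    refine Finset.sum_congr rfl fun i _ => ?_
    simp
  rw [this]
  exact mul_le_mul_of_nonneg_left (le_traceNorm hT he hf) (norm_nonneg _)

theorem isTraceClass_zero : IsTraceClass (0 : L →L[ℂ] L) := by
  refine ⟨0, ?_⟩
  rintro r ⟨n, e, f, he, hf, rfl⟩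
  simp

theorem traceNorm_smul_le (c : ℂ) {T : L →L[ℂ] L} (hT : IsTraceClass T) :
    traceNorm (c • T) ≤ ‖c‖ * traceNorm T :=
  csSup_le ⟨0, zero_mem_traceNormSet _⟩ (mem_upperBounds_smul c hT)

theorem norm_inner_le_traceNorm {T : L →L[ℂ] L} (hT : IsTraceClass T) {x y : L}
    (hx : ‖x‖ = 1) (hy : ‖y‖ = 1) : ‖⟪y, T x⟫_ℂ‖ ≤ traceNorm T := by
  have h1 : ∀ z : L, ‖z‖ = 1 → Orthonormal ℂ (fun _ : Fin 1 => z) := fun z hz =>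
    ⟨fun _ => hz, fun i j hij => (hij (Subsingleton.elim i j)).elim⟩
  simpa using le_traceNorm hT (h1 x hx) (h1 y hy)

theorem norm_inner_le_traceNorm_mul {T : L →L[ℂ] L} (hT : IsTraceClass T) (x y : L) :
    ‖⟪y, T x⟫_ℂ‖ ≤ traceNorm T * ‖x‖ * ‖y‖ := by
  rcases eq_or_ne x 0 with rfl | hx
  · simp
  rcases eq_or_ne y 0 with rfl | hy
  · simp
  have hx' : ‖x‖ ≠ 0 := norm_ne_zero_iff.2 hx
  have hy' : ‖y‖ ≠ 0 := norm_ne_zero_iff.2 hy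
  have h := norm_inner_le_traceNorm hT (x := ((‖x‖⁻¹ : ℝ) : ℂ) • x) (y := ((‖y‖⁻¹ : ℝ) : ℂ) • y)
    (by simp [norm_smul, hx']) (by simp [norm_smul, hy'])
  rw [map_smul, inner_smul_left, inner_smul_right, norm_mul, norm_mul] at h
  simp only [RCLike.norm_conj, Complex.norm_real, norm_inv, norm_norm] at h
  have hxp : 0 < ‖x‖ := norm_pos_iff.2 hx
  have hyp : 0 < ‖y‖ := norm_pos_iff.2 hy
  calc ‖⟪y, T x⟫_ℂ‖
      = ‖y‖⁻¹ * (‖x‖⁻¹ * ‖⟪y, T x⟫_ℂ‖) * (‖x‖ * ‖y‖) := by field_simp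
    _ ≤ traceNorm T * (‖x‖ * ‖y‖) := mul_le_mul_of_nonneg_right h (by positivity)
    _ = traceNorm T * ‖x‖ * ‖y‖ := by ring

theorem opNorm_le_traceNorm {T : L →L[ℂ] L} (hT : IsTraceClass T) : ‖T‖ ≤ traceNorm T := by
  refine T.opNorm_le_bound (traceNorm_nonneg T) fun x => ?_
  have h := norm_inner_le_traceNorm_mul hT x (T x)
  rcases eq_or_ne (T x) 0 with h0 | h0
  · rw [h0, norm_zero]
    exact mul_nonneg (traceNorm_nonneg T) (norm_nonneg x)
  · rw [inner_self_eq_norm_sq_to_K] at h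
    simp only [norm_pow, RCLike.norm_ofReal, abs_norm] at h
    rw [sq] at h
    exact le_of_mul_le_mul_right h (norm_pos_iff.2 h0)

variable (L) in
/-- The trace class operators as a subspace of the bounded operators. -/
def traceClassSubmodule : Submodule ℂ (L →L[ℂ] L) where
  carrier := {T | IsTraceClass T}
  add_mem' hS hT := ⟨_, mem_upperBounds_add hS hT⟩
  zero_mem' := isTraceClass_zero
  smul_mem' c _ hT := ⟨_, mem_upperBounds_smul c hT⟩

variable (L) in
/-- The space `𝔗(L)` of trace class operators, normed by the trace norm. -/
def TraceClass : Type _ := traceClassSubmodule L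

instance : AddCommGroup (TraceClass L) := inferInstanceAs (AddCommGroup (traceClassSubmodule L))

instance : Module ℂ (TraceClass L) := inferInstanceAs (Module ℂ (traceClassSubmodule L))

/-- The operator underlying an element of `𝔗(L)`. -/
def TraceClass.op : TraceClass L →ₗ[ℂ] (L →L[ℂ] L) := (traceClassSubmodule L).subtype

theorem TraceClass.isTraceClass (T : TraceClass L) : IsTraceClass T.op := T.2

theorem TraceClass.op_injective : Function.Injective (TraceClass.op : TraceClass L → _) :=
  Subtype.val_injective

instance : Norm (TraceClass L) := ⟨fun T => traceNorm T.op⟩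

theorem TraceClass.norm_def (T : TraceClass L) : ‖T‖ = traceNorm T.op := rfl

theorem TraceClass.normCore : NormedSpace.Core ℂ (TraceClass L) where
  norm_nonneg T := traceNorm_nonneg _
  norm_smul c T := by
    rw [norm_def, norm_def, map_smul]
    refine le_antisymm (traceNorm_smul_le c T.isTraceClass) ?_
    rcases eq_or_ne c 0 with rfl | hc
    · simpa using traceNorm_nonneg _
    have h := traceNorm_smul_le c⁻¹ (T := c • T.op)
      ((traceClassSubmodule L).smul_mem c T.isTraceClass)
    rw [smul_smul, inv_mul_cancel₀ hc, one_smul, norm_inv] at h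
    rw [mul_comm]
    exact (le_inv_mul_iff₀' (norm_pos_iff.2 hc)).1 h
  norm_triangle S T := by
    rw [norm_def, norm_def, norm_def, map_add]
    exact csSup_le ⟨0, zero_mem_traceNormSet _⟩
      (mem_upperBounds_add S.isTraceClass T.isTraceClass)
  norm_eq_zero_iff T := by
    constructor
    · intro h
      apply TraceClass.op_injective
      rw [map_zero]
      have := opNorm_le_traceNorm T.isTraceClass
      rw [← norm_def, h] at this
      exact norm_le_zero_iff.1 this
    · rintro rfl
      have h := traceNorm_smul_le (0 : ℂ) (isTraceClass_zero (L := L))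
      rw [norm_def, map_zero]
      simp only [smul_zero, norm_zero, zero_mul] at h
      exact le_antisymm h (traceNorm_nonneg _)

instance : NormedAddCommGroup (TraceClass L) := .ofCore TraceClass.normCore

instance : NormedSpace ℂ (TraceClass L) := .ofCore TraceClass.normCore

/-- Trace class operators are compact. -/
theorem isCompactOperator_of_isTraceClass [CompleteSpace L] {T : L →L[ℂ] L}
    (hT : IsTraceClass T) : IsCompactOperator T := by
  classical
  have key : ∀ ε : ℝ, 0 < ε → ∃ F : L →L[ℂ] L, IsCompactOperator F ∧ ‖T - F‖ ≤ ε := by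
    intro ε hε
    let P : ℕ → Prop := fun n => ∃ e f : Fin n → L, Orthonormal ℂ e ∧ Orthonormal ℂ f ∧
      ∀ i, ε ≤ ‖⟪f i, T (e i)⟫_ℂ‖
    have hex : ∃ n, ¬ P n := by
      obtain ⟨n, hn⟩ := exists_nat_gt (traceNorm T / ε)
      refine ⟨n, ?_⟩
      rintro ⟨e, f, he, hf, h⟩
      have h1 : (n : ℝ) * ε ≤ ∑ i, ‖⟪f i, T (e i)⟫_ℂ‖ := by
        simpa using Finset.sum_le_sum fun i (_ : i ∈ Finset.univ) => h i
      have h2 := h1.trans (le_traceNorm hT he hf)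
      rw [div_lt_iff₀ hε] at hn
      linarith
    have h0 : P 0 := ⟨Fin.elim0, Fin.elim0, ⟨fun i => i.elim0, fun i => i.elim0⟩,
      ⟨fun i => i.elim0, fun i => i.elim0⟩, fun i => i.elim0⟩
    obtain ⟨m, hm, hm'⟩ : ∃ m, P m ∧ ¬ P (m + 1) := by
      by_contra hcon
      push Not at hcon
      obtain ⟨n, hn⟩ := hex
      exact hn (Nat.rec h0 hcon n)
    obtain ⟨e, f, he, hf, hef⟩ := hm
    let E : Submodule ℂ L := Submodule.span ℂ (Set.range e)
    let F : Submodule ℂ L := Submodule.span ℂ (Set.range f)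
    have : FiniteDimensional ℂ E := FiniteDimensional.span_of_finite ℂ (Set.finite_range e)
    have : FiniteDimensional ℂ F := FiniteDimensional.span_of_finite ℂ (Set.finite_range f)
    have hunit : ∀ x ∈ Eᗮ, ∀ y ∈ Fᗮ, ‖x‖ = 1 → ‖y‖ = 1 → ‖⟪y, T x⟫_ℂ‖ ≤ ε := by
      intro x hx y hy hx1 hy1
      by_contra hlt
      push Not at hlt
      refine hm' ⟨Matrix.vecCons x e, Matrix.vecCons y f, ?_, ?_, ?_⟩
      · exact orthonormal_vecCons_iff.2 ⟨hx1, fun i =>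
          (Submodule.mem_orthogonal' _ _).1 hx _ (Submodule.subset_span ⟨i, rfl⟩), he⟩
      · exact orthonormal_vecCons_iff.2 ⟨hy1, fun i =>
          (Submodule.mem_orthogonal' _ _).1 hy _ (Submodule.subset_span ⟨i, rfl⟩), hf⟩
      · intro i
        refine Fin.cases ?_ (fun j => ?_) i
        · simpa using hlt.le
        · simpa using hef j
    have hall : ∀ x ∈ Eᗮ, ∀ y ∈ Fᗮ, ‖⟪y, T x⟫_ℂ‖ ≤ ε * ‖x‖ * ‖y‖ := by
      intro x hx y hy
      rcases eq_or_ne x 0 with rfl | hx0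
      · simp
      rcases eq_or_ne y 0 with rfl | hy0
      · simp
      have hxp : 0 < ‖x‖ := norm_pos_iff.2 hx0
      have hyp : 0 < ‖y‖ := norm_pos_iff.2 hy0
      have h := hunit (((‖x‖⁻¹ : ℝ) : ℂ) • x) (Submodule.smul_mem _ _ hx)
        (((‖y‖⁻¹ : ℝ) : ℂ) • y) (Submodule.smul_mem _ _ hy)
        (by simp [norm_smul, hxp.ne']) (by simp [norm_smul, hyp.ne'])
      rw [map_smul, inner_smul_left, inner_smul_right, norm_mul, norm_mul] at h
      simp only [RCLike.norm_conj, Complex.norm_real, norm_inv, norm_norm] at h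
      calc ‖⟪y, T x⟫_ℂ‖
          = ‖y‖⁻¹ * (‖x‖⁻¹ * ‖⟪y, T x⟫_ℂ‖) * (‖x‖ * ‖y‖) := by field_simp
        _ ≤ ε * (‖x‖ * ‖y‖) := mul_le_mul_of_nonneg_right h (by positivity)
        _ = ε * ‖x‖ * ‖y‖ := by ring
    have hlE : ProperSpace E := FiniteDimensional.proper ℂ E
    have hlF : ProperSpace F := FiniteDimensional.proper ℂ F
    have hcE' : IsCompactOperator E.orthogonalProjectionOnto :=
      isCompactOperator_of_locallyCompactSpace_dom E.orthogonalProjectionOnto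
    have hcF' : IsCompactOperator F.orthogonalProjectionOnto :=
      isCompactOperator_of_locallyCompactSpace_dom F.orthogonalProjectionOnto
    have hcE : IsCompactOperator E.starProjection := hcE'.clm_comp E.subtypeL
    have hcF : IsCompactOperator F.starProjection := hcF'.clm_comp F.subtypeL
    refine ⟨F.starProjection ∘L T + Fᗮ.starProjection ∘L T ∘L E.starProjection, ?_, ?_⟩
    · exact (hcF.comp_clm T).add ((hcE.clm_comp T).clm_comp Fᗮ.starProjection)
    · refine ContinuousLinearMap.opNorm_le_bound _ hε.le fun x => ?_
      set z : L := (T - (F.starProjection ∘L T + Fᗮ.starProjection ∘L T ∘L E.starProjection)) x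
        with hz
      have hzeq : z = Fᗮ.starProjection (T (Eᗮ.starProjection x)) := by
        rw [hz]
        have h1 : T x = F.starProjection (T x) + Fᗮ.starProjection (T x) :=
          (F.starProjection_add_starProjection_orthogonal (T x)).symm
        have h2 : Eᗮ.starProjection x = x - E.starProjection x := by
          rw [eq_sub_iff_add_eq, add_comm]
          exact E.starProjection_add_starProjection_orthogonal x
        rw [h2, map_sub, map_sub]
        simp only [sub_apply, add_apply, ContinuousLinearMap.comp_apply]
        nth_rewrite 1 [h1]
        abel
      have hzF : z ∈ Fᗮ := by
        rw [hzeq]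
        exact Submodule.starProjection_apply_mem _ _
      have h3 : ‖⟪z, T (Eᗮ.starProjection x)⟫_ℂ‖ = ‖z‖ * ‖z‖ := by
        have : ⟪z, T (Eᗮ.starProjection x)⟫_ℂ = ⟪z, z⟫_ℂ :=
          calc ⟪z, T (Eᗮ.starProjection x)⟫_ℂ
              = ⟪Fᗮ.starProjection z, T (Eᗮ.starProjection x)⟫_ℂ := by
                rw [Submodule.starProjection_eq_self_iff.2 hzF]
            _ = ⟪z, Fᗮ.starProjection (T (Eᗮ.starProjection x))⟫_ℂ :=
                Submodule.inner_starProjection_left_eq_right _ _ _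
            _ = ⟪z, z⟫_ℂ := by rw [← hzeq]
        rw [this, inner_self_eq_norm_sq_to_K]
        simp [sq]
      have h4 := hall _ (Submodule.starProjection_apply_mem Eᗮ x) z hzF
      rw [h3] at h4
      have h5 : ‖Eᗮ.starProjection x‖ ≤ ‖x‖ := Submodule.norm_starProjection_apply_le _ _
      rcases eq_or_ne z 0 with h0 | h0
      · rw [h0, norm_zero]
        positivity
      · exact (le_of_mul_le_mul_right h4 (norm_pos_iff.2 h0)).trans
          (mul_le_mul_of_nonneg_left h5 hε.le)
  have hmem : T ∈ closure {F : L →L[ℂ] L | IsCompactOperator F} := by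
    rw [Metric.mem_closure_iff]
    intro ε hε
    obtain ⟨F, hF, h⟩ := key (ε / 2) (half_pos hε)
    exact ⟨F, hF, by rw [dist_eq_norm]; linarith⟩
  rwa [(isClosed_setOfPred_isCompactOperator (σ₁₂ := RingHom.id ℂ) (M₁ := L) (M₂ := L)).closure_eq]
    at hmem

/-- The trace `Tr T = ∑ ⟪e, T e⟫` over an orthonormal basis of the Hilbert space. (The value on
a trace class operator does not depend on the basis.) -/
def trace [CompleteSpace L] (T : L →L[ℂ] L) : ℂ :=
  ∑' v : (exists_hilbertBasis ℂ L).choose, ⟪(v : L), T (v : L)⟫_ℂ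

variable (L) in
/-- The ultraweak (σ-weak, `*`-weak) topology of the algebra of bounded operators: the weak topology
`σ(B(L), 𝔗(L))` given by the functionals `a ↦ Tr (ϱ a)`, `ϱ` of trace class. -/
abbrev ultraweakTopology [CompleteSpace L] : TopologicalSpace (L →L[ℂ] L) :=
  ⨅ ϱ : TraceClass L, TopologicalSpace.induced (fun a => trace (ϱ.op ∘L a)) inferInstance

end TraceClassSection

/-! ## Projective and injective tensor products of Banach spaces -/

section Tensor

variable (X Y : Type*) [NormedAddCommGroup X] [NormedSpace ℂ X]
  [NormedAddCommGroup Y] [NormedSpace ℂ Y]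

/-- The numbers `∑ i, ‖x i‖ * ‖y i‖` over the representations `u = ∑ i, x i ⊗ y i`. -/
def projNormSet {X Y : Type*} [NormedAddCommGroup X] [NormedSpace ℂ X]
    [NormedAddCommGroup Y] [NormedSpace ℂ Y] (u : X ⊗[ℂ] Y) : Set ℝ :=
  {r | ∃ (n : ℕ) (x : Fin n → X) (y : Fin n → Y),
    u = ∑ i, x i ⊗ₜ[ℂ] y i ∧ r = ∑ i, ‖x i‖ * ‖y i‖}

/-- The projective norm. -/
def projNorm {X Y : Type*} [NormedAddCommGroup X] [NormedSpace ℂ X]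
    [NormedAddCommGroup Y] [NormedSpace ℂ Y] (u : X ⊗[ℂ] Y) : ℝ := sInf (projNormSet u)

/-- The numbers `|(f ⊗ g) u|` with `f`, `g` in the unit balls of the dual spaces. -/
def injNormSet {X Y : Type*} [NormedAddCommGroup X] [NormedSpace ℂ X]
    [NormedAddCommGroup Y] [NormedSpace ℂ Y] (u : X ⊗[ℂ] Y) : Set ℝ :=
  {r | ∃ (f : StrongDual ℂ X) (g : StrongDual ℂ Y), ‖f‖ ≤ 1 ∧ ‖g‖ ≤ 1 ∧
    r = ‖TensorProduct.lid ℂ ℂ (TensorProduct.map f.toLinearMap g.toLinearMap u)‖}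

/-- The injective norm. -/
def injNorm {X Y : Type*} [NormedAddCommGroup X] [NormedSpace ℂ X]
    [NormedAddCommGroup Y] [NormedSpace ℂ Y] (u : X ⊗[ℂ] Y) : ℝ := sSup (injNormSet u)

variable {X Y}

theorem projNormSet_nonempty (u : X ⊗[ℂ] Y) : (projNormSet u).Nonempty := by
  obtain ⟨S, hS⟩ := TensorProduct.exists_finset u
  let e := S.equivFin
  refine ⟨_, S.card, fun i => (e.symm i).1.1, fun i => (e.symm i).1.2, ?_, rfl⟩
  rw [hS, ← Finset.sum_coe_sort S fun i => i.1 ⊗ₜ[ℂ] i.2]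
  exact (Equiv.sum_comp e.symm fun i : S => i.1.1 ⊗ₜ[ℂ] i.1.2).symm

theorem projNormSet_nonneg {u : X ⊗[ℂ] Y} {r : ℝ} (hr : r ∈ projNormSet u) : 0 ≤ r := by
  obtain ⟨n, x, y, -, rfl⟩ := hr
  positivity

theorem projNorm_le {u : X ⊗[ℂ] Y} {r : ℝ} (hr : r ∈ projNormSet u) : projNorm u ≤ r :=
  csInf_le ⟨0, fun _ => projNormSet_nonneg⟩ hr

theorem projNorm_nonneg (u : X ⊗[ℂ] Y) : 0 ≤ projNorm u :=
  le_csInf (projNormSet_nonempty u) fun _ => projNormSet_nonneg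

theorem projNorm_add_le (u v : X ⊗[ℂ] Y) : projNorm (u + v) ≤ projNorm u + projNorm v := by
  refine le_of_forall_pos_le_add fun ε hε => ?_
  obtain ⟨r, ⟨n, x, y, hu, rfl⟩, hr⟩ :=
    exists_lt_of_csInf_lt (projNormSet_nonempty u) (lt_add_of_pos_right (projNorm u) (half_pos hε))
  obtain ⟨s, ⟨m, x', y', hv, rfl⟩, hs⟩ :=
    exists_lt_of_csInf_lt (projNormSet_nonempty v) (lt_add_of_pos_right (projNorm v) (half_pos hε))
  have := projNorm_le (u := u + v)
    ⟨n + m, Fin.append x x', Fin.append y y', by simp [Fin.sum_univ_add, hu, hv], rfl⟩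
  simp only [Fin.sum_univ_add, Fin.append_left, Fin.append_right] at this
  linarith

theorem projNorm_smul_le (c : ℂ) (u : X ⊗[ℂ] Y) : projNorm (c • u) ≤ ‖c‖ * projNorm u := by
  refine le_of_forall_pos_le_add fun ε hε => ?_
  have hc : 0 < ‖c‖ + 1 := by positivity
  obtain ⟨r, ⟨n, x, y, hu, rfl⟩, hr⟩ := exists_lt_of_csInf_lt (projNormSet_nonempty u)
    (lt_add_of_pos_right (projNorm u) (div_pos hε hc))
  have h := projNorm_le (u := c • u) ⟨n, fun i => c • x i, y,
    by simp [hu, Finset.smul_sum, TensorProduct.smul_tmul'], rfl⟩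
  have h2 : ∑ i, ‖c • x i‖ * ‖y i‖ = ‖c‖ * ∑ i, ‖x i‖ * ‖y i‖ := by
    rw [Finset.mul_sum]
    exact Finset.sum_congr rfl fun i _ => by rw [norm_smul, mul_assoc]
  rw [h2] at h
  refine h.trans ((mul_le_mul_of_nonneg_left hr.le (norm_nonneg c)).trans ?_)
  change ‖c‖ * (projNorm u + ε / (‖c‖ + 1)) ≤ _
  rw [mul_add]
  gcongr
  rw [← mul_div_assoc, div_le_iff₀ hc]
  nlinarith

theorem injNormSet_le {u : X ⊗[ℂ] Y} {r : ℝ} (hr : r ∈ injNormSet u) : r ≤ projNorm u := by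
  obtain ⟨f, g, hf, hg, rfl⟩ := hr
  refine le_csInf (projNormSet_nonempty u) ?_
  rintro s ⟨n, x, y, rfl, rfl⟩
  simp only [map_sum, TensorProduct.map_tmul, TensorProduct.lid_tmul]
  refine (norm_sum_le _ _).trans (Finset.sum_le_sum fun i _ => ?_)
  rw [norm_smul]
  exact mul_le_mul (f.le_of_opNorm_le hf _ |>.trans (one_mul _).le)
    (g.le_of_opNorm_le hg _ |>.trans (one_mul _).le) (norm_nonneg _) (norm_nonneg _)

theorem zero_mem_injNormSet (u : X ⊗[ℂ] Y) : (0 : ℝ) ∈ injNormSet u :=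
  ⟨0, 0, by simp, by simp, by simp⟩

theorem injNorm_nonneg (u : X ⊗[ℂ] Y) : 0 ≤ injNorm u :=
  Real.sSup_nonneg' ⟨0, zero_mem_injNormSet u, le_rfl⟩

theorem le_injNorm {u : X ⊗[ℂ] Y} {f : StrongDual ℂ X} {g : StrongDual ℂ Y}
    (hf : ‖f‖ ≤ 1) (hg : ‖g‖ ≤ 1) :
    ‖TensorProduct.lid ℂ ℂ (TensorProduct.map f.toLinearMap g.toLinearMap u)‖ ≤ injNorm u :=
  le_csSup ⟨projNorm u, fun _ => injNormSet_le⟩ ⟨f, g, hf, hg, rfl⟩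

variable (X Y)

/-- The algebraic tensor product with the projective norm. -/
def ProjTensor : Type _ := X ⊗[ℂ] Y

/-- The algebraic tensor product with the injective norm. -/
def InjTensor : Type _ := X ⊗[ℂ] Y

instance : AddCommGroup (ProjTensor X Y) := inferInstanceAs (AddCommGroup (X ⊗[ℂ] Y))

instance : Module ℂ (ProjTensor X Y) := inferInstanceAs (Module ℂ (X ⊗[ℂ] Y))

instance : AddCommGroup (InjTensor X Y) := inferInstanceAs (AddCommGroup (X ⊗[ℂ] Y))

instance : Module ℂ (InjTensor X Y) := inferInstanceAs (Module ℂ (X ⊗[ℂ] Y))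

/-- The identification of the algebraic tensor product with its normed copy. -/
def ProjTensor.of : (X ⊗[ℂ] Y) ≃ₗ[ℂ] ProjTensor X Y := LinearEquiv.refl ℂ (X ⊗[ℂ] Y)

/-- The identification of the algebraic tensor product with its normed copy. -/
def InjTensor.of : (X ⊗[ℂ] Y) ≃ₗ[ℂ] InjTensor X Y := LinearEquiv.refl ℂ (X ⊗[ℂ] Y)

instance : Norm (ProjTensor X Y) := ⟨fun u => projNorm ((ProjTensor.of X Y).symm u)⟩

instance : Norm (InjTensor X Y) := ⟨fun u => injNorm ((InjTensor.of X Y).symm u)⟩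

theorem ProjTensor.norm_def (u : ProjTensor X Y) : ‖u‖ = projNorm ((ProjTensor.of X Y).symm u) :=
  rfl

theorem InjTensor.norm_def (u : InjTensor X Y) : ‖u‖ = injNorm ((InjTensor.of X Y).symm u) :=
  rfl

theorem ProjTensor.core : SeminormedSpace.Core ℂ (ProjTensor X Y) where
  norm_nonneg u := projNorm_nonneg _
  norm_triangle u v := by
    rw [norm_def, norm_def, norm_def, map_add]
    exact projNorm_add_le _ _
  norm_smul c u := by
    rw [norm_def, norm_def, map_smul]
    refine le_antisymm (projNorm_smul_le c _) ?_
    rcases eq_or_ne c 0 with rfl | hc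
    · rw [norm_zero, zero_mul]
      exact projNorm_nonneg _
    have h := projNorm_smul_le c⁻¹ (c • (ProjTensor.of X Y).symm u)
    rw [smul_smul, inv_mul_cancel₀ hc, norm_inv, one_smul] at h
    rw [mul_comm]
    exact (le_inv_mul_iff₀' (norm_pos_iff.2 hc)).1 h

theorem InjTensor.core : SeminormedSpace.Core ℂ (InjTensor X Y) where
  norm_nonneg u := injNorm_nonneg _
  norm_triangle u v := by
    rw [norm_def, norm_def, norm_def, map_add]
    refine csSup_le ⟨0, zero_mem_injNormSet _⟩ ?_
    rintro r ⟨f, g, hf, hg, rfl⟩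
    rw [map_add, map_add]
    exact (norm_add_le _ _).trans (add_le_add (le_injNorm hf hg) (le_injNorm hf hg))
  norm_smul c u := by
    have key : ∀ (c : ℂ) (u : X ⊗[ℂ] Y), injNorm (c • u) ≤ ‖c‖ * injNorm u := by
      intro c u
      refine csSup_le ⟨0, zero_mem_injNormSet _⟩ ?_
      rintro r ⟨f, g, hf, hg, rfl⟩
      rw [map_smul, map_smul, norm_smul]
      exact mul_le_mul_of_nonneg_left (le_injNorm hf hg) (norm_nonneg c)
    rw [norm_def, norm_def, map_smul]
    refine le_antisymm (key c _) ?_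
    rcases eq_or_ne c 0 with rfl | hc
    · rw [norm_zero, zero_mul]
      exact injNorm_nonneg _
    have h := key c⁻¹ (c • (InjTensor.of X Y).symm u)
    rw [smul_smul, inv_mul_cancel₀ hc, norm_inv, one_smul] at h
    rw [mul_comm]
    exact (le_inv_mul_iff₀' (norm_pos_iff.2 hc)).1 h

instance : SeminormedAddCommGroup (ProjTensor X Y) := .ofCore (ProjTensor.core X Y)

instance : NormedSpace ℂ (ProjTensor X Y) where
  norm_smul_le c u := ((ProjTensor.core X Y).norm_smul c u).le

instance : SeminormedAddCommGroup (InjTensor X Y) := .ofCore (InjTensor.core X Y)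

instance : NormedSpace ℂ (InjTensor X Y) where
  norm_smul_le c u := ((InjTensor.core X Y).norm_smul c u).le

/-- The projective tensor product `X ⊗_π Y` of Banach spaces: the completion. -/
def ProjectiveTensor : Type _ := UniformSpace.Completion (ProjTensor X Y)

instance : NormedAddCommGroup (ProjectiveTensor X Y) :=
  inferInstanceAs (NormedAddCommGroup (UniformSpace.Completion (ProjTensor X Y)))

instance : NormedSpace ℂ (ProjectiveTensor X Y) :=
  inferInstanceAs (NormedSpace ℂ (UniformSpace.Completion (ProjTensor X Y)))

instance : CompleteSpace (ProjectiveTensor X Y) :=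
  inferInstanceAs (CompleteSpace (UniformSpace.Completion (ProjTensor X Y)))

/-- The injective tensor product `X ⊗_ε Y` of Banach spaces: the completion. -/
def InjectiveTensor : Type _ := UniformSpace.Completion (InjTensor X Y)

instance : NormedAddCommGroup (InjectiveTensor X Y) :=
  inferInstanceAs (NormedAddCommGroup (UniformSpace.Completion (InjTensor X Y)))

instance : NormedSpace ℂ (InjectiveTensor X Y) :=
  inferInstanceAs (NormedSpace ℂ (UniformSpace.Completion (InjTensor X Y)))

instance : CompleteSpace (InjectiveTensor X Y) :=
  inferInstanceAs (CompleteSpace (UniformSpace.Completion (InjTensor X Y)))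

/-- The projective tensor product is the completion of the algebraic one. -/
def ProjectiveTensor.ofCompletion :
    UniformSpace.Completion (ProjTensor X Y) ≃ₗᵢ[ℂ] ProjectiveTensor X Y :=
  LinearIsometryEquiv.refl ℂ (UniformSpace.Completion (ProjTensor X Y))

/-- The injective tensor product is the completion of the algebraic one. -/
def InjectiveTensor.ofCompletion :
    UniformSpace.Completion (InjTensor X Y) ≃ₗᵢ[ℂ] InjectiveTensor X Y :=
  LinearIsometryEquiv.refl ℂ (UniformSpace.Completion (InjTensor X Y))

variable {X Y}

/-- The elementary tensor `x ⊗ y` in `X ⊗_π Y`. -/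
def ptmul (x : X) (y : Y) : ProjectiveTensor X Y :=
  ProjectiveTensor.ofCompletion X Y (ProjTensor.of X Y (x ⊗ₜ[ℂ] y))

/-- The elementary tensor `x ⊗ y` in `X ⊗_ε Y`. -/
def itmul (x : X) (y : Y) : InjectiveTensor X Y :=
  InjectiveTensor.ofCompletion X Y (InjTensor.of X Y (x ⊗ₜ[ℂ] y))

/-- The linearization of a bilinear map of norm at most one on the projective tensor product. -/
def projLift {Z : Type*} [NormedAddCommGroup Z] [NormedSpace ℂ Z] [CompleteSpace Z]
    (B : X →ₗ[ℂ] Y →ₗ[ℂ] Z) (hB : ∀ x y, ‖B x y‖ ≤ ‖x‖ * ‖y‖) : ProjectiveTensor X Y →L[ℂ] Z :=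
  (ContinuousLinearMap.fromCompletion
    (LinearMap.mkContinuous (TensorProduct.lift B ∘ₗ (ProjTensor.of X Y).symm.toLinearMap) 1
      fun u => by
      rw [one_mul, ProjTensor.norm_def]
      refine le_csInf (projNormSet_nonempty _) ?_
      rintro r ⟨n, x, y, hu, rfl⟩
      rw [LinearMap.comp_apply, LinearEquiv.coe_coe, hu, map_sum]
      simp only [TensorProduct.lift.tmul]
      exact (norm_sum_le _ _).trans (Finset.sum_le_sum fun i _ => hB _ _))) ∘L
    ((ProjectiveTensor.ofCompletion X Y).symm.toContinuousLinearEquiv :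
      ProjectiveTensor X Y →L[ℂ] UniformSpace.Completion (ProjTensor X Y))

theorem projLift_ptmul {Z : Type*} [NormedAddCommGroup Z] [NormedSpace ℂ Z] [CompleteSpace Z]
    (B : X →ₗ[ℂ] Y →ₗ[ℂ] Z) (hB : ∀ x y, ‖B x y‖ ≤ ‖x‖ * ‖y‖) (x : X) (y : Y) :
    projLift B hB (ptmul x y) = B x y := by
  simp [projLift, ptmul]

end Tensor

/-! ## Operators on the Hilbert tensor product -/

section HilbertTensor

variable (H K : Type*) [NormedAddCommGroup H] [InnerProductSpace ℂ H]
  [NormedAddCommGroup K] [InnerProductSpace ℂ K]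

/-- The Hilbert space tensor product `H ⊗ K`: the completion of the algebraic tensor product for
the inner product with `⟪f ⊗ g, f' ⊗ g'⟫ = ⟪f, f'⟫ ⟪g, g'⟫`. -/
def HTensor : Type _ := UniformSpace.Completion (H ⊗[ℂ] K)

instance : NormedAddCommGroup (HTensor H K) :=
  inferInstanceAs (NormedAddCommGroup (UniformSpace.Completion (H ⊗[ℂ] K)))

instance : InnerProductSpace ℂ (HTensor H K) :=
  inferInstanceAs (InnerProductSpace ℂ (UniformSpace.Completion (H ⊗[ℂ] K)))

instance : CompleteSpace (HTensor H K) :=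
  inferInstanceAs (CompleteSpace (UniformSpace.Completion (H ⊗[ℂ] K)))

/-- The Hilbert space tensor product is the completion of the algebraic one. -/
def HTensor.ofCompletion : UniformSpace.Completion (H ⊗[ℂ] K) ≃ₗᵢ[ℂ] HTensor H K :=
  LinearIsometryEquiv.refl ℂ (UniformSpace.Completion (H ⊗[ℂ] K))

/-- The isometric embedding of the algebraic tensor product. -/
def HTensor.of : H ⊗[ℂ] K →ₗᵢ[ℂ] HTensor H K :=
  (HTensor.ofCompletion H K).toLinearIsometry.comp UniformSpace.Completion.toComplₗᵢ

variable {H K}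

theorem HTensor.denseRange_of : DenseRange (HTensor.of H K) :=
  UniformSpace.Completion.denseRange_coe

/-- The vector `f ⊗ g`. -/
def htmul (f : H) (g : K) : HTensor H K := HTensor.of H K (f ⊗ₜ[ℂ] g)

theorem inner_htmul (f f' : H) (g g' : K) :
    ⟪htmul f g, htmul f' g'⟫_ℂ = ⟪f, f'⟫_ℂ * ⟪g, g'⟫_ℂ := by
  simp [htmul]

/-- The operator `a ⊗ b` on `H ⊗ K`: the continuous extension of the algebraic one. -/
def tensorOp (a : H →L[ℂ] H) (b : K →L[ℂ] K) : HTensor H K →L[ℂ] HTensor H K :=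
  ((HTensor.ofCompletion H K).toContinuousLinearEquiv :
      UniformSpace.Completion (H ⊗[ℂ] K) →L[ℂ] HTensor H K) ∘L
    (TensorProduct.mapL a b).completion ∘L
    ((HTensor.ofCompletion H K).symm.toContinuousLinearEquiv :
      HTensor H K →L[ℂ] UniformSpace.Completion (H ⊗[ℂ] K))

theorem tensorOp_of (a : H →L[ℂ] H) (b : K →L[ℂ] K) (u : H ⊗[ℂ] K) :
    tensorOp a b (HTensor.of H K u) = HTensor.of H K (TensorProduct.mapL a b u) := by
  simp [tensorOp, HTensor.of]

theorem tensorOp_htmul (a : H →L[ℂ] H) (b : K →L[ℂ] K) (f : H) (g : K) :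
    tensorOp a b (htmul f g) = htmul (a f) (b g) := by
  rw [htmul, tensorOp_of, TensorProduct.mapL_tmul, htmul]

theorem norm_tensorOp_le (a : H →L[ℂ] H) (b : K →L[ℂ] K) : ‖tensorOp a b‖ ≤ ‖a‖ * ‖b‖ := by
  refine ContinuousLinearMap.opNorm_le_bound _ (by positivity) fun x => ?_
  refine HTensor.denseRange_of.induction_on (p := fun x => ‖tensorOp a b x‖ ≤ ‖a‖ * ‖b‖ * ‖x‖) x
    (isClosed_le (by fun_prop) (by fun_prop)) fun u => ?_
  rw [tensorOp_of, LinearIsometry.norm_map, LinearIsometry.norm_map]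
  exact (TensorProduct.mapL a b).le_of_opNorm_le (TensorProduct.norm_mapL_le a b) u

theorem HTensor.ext_of {S T : HTensor H K →L[ℂ] HTensor H K}
    (h : ∀ u : H ⊗[ℂ] K, S (HTensor.of H K u) = T (HTensor.of H K u)) : S = T := by
  ext x
  exact HTensor.denseRange_of.induction_on (p := fun x => S x = T x) x
    (isClosed_eq S.continuous T.continuous) h

theorem tensorOp_add_left (a a' : H →L[ℂ] H) (b : K →L[ℂ] K) :
    tensorOp (a + a') b = tensorOp a b + tensorOp a' b :=
  HTensor.ext_of fun u => by
    rw [add_apply, tensorOp_of, tensorOp_of, tensorOp_of,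
      TensorProduct.mapL_add_left, add_apply, map_add]

theorem tensorOp_add_right (a : H →L[ℂ] H) (b b' : K →L[ℂ] K) :
    tensorOp a (b + b') = tensorOp a b + tensorOp a b' :=
  HTensor.ext_of fun u => by
    rw [add_apply, tensorOp_of, tensorOp_of, tensorOp_of,
      TensorProduct.mapL_add_right, add_apply, map_add]

theorem tensorOp_smul_left (c : ℂ) (a : H →L[ℂ] H) (b : K →L[ℂ] K) :
    tensorOp (c • a) b = c • tensorOp a b :=
  HTensor.ext_of fun u => by
    rw [smul_apply, tensorOp_of, tensorOp_of,
      TensorProduct.mapL_smul_left, smul_apply, map_smul]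

theorem tensorOp_smul_right (c : ℂ) (a : H →L[ℂ] H) (b : K →L[ℂ] K) :
    tensorOp a (c • b) = c • tensorOp a b :=
  HTensor.ext_of fun u => by
    rw [smul_apply, tensorOp_of, tensorOp_of,
      TensorProduct.mapL_smul_right, smul_apply, map_smul]

/-- The compact operators `𝔎(K)`, a norm closed subspace of the bounded operators. -/
abbrev CompactOps (K : Type*) [NormedAddCommGroup K] [InnerProductSpace ℂ K] :
    Submodule ℂ (K →L[ℂ] K) := compactOperator (RingHom.id ℂ) K K

variable (H K) in
/-- The C*-algebra `B(H) ⊗ 𝔎(K)`: the operator norm closure, in the bounded operators on the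
Hilbert space `H ⊗ K`, of the linear span (a `*`-algebra) of the operators `a ⊗ k` with `a` bounded
and `k` compact. -/
def bkAlg : Submodule ℂ (HTensor H K →L[ℂ] HTensor H K) :=
  (Submodule.span ℂ {T | ∃ (a : H →L[ℂ] H), ∃ k ∈ CompactOps K, T = tensorOp a k}).topologicalClosure

theorem isClosed_bkAlg : IsClosed (bkAlg H K : Set (HTensor H K →L[ℂ] HTensor H K)) :=
  Submodule.isClosed_topologicalClosure _

instance : CompleteSpace (bkAlg H K) :=
  isClosed_bkAlg.isComplete.completeSpace_coe

theorem tensorOp_mem_bkAlg (a : H →L[ℂ] H) {k : K →L[ℂ] K} (hk : k ∈ CompactOps K) :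
    tensorOp a k ∈ bkAlg H K :=
  Submodule.le_topologicalClosure _ (Submodule.subset_span ⟨a, k, hk, rfl⟩)

/-- The element `a ⊗ k` of `B(H) ⊗ 𝔎(K)`. -/
def bkTmul (a : H →L[ℂ] H) (k : CompactOps K) : bkAlg H K :=
  ⟨tensorOp a k, tensorOp_mem_bkAlg a k.2⟩

/-- The complex conjugation of the Hilbert space with respect to an orthonormal basis. -/
def conjBasis {ι : Type*} (e : HilbertBasis ι ℂ K) : K →SL[starRingEnd ℂ] K :=
  LinearMap.mkContinuous
    { toFun := fun x => e.repr.symm (star (e.repr x))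
      map_add' := fun x y => by simp
      map_smul' := fun c x => by simp [star_smul] } 1
    (fun x => by simp)

theorem conjBasis_self {ι : Type*} (e : HilbertBasis ι ℂ K) (i : ι) : conjBasis e (e i) = e i := by
  classical
  have h : conjBasis e (e i) = e.repr.symm (star (e.repr (e i))) := rfl
  rw [h, e.repr_self, ← e.repr_symm_single]
  congr 1
  ext j
  rcases eq_or_ne j i with rfl | hij
  · simp
  · simp [hij]

theorem inner_conjBasis {ι : Type*} (e : HilbertBasis ι ℂ K) (i : ι) (x : K) :
    ⟪e i, conjBasis e x⟫_ℂ = ⟪x, e i⟫_ℂ := by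
  have h : conjBasis e x = e.repr.symm (star (e.repr x)) := rfl
  rw [h, ← e.repr_apply_apply, LinearIsometryEquiv.apply_symm_apply, ← inner_conj_symm x,
    ← e.repr_apply_apply]
  rfl

variable [CompleteSpace K]

theorem TraceClass.mem_compactOps (b : TraceClass K) : b.op ∈ CompactOps K :=
  isCompactOperator_of_isTraceClass b.isTraceClass

/-- The bilinear map `(a, b) ↦ a ⊗ b` from `B(H) × 𝔗(K)` to `B(H) ⊗ 𝔎(K)`. -/
def tensorBilin : (H →L[ℂ] H) →ₗ[ℂ] TraceClass K →ₗ[ℂ] bkAlg H K :=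
  LinearMap.mk₂ ℂ
    (fun a b => ⟨tensorOp a b.op, tensorOp_mem_bkAlg a b.mem_compactOps⟩)
    (fun a a' b => Subtype.ext (tensorOp_add_left a a' b.op))
    (fun c a b => Subtype.ext (tensorOp_smul_left c a b.op))
    (fun a b b' => Subtype.ext (tensorOp_add_right a b.op b'.op))
    (fun c a b => Subtype.ext (tensorOp_smul_right c a b.op))

theorem norm_tensorBilin_le (a : H →L[ℂ] H) (b : TraceClass K) :
    ‖(tensorBilin a b : bkAlg H K)‖ ≤ ‖a‖ * ‖b‖ := by
  have h : ‖(tensorBilin a b : bkAlg H K)‖ = ‖tensorOp a b.op‖ := rfl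
  rw [h, TraceClass.norm_def]
  exact (norm_tensorOp_le a b.op).trans
    (mul_le_mul_of_nonneg_left (opNorm_le_traceNorm b.isTraceClass) (norm_nonneg a))

variable (H K) in
/-- The space `B(H) ⊗_π 𝔗(K)`. -/
abbrev BPiT : Type _ := ProjectiveTensor (H →L[ℂ] H) (TraceClass K)

variable (H K) in
/-- The space `B(H) ⊗_ε 𝔎(K)`. -/
abbrev BEpsK : Type _ := InjectiveTensor (H →L[ℂ] H) (CompactOps K)

/-- The canonical contraction `B(H) ⊗_π 𝔗(K) → B(H) ⊗ 𝔎(K)`, by which the elements of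
`B(H) ⊗_π 𝔗(K)` act as operators on `H ⊗ K`. -/
def canonicalMap : BPiT H K →L[ℂ] bkAlg H K :=
  projLift (tensorBilin (H := H) (K := K)) norm_tensorBilin_le

theorem canonicalMap_ptmul (a : H →L[ℂ] H) (b : TraceClass K) :
    ((canonicalMap (ptmul a b) : bkAlg H K) : HTensor H K →L[ℂ] HTensor H K) = tensorOp a b.op := by
  unfold canonicalMap
  rw [projLift_ptmul]
  rfl

/-- A functional on `B(H) ⊗ 𝔎(K)` restricted to `B(H) ⊗_π 𝔗(K)`. -/
def restrictFunctional (ρ : StrongDual ℂ (bkAlg H K)) : StrongDual ℂ (BPiT H K) :=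
  ρ ∘L canonicalMap

/-! ## Normal and singular functionals -/

variable [CompleteSpace H]

/-- Ultraweak continuity of a functional on the C*-algebra `B(H) ⊗ 𝔎(K)`, which acts on
`H ⊗ K`. -/
def IsUltraweaklyContinuous (ρ : StrongDual ℂ (bkAlg H K)) : Prop :=
  @Continuous _ _ (TopologicalSpace.induced Subtype.val (ultraweakTopology (HTensor H K)))
    inferInstance ρ

/-- Positivity of a functional on the C*-algebra `B(H) ⊗ 𝔎(K)`. -/
def IsPositiveFunctional (ρ : StrongDual ℂ (bkAlg H K)) : Prop :=
  ∀ x : bkAlg H K, 0 ≤ (x : HTensor H K →L[ℂ] HTensor H K) → 0 ≤ ρ x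

/-- A positive functional is singular if it dominates no nonzero positive ultraweakly continuous
functional. -/
def IsPositiveSingular (ρ : StrongDual ℂ (bkAlg H K)) : Prop :=
  IsPositiveFunctional ρ ∧ ∀ ω : StrongDual ℂ (bkAlg H K), IsPositiveFunctional ω →
    IsUltraweaklyContinuous ω → IsPositiveFunctional (ρ - ω) → ω = 0

/-- Singular functionals: the linear combinations of positive singular functionals. -/
def IsSingular (ρ : StrongDual ℂ (bkAlg H K)) : Prop :=
  ρ ∈ Submodule.span ℂ {σ : StrongDual ℂ (bkAlg H K) | IsPositiveSingular σ}

/-- Normal functionals on `B(H) ⊗_π 𝔗(K)`: those which come from an ultraweakly continuous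
functional on the C*-algebra `B(H) ⊗ 𝔎(K)`. -/
def IsNormal (ψ : StrongDual ℂ (BPiT H K)) : Prop :=
  ∃ ρ : StrongDual ℂ (bkAlg H K), IsUltraweaklyContinuous ρ ∧ ψ = restrictFunctional ρ

/-! ## Positive maps and block-positive density matrices -/

/-- The transpose of an operator with respect to an orthonormal basis. -/
def transpose {ι : Type*} (e : HilbertBasis ι ℂ K) (b : K →L[ℂ] K) : K →L[ℂ] K :=
  ((conjBasis e).comp (ContinuousLinearMap.adjoint b)).comp (conjBasis e)

/-- The matrix of the transpose operator is the transposed matrix. -/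
theorem inner_transpose {ι : Type*} (e : HilbertBasis ι ℂ K) (b : K →L[ℂ] K) (i j : ι) :
    ⟪e i, transpose e b (e j)⟫_ℂ = ⟪e j, b (e i)⟫_ℂ := by
  have h : transpose e b (e j) = conjBasis e (ContinuousLinearMap.adjoint b (conjBasis e (e j))) :=
    rfl
  rw [h, conjBasis_self, inner_conjBasis, ContinuousLinearMap.adjoint_inner_left]

/-- Positivity of a map between algebras of operators. -/
def IsPositiveMap (φ : (H →L[ℂ] H) →L[ℂ] (K →L[ℂ] K)) : Prop :=
  ∀ a : H →L[ℂ] H, 0 ≤ a → 0 ≤ φ a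

/-- Positivity of a functional on the cone `B(H)⁺ ⊗_π 𝔗(K)⁺`; by linearity and continuity it is
enough to test the generators `a ⊗ b`, `a ≥ 0`, `b ≥ 0`, of this closed convex cone. -/
def IsPositiveOnCone (ψ : StrongDual ℂ (BPiT H K)) : Prop :=
  ∀ (a : H →L[ℂ] H) (b : TraceClass K), 0 ≤ a → 0 ≤ b.op → 0 ≤ ψ (ptmul a b)

/-- Block positivity, `ϱ ≥_bp 0`. -/
def IsBlockPositive (ϱ : HTensor H K →L[ℂ] HTensor H K) : Prop :=
  ∀ (f : H) (g : K), 0 ≤ ⟪htmul f g, ϱ (htmul f g)⟫_ℂ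

/-- The dual norm to the projective norm, `α(ϱ) = sup |Tr (ϱ u)| / ‖u‖_π` over
`0 ≠ u ∈ B(H) ⊗_π 𝔗(K)`. -/
def alphaNorm (ϱ : TraceClass (HTensor H K)) : ℝ :=
  sSup {r | ∃ u : BPiT H K, u ≠ 0 ∧ r = ‖trace (ϱ.op ∘L (canonicalMap u : bkAlg H K).1)‖ / ‖u‖}

variable (H K) in
/-- The set `𝔇₀`. -/
def D₀ : Set (TraceClass (HTensor H K)) :=
  {ϱ | alphaNorm ϱ = 1 ∧ ContinuousLinearMap.adjoint ϱ.op = ϱ.op ∧ IsBlockPositive ϱ.op}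

/-- The matrix element `⟪g, (Tr_H ϱ) g'⟫` of the partial trace over `H`. -/
def partialTraceForm (ϱ : HTensor H K →L[ℂ] HTensor H K) (g g' : K) : ℂ :=
  ∑' v : (exists_hilbertBasis ℂ H).choose, ⟪htmul (v : H) g, ϱ (htmul (v : H) g')⟫_ℂ

variable (H K) in
/-- The set `𝔇` of normalized elements of `𝔇₀`: the partial trace over `H` is the identity of
`K`. -/
def D : Set (TraceClass (HTensor H K)) :=
  {ϱ | ϱ ∈ D₀ H K ∧ ∀ g g' : K, partialTraceForm ϱ.op g g' = ⟪g, g'⟫_ℂ}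

end HilbertTensor

/-- The exposed points of the set `C` with respect to the norm `p`: the points `x` of `C` for which
some `p`-bounded real-linear functional attains its maximum on `C` at `x` and only at `x`. -/
def exposed {E : Type*} [AddCommGroup E] [Module ℝ E] (p : E → ℝ) (C : Set E) : Set E :=
  {x | x ∈ C ∧ ∃ f : E →ₗ[ℝ] ℝ, (∃ M : ℝ, ∀ y, |f y| ≤ M * p y) ∧ ∀ y ∈ C, y ≠ x → f y < f x}

end PosMaps

end

/-!
Normal and singular functionals, and positive maps with a density operator.

Everything rests on one estimate for the trace norm, which is defined by finite orthonormal
families: by a singular value decomposition, an operator maps an orthonormal family into one whose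
contribution to such sums is controlled (`exists_orthonormal_sum_norm_inner_le`). It gives the ideal
property `IsTraceClass.comp` and the density of the finite rank operators in the trace class
(`TraceClass.topologicalClosure_span_rankOne`); identities such as the cyclicity of the trace
(`trace_comp_comp_comm`) then have to be checked on operators of rank one only.

The inclusions of the dual spaces are density statements together with the comparison of the
injective norm with the operator norm, which holds because slice maps are contractive
(`norm_leftSlice_le`).

A bounded functional on `B(H) ⊗ 𝔎(K)` restricts to the finite rank operators on `H ⊗ K`, where it is
given by a trace class operator (`exists_density`). If the functional is positive, subtracting the
normal functional with this density leaves a positive functional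
(`isPositiveFunctional_sub_densityFunctional`) which vanishes on finite rank operators, and vanishing
there characterizes the singular functionals among the positive ones (`isPositiveSingular_iff`).
Arbitrary functionals are linear combinations of positive ones by a Hahn–Banach argument
(`mem_span_positive`).

The correspondence `φ ↦ φ̃` (`mapEquiv`) is the universal property of the projective tensor product
combined with the duality between `𝔗(K)` and `B(K)`; the inverse images of the normal functionals are
the maps `φ_ϱ` (`densityMap`). Since `⟪y, φ_ϱ(|f⟩⟨f'|) x⟫` is, up to the conjugation of `x` and `y`,
the matrix element of `ϱ` between `f' ⊗ x` and `f ⊗ y`, positivity of `φ_ϱ` is block positivity of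
`ϱ` (`isPositiveMap_densityMap_iff`). Exposed points are transported because a functional bounded for
`α` on the density operators extends to all maps by the Hahn–Banach theorem (`image_exposed`).

The partial trace of `ϱ` is the transpose of `φ_ϱ(1)`, so `𝔇` corresponds to the unital positive
maps; that these have norm one is the Russo–Dye theorem (`IsPositiveMap.norm_le_one`). It is proved
here with the Poisson kernel: for a strict contraction `x` the operators
`(1 - ζ x)⁻¹ + (1 - ζ̄ x*)⁻¹ - 1`, `|ζ| = 1`, are positive, and their averages over the roots of unity
of large order, without weights and with the weights `ζ̄`, are close to `1` and to `x`. Applying `φ`,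
the Cauchy–Schwarz inequality for positive operators gives `‖φ(x)‖ ≤ 1`. Finally the trace norm of an
element of `𝔇` bounds the size of orthonormal families in `K`, which forces `K` to be
finite-dimensional.
-/

noncomputable section

namespace PosMaps

/-! ### Singular value decomposition on finite orthonormal families -/

section TraceClassTheory

variable {L M N : Type*} [NormedAddCommGroup L] [InnerProductSpace ℂ L]
  [NormedAddCommGroup M] [InnerProductSpace ℂ M] [NormedAddCommGroup N] [InnerProductSpace ℂ N]

theorem norm_sum_smul_sq_of_orthonormal {κ : Type*} [Fintype κ] {e : κ → M} (he : Orthonormal ℂ e)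
    (c : κ → ℂ) : ‖∑ i, c i • e i‖ ^ 2 = ∑ i, ‖c i‖ ^ 2 := by
  have h := he.inner_sum c c Finset.univ
  rw [inner_self_eq_norm_sq_to_K] at h
  have h2 : ((‖∑ i, c i • e i‖ ^ 2 : ℝ) : ℂ) = ((∑ i, ‖c i‖ ^ 2 : ℝ) : ℂ) := by
    push_cast
    refine h.trans (Finset.sum_congr rfl fun i _ => ?_)
    exact Complex.conj_mul' (c i)
  exact_mod_cast h2

/-- A singular value decomposition of `a` on the span of the family `e` replaces the
vectors `a (e i)` by an orthonormal family in the range of `a`, at the cost of the factor `‖a‖`. -/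
theorem exists_orthonormal_sum_norm_inner_le [CompleteSpace L] {n : ℕ} {e : Fin n → M}
    {f : Fin n → N} (he : Orthonormal ℂ e) (hf : Orthonormal ℂ f) (a : M →L[ℂ] L)
    (T : L →L[ℂ] N) :
    ∃ (m : ℕ) (w : Fin m → L) (g : Fin m → N), Orthonormal ℂ w ∧ Orthonormal ℂ g ∧
      (∀ j, w j ∈ LinearMap.range a.toLinearMap) ∧
      (∀ j, g j ∈ Submodule.span ℂ (Set.range f)) ∧
      ∑ i, ‖⟪f i, T (a (e i))⟫_ℂ‖ ≤ ‖a‖ * ∑ j, ‖⟪g j, T (w j)⟫_ℂ‖ := by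
  classical
  -- `A` is `a` composed with the isometry onto the span of `e`, and `b` diagonalizes `A* A`
  let A₀ : EuclideanSpace ℂ (Fin n) →ₗ[ℂ] L :=
    { toFun := fun c => a (∑ i, c i • e i)
      map_add' := fun c d => by simp [add_smul, Finset.sum_add_distrib]
      map_smul' := fun r c => by simp [Finset.smul_sum, smul_smul] }
  let A : EuclideanSpace ℂ (Fin n) →L[ℂ] L := LinearMap.toContinuousLinearMap A₀
  have hA : ∀ c : EuclideanSpace ℂ (Fin n), A c = a (∑ i, c i • e i) := fun c => rfl
  have hAn : ∀ c : EuclideanSpace ℂ (Fin n), ‖A c‖ ≤ ‖a‖ * ‖c‖ := by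
    intro c
    have h1 : ‖∑ i, c i • e i‖ = ‖c‖ := by
      rw [← sq_eq_sq₀ (norm_nonneg _) (norm_nonneg _), norm_sum_smul_sq_of_orthonormal he,
        EuclideanSpace.norm_sq_eq]
    rw [hA, ← h1]
    exact a.le_opNorm _
  let G : EuclideanSpace ℂ (Fin n) →L[ℂ] EuclideanSpace ℂ (Fin n) := ContinuousLinearMap.adjoint A ∘L A
  have hG : G.toLinearMap.IsSymmetric := by
    intro x y
    simp [G, ContinuousLinearMap.adjoint_inner_left, ContinuousLinearMap.adjoint_inner_right]
  let b := hG.eigenvectorBasis (finrank_euclideanSpace_fin (𝕜 := ℂ) (n := n))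
  have hb : ∀ j k, j ≠ k → ⟪A (b j), A (b k)⟫_ℂ = 0 := by
    intro j k hjk
    have h1 : ⟪A (b j), A (b k)⟫_ℂ = ⟪b j, G (b k)⟫_ℂ := by
      simp [G, ContinuousLinearMap.adjoint_inner_right]
    have h2 : G (b k) = _ := hG.apply_eigenvectorBasis finrank_euclideanSpace_fin k
    rw [h1, h2, inner_smul_right, b.orthonormal.2 hjk, mul_zero]
  -- the phases `c i` turn the moduli in the sum into the values of a linear expression in `f`
  choose c hc hc' using fun i => RCLike.exists_norm_eq_mul_self (⟪f i, T (a (e i))⟫_ℂ)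
  have hcc : ∀ i, c i * (starRingEnd ℂ) (c i) = 1 := by
    intro i
    rw [Complex.mul_conj', hc]
    simp
  let g : Fin n → N := fun j => ∑ i, ((starRingEnd ℂ) (c i) * b j i) • f i
  have hg : Orthonormal ℂ g := by
    rw [orthonormal_iff_ite]
    intro j k
    rw [hf.inner_sum, ← orthonormal_iff_ite.1 b.orthonormal j k, PiLp.inner_apply]
    refine Finset.sum_congr rfl fun i _ => ?_
    rw [map_mul, Complex.conj_conj, RCLike.inner_apply]
    linear_combination (starRingEnd ℂ) (b j i) * b k i * hcc i
  have hsum : ∑ i, c i * ⟪f i, T (a (e i))⟫_ℂ = ∑ j, ⟪g j, T (A (b j))⟫_ℂ := by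
    have h1 : ∀ i, T (a (e i)) = ∑ j, (starRingEnd ℂ) (b j i) • T (A (b j)) := by
      intro i
      have h2 := b.sum_repr' (EuclideanSpace.single i (1 : ℂ))
      have h3 : A (EuclideanSpace.single i (1 : ℂ)) = a (e i) := by
        rw [hA, Finset.sum_eq_single i] <;> simp +contextual
      rw [← h3, ← h2, map_sum, map_sum]
      simp [EuclideanSpace.inner_single_right]
    calc ∑ i, c i * ⟪f i, T (a (e i))⟫_ℂ
        = ∑ i, ∑ j, c i * ((starRingEnd ℂ) (b j i) * ⟪f i, T (A (b j))⟫_ℂ) := by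
          refine Finset.sum_congr rfl fun i _ => ?_
          rw [h1, inner_sum, Finset.mul_sum]
          simp only [inner_smul_right]
      _ = ∑ j, ⟪g j, T (A (b j))⟫_ℂ := by
          rw [Finset.sum_comm]
          refine Finset.sum_congr rfl fun j _ => ?_
          rw [sum_inner]
          refine Finset.sum_congr rfl fun i _ => ?_
          rw [inner_smul_left, map_mul, Complex.conj_conj, mul_assoc]
  -- the vectors `A (b j)` are orthogonal; the nonzero ones are normalized
  let κ := {j : Fin n // A (b j) ≠ 0}
  let q : Fin (Fintype.card κ) ≃ κ := (Fintype.equivFin κ).symm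
  let w : κ → L := fun j => ((‖A (b j)‖⁻¹ : ℝ) : ℂ) • A (b j)
  have hw : Orthonormal ℂ w := by
    refine ⟨fun j => ?_, fun j k hjk => ?_⟩
    · simp [w, norm_smul, j.2]
    · simp [w, inner_smul_left, inner_smul_right, hb j k (fun h => hjk (Subtype.ext h))]
  refine ⟨_, w ∘ q, (fun j : κ => g j) ∘ q, hw.comp q q.injective,
    (hg.comp _ Subtype.val_injective).comp q q.injective, fun j => ?_, fun j => ?_, ?_⟩
  · exact Submodule.smul_mem _ _ ⟨_, (hA _).symm⟩
  · exact Submodule.sum_mem _ fun i _ => Submodule.smul_mem _ _ (Submodule.subset_span ⟨i, rfl⟩)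
  · have h1 : ((∑ i, ‖⟪f i, T (a (e i))⟫_ℂ‖ : ℝ) : ℂ) = ∑ j, ⟪g j, T (A (b j))⟫_ℂ := by
      rw [← hsum]
      push_cast
      exact Finset.sum_congr rfl fun i _ => hc' i
    have h2 : ∑ i, ‖⟪f i, T (a (e i))⟫_ℂ‖ ≤ ∑ j, ‖⟪g j, T (A (b j))⟫_ℂ‖ := by
      have := norm_sum_le Finset.univ fun j => ⟪g j, T (A (b j))⟫_ℂ
      rw [← h1, Complex.norm_real, Real.norm_of_nonneg (by positivity)] at this
      exact this
    refine h2.trans ?_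
    have h3 : ∑ j, ‖⟪g j, T (A (b j))⟫_ℂ‖ = ∑ j : κ, ‖⟪g j, T (A (b j))⟫_ℂ‖ := by
      rw [← Fintype.sum_subtype_add_sum_subtype (fun j => A (b j) ≠ 0), add_eq_left]
      refine Finset.sum_eq_zero fun j _ => ?_
      rw [not_not.1 j.2]
      simp
    rw [h3, ← q.sum_comp, Finset.mul_sum]
    refine Finset.sum_le_sum fun j _ => ?_
    have h4 : A (b (q j)) = ((‖A (b (q j))‖ : ℝ) : ℂ) • w (q j) := by
      simp only [w]
      rw [smul_smul, ← Complex.ofReal_mul, mul_inv_cancel₀ (norm_ne_zero_iff.2 (q j).2),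
        Complex.ofReal_one, one_smul]
    have h5 := hAn (b (q j))
    rw [b.orthonormal.1, mul_one] at h5
    rw [h4, map_smul, inner_smul_right, norm_mul, Complex.norm_real, norm_norm]
    exact mul_le_mul_of_nonneg_right h5 (norm_nonneg _)

end TraceClassTheory

/-! ### The ideal property of the trace norm -/

section TraceClassIdeal

open InnerProductSpace ContinuousLinearMap

variable {L M : Type*} [NormedAddCommGroup L] [InnerProductSpace ℂ L]
  [NormedAddCommGroup M] [InnerProductSpace ℂ M]

theorem sum_norm_inner_le_traceNorm {T : L →L[ℂ] L} (hT : IsTraceClass T) {κ : Type*} [Fintype κ]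
    {e f : κ → L} (he : Orthonormal ℂ e) (hf : Orthonormal ℂ f) :
    ∑ i, ‖⟪f i, T (e i)⟫_ℂ‖ ≤ traceNorm T := by
  let q := (Fintype.equivFin κ).symm
  rw [← q.sum_comp]
  exact le_traceNorm hT (he.comp q q.injective) (hf.comp q q.injective)

theorem traceNorm_le_of_forall {T : L →L[ℂ] L} {C : ℝ}
    (h : ∀ (n : ℕ) (e f : Fin n → L), Orthonormal ℂ e → Orthonormal ℂ f →
      ∑ i, ‖⟪f i, T (e i)⟫_ℂ‖ ≤ C) : traceNorm T ≤ C :=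
  csSup_le ⟨0, zero_mem_traceNormSet T⟩ (by rintro r ⟨n, e, f, he, hf, rfl⟩; exact h n e f he hf)

theorem isTraceClass_of_forall {T : L →L[ℂ] L} {C : ℝ}
    (h : ∀ (n : ℕ) (e f : Fin n → L), Orthonormal ℂ e → Orthonormal ℂ f →
      ∑ i, ‖⟪f i, T (e i)⟫_ℂ‖ ≤ C) : IsTraceClass T :=
  ⟨C, by rintro r ⟨n, e, f, he, hf, rfl⟩; exact h n e f he hf⟩

theorem sum_norm_inner_rankOne_le (x y : L) (n : ℕ) (e f : Fin n → L) (he : Orthonormal ℂ e)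
    (hf : Orthonormal ℂ f) : ∑ i, ‖⟪f i, rankOne ℂ x y (e i)⟫_ℂ‖ ≤ ‖x‖ * ‖y‖ := by
  have h1 : ∀ i, ‖⟪f i, rankOne ℂ x y (e i)⟫_ℂ‖ = ‖⟪f i, x⟫_ℂ‖ * ‖⟪e i, y⟫_ℂ‖ := by
    intro i
    rw [rankOne_apply, inner_smul_right, norm_mul, mul_comm, norm_inner_symm y]
  simp only [h1]
  have h2 := Finset.sum_mul_sq_le_sq_mul_sq Finset.univ (fun i => ‖⟪f i, x⟫_ℂ‖)
    (fun i => ‖⟪e i, y⟫_ℂ‖)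
  refine le_of_sq_le_sq ?_ (by positivity)
  rw [mul_pow]
  exact h2.trans (mul_le_mul (hf.sum_inner_products_le x) (he.sum_inner_products_le y)
    (by positivity) (by positivity))

theorem isTraceClass_rankOne (x y : L) : IsTraceClass (rankOne ℂ x y) :=
  isTraceClass_of_forall (sum_norm_inner_rankOne_le x y)

theorem traceNorm_rankOne_le (x y : L) : traceNorm (rankOne ℂ x y) ≤ ‖x‖ * ‖y‖ :=
  traceNorm_le_of_forall (sum_norm_inner_rankOne_le x y)

variable [CompleteSpace L]

theorem traceNormSet_adjoint (T : L →L[ℂ] L) : traceNormSet (adjoint T) = traceNormSet T := by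
  ext r
  constructor <;> rintro ⟨n, e, f, he, hf, rfl⟩ <;> refine ⟨n, f, e, hf, he, ?_⟩ <;>
    refine Finset.sum_congr rfl fun i _ => ?_
  · rw [adjoint_inner_right, norm_inner_symm]
  · rw [adjoint_inner_right, norm_inner_symm]

theorem IsTraceClass.adjoint {T : L →L[ℂ] L} (hT : IsTraceClass T) :
    IsTraceClass (ContinuousLinearMap.adjoint T) := by
  rwa [IsTraceClass, traceNormSet_adjoint]

theorem traceNorm_adjoint (T : L →L[ℂ] L) : traceNorm (adjoint T) = traceNorm T := by
  rw [traceNorm, traceNormSet_adjoint, traceNorm]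

variable [CompleteSpace M]

/-- The singular value decomposition is applied twice: to move `V` out on the right, and, after
passing to adjoints, to move `W` out on the left. -/
theorem sum_norm_inner_comp_le {T : L →L[ℂ] L} (hT : IsTraceClass T) (W : L →L[ℂ] M)
    (V : M →L[ℂ] L) (n : ℕ) (e f : Fin n → M) (he : Orthonormal ℂ e) (hf : Orthonormal ℂ f) :
    ∑ i, ‖⟪f i, (W ∘L T ∘L V) (e i)⟫_ℂ‖ ≤ ‖W‖ * traceNorm T * ‖V‖ := by
  obtain ⟨m, w, g, hw, hg, -, -, h1⟩ :=
    exists_orthonormal_sum_norm_inner_le he hf V (W ∘L T)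
  obtain ⟨k, z, h, hz, hh, -, -, h2⟩ :=
    exists_orthonormal_sum_norm_inner_le hg hw (ContinuousLinearMap.adjoint W)
      (ContinuousLinearMap.adjoint T)
  have h3 : ∑ j, ‖⟪g j, (W ∘L T) (w j)⟫_ℂ‖ =
      ∑ j, ‖⟪w j, ContinuousLinearMap.adjoint T (ContinuousLinearMap.adjoint W (g j))⟫_ℂ‖ := by
    refine Finset.sum_congr rfl fun j _ => ?_
    rw [adjoint_inner_right, adjoint_inner_right, norm_inner_symm]
    rfl
  have h4 := le_traceNorm hT.adjoint hz hh
  rw [traceNorm_adjoint] at h4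
  rw [LinearIsometryEquiv.norm_map, ← h3] at h2
  calc _ ≤ ‖V‖ * ∑ j, ‖⟪g j, (W ∘L T) (w j)⟫_ℂ‖ := h1
    _ ≤ ‖V‖ * (‖W‖ * traceNorm T) := by gcongr; exact h2.trans (by gcongr)
    _ = _ := by ring

theorem IsTraceClass.comp {T : L →L[ℂ] L} (hT : IsTraceClass T) (W : L →L[ℂ] M)
    (V : M →L[ℂ] L) : IsTraceClass (W ∘L T ∘L V) :=
  isTraceClass_of_forall (sum_norm_inner_comp_le hT W V)

theorem traceNorm_comp_le {T : L →L[ℂ] L} (hT : IsTraceClass T) (W : L →L[ℂ] M)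
    (V : M →L[ℂ] L) : traceNorm (W ∘L T ∘L V) ≤ ‖W‖ * traceNorm T * ‖V‖ :=
  traceNorm_le_of_forall (sum_norm_inner_comp_le hT W V)

end TraceClassIdeal

/-! ### Density of the finite rank operators in the trace class -/

section FiniteRankDense

open InnerProductSpace ContinuousLinearMap

variable {L M : Type*} [NormedAddCommGroup L] [InnerProductSpace ℂ L] [CompleteSpace L]
  [NormedAddCommGroup M] [InnerProductSpace ℂ M] [CompleteSpace M]

/-- An operator of trace class, as an element of `𝔗(L)`. -/
def TraceClass.mk {L : Type*} [NormedAddCommGroup L] [InnerProductSpace ℂ L] (T : L →L[ℂ] L)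
    (hT : IsTraceClass T) : TraceClass L := ⟨T, hT⟩

@[simp]
theorem TraceClass.op_mk {L : Type*} [NormedAddCommGroup L] [InnerProductSpace ℂ L]
    (T : L →L[ℂ] L) (hT : IsTraceClass T) : (TraceClass.mk T hT).op = T := rfl

/-- The operator `z ↦ ⟪y, z⟫ x` as an element of `𝔗(L)`. -/
def TraceClass.rankOne {L : Type*} [NormedAddCommGroup L] [InnerProductSpace ℂ L] (x y : L) :
    TraceClass L := TraceClass.mk _ (isTraceClass_rankOne x y)

@[simp]
theorem TraceClass.op_rankOne {L : Type*} [NormedAddCommGroup L] [InnerProductSpace ℂ L]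
    (x y : L) : (TraceClass.rankOne x y).op = InnerProductSpace.rankOne ℂ x y := rfl

theorem TraceClass.norm_rankOne_le {L : Type*} [NormedAddCommGroup L] [InnerProductSpace ℂ L]
    (x y : L) : ‖TraceClass.rankOne x y‖ ≤ ‖x‖ * ‖y‖ := traceNorm_rankOne_le x y

theorem orthonormal_sumElim {L : Type*} [NormedAddCommGroup L] [InnerProductSpace ℂ L]
    {κ κ' : Type*} {e : κ → L} {f : κ' → L} (he : Orthonormal ℂ e)
    (hf : Orthonormal ℂ f) (h : ∀ i j, ⟪e i, f j⟫_ℂ = 0) : Orthonormal ℂ (Sum.elim e f) := by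
  refine ⟨?_, ?_⟩
  · rintro (i | i)
    exacts [he.1 i, hf.1 i]
  · rintro (i | i) (j | j) hij
    · exact he.2 fun h => hij (congrArg _ h)
    · exact h i j
    · exact inner_eq_zero_symm.1 (h j i)
    · exact hf.2 fun h => hij (congrArg _ h)

/-- If the orthonormal families `e`, `f` almost attain the trace norm of `T`, then the compression
of `T` to their orthogonal complements has small trace norm. -/
theorem traceNorm_compression_le {T : L →L[ℂ] L} (hT : IsTraceClass T) {n : ℕ} {e f : Fin n → L}
    (he : Orthonormal ℂ e) (hf : Orthonormal ℂ f) (E F : Submodule ℂ L)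
    [E.HasOrthogonalProjection] [F.HasOrthogonalProjection] (heE : ∀ i, e i ∈ E)
    (hfF : ∀ i, f i ∈ F) :
    traceNorm (Fᗮ.starProjection ∘L T ∘L Eᗮ.starProjection) ≤
      traceNorm T - ∑ i, ‖⟪f i, T (e i)⟫_ℂ‖ := by
  refine traceNorm_le_of_forall fun m e' f' he' hf' => ?_
  obtain ⟨m, w, g, hw, hg, hwr, -, h1⟩ :=
    exists_orthonormal_sum_norm_inner_le he' hf' Eᗮ.starProjection (Fᗮ.starProjection ∘L T)
  obtain ⟨k, z, h, hz, hh, hzr, hhr, h2⟩ :=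
    exists_orthonormal_sum_norm_inner_le hg hw Fᗮ.starProjection (ContinuousLinearMap.adjoint T)
  have hwE : ∀ x ∈ Submodule.span ℂ (Set.range w), x ∈ Eᗮ := by
    intro x hx
    refine (Submodule.span_le (p := Eᗮ)).2 ?_ hx
    rintro _ ⟨j, rfl⟩
    obtain ⟨y, hy⟩ := hwr j
    rw [← hy]
    exact Submodule.starProjection_apply_mem _ _
  have hzF : ∀ j, z j ∈ Fᗮ := by
    intro j
    obtain ⟨y, hy⟩ := hzr j
    rw [← hy]
    exact Submodule.starProjection_apply_mem _ _
  have h3 : ∑ j, ‖⟪g j, (Fᗮ.starProjection ∘L T) (w j)⟫_ℂ‖ =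
      ∑ j, ‖⟪w j, ContinuousLinearMap.adjoint T (Fᗮ.starProjection (g j))⟫_ℂ‖ := by
    refine Finset.sum_congr rfl fun j _ => ?_
    rw [adjoint_inner_right, norm_inner_symm, ContinuousLinearMap.comp_apply,
      Submodule.inner_starProjection_left_eq_right]
  -- the families obtained from `e'`, `f'` are orthogonal to `e`, `f`, hence can be joined to them
  have h4 := sum_norm_inner_le_traceNorm hT
    (orthonormal_sumElim he hh fun i j => (Submodule.mem_orthogonal _ _).1 (hwE _ (hhr j)) _ (heE i))
    (orthonormal_sumElim hf hz fun i j => (Submodule.mem_orthogonal _ _).1 (hzF j) _ (hfF i))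
  rw [Fintype.sum_sum_type] at h4
  simp only [Sum.elim_inl, Sum.elim_inr] at h4
  have h5 : ∑ j, ‖⟪h j, ContinuousLinearMap.adjoint T (z j)⟫_ℂ‖ = ∑ j, ‖⟪z j, T (h j)⟫_ℂ‖ := by
    refine Finset.sum_congr rfl fun j _ => ?_
    rw [adjoint_inner_right, norm_inner_symm]
  have h6 : ∑ i, ‖⟪f' i, (Fᗮ.starProjection ∘L T ∘L Eᗮ.starProjection) (e' i)⟫_ℂ‖ ≤
      ∑ j, ‖⟪z j, T (h j)⟫_ℂ‖ := by
    refine h1.trans ((mul_le_of_le_one_left (by positivity) Eᗮ.starProjection_norm_le).trans ?_)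
    rw [h3, ← h5]
    exact h2.trans (mul_le_of_le_one_left (by positivity) Fᗮ.starProjection_norm_le)
  linarith

/-- The operators of finite rank are dense in the trace class: with `E`, `F` the spans of families
`e`, `f` which almost attain the trace norm of `T`, the operator `T` differs from one of finite rank
by its compression to `Eᗮ` and `Fᗮ`. -/
theorem TraceClass.topologicalClosure_span_rankOne :
    (Submodule.span ℂ (Set.range fun p : L × L => TraceClass.rankOne p.1 p.2)).topologicalClosure =
      ⊤ := by
  rw [eq_top_iff]
  intro T _
  rw [← SetLike.mem_coe, Submodule.topologicalClosure_coe, Metric.mem_closure_iff]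
  intro ε hε
  obtain ⟨r, ⟨n, e, f, he, hf, rfl⟩, hr⟩ := exists_lt_of_lt_csSup
    ⟨0, zero_mem_traceNormSet T.op⟩ (sub_lt_self (traceNorm T.op) hε)
  let E : Submodule ℂ L := Submodule.span ℂ (Set.range e)
  let F : Submodule ℂ L := Submodule.span ℂ (Set.range f)
  have : FiniteDimensional ℂ E := FiniteDimensional.span_of_finite ℂ (Set.finite_range e)
  have : FiniteDimensional ℂ F := FiniteDimensional.span_of_finite ℂ (Set.finite_range f)
  have hS := traceNorm_compression_le T.isTraceClass he hf E F
    (fun i => Submodule.subset_span ⟨i, rfl⟩) (fun i => Submodule.subset_span ⟨i, rfl⟩)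
  let b := stdOrthonormalBasis ℂ E
  let c := stdOrthonormalBasis ℂ F
  let R : TraceClass L := ∑ i, TraceClass.rankOne (T.op (b i)) (b i : L) +
    ∑ i, TraceClass.rankOne (c i : L)
      (ContinuousLinearMap.adjoint (T.op ∘L Eᗮ.starProjection) (c i : L))
  have hR : T.op - R.op = Fᗮ.starProjection ∘L T.op ∘L Eᗮ.starProjection := by
    have h1 : R.op = T.op ∘L E.starProjection + F.starProjection ∘L T.op ∘L Eᗮ.starProjection := by
      simp only [R, map_add, map_sum, TraceClass.op_rankOne]
      congr 1
      · rw [b.starProjection_eq_sum_rankOne]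
        ext x
        simp
      · rw [c.starProjection_eq_sum_rankOne]
        simp_rw [← InnerProductSpace.rankOne_comp]
        ext x
        simp [sum_apply]
    ext x
    have h2 := E.starProjection_add_starProjection_orthogonal x
    have h3 := F.starProjection_add_starProjection_orthogonal (T.op (Eᗮ.starProjection x))
    rw [h1]
    simp only [sub_apply, add_apply, ContinuousLinearMap.comp_apply]
    nth_rewrite 1 [← h2]
    rw [map_add]
    nth_rewrite 1 [← h3]
    abel
  refine ⟨R, Submodule.add_mem _ (Submodule.sum_mem _ fun i _ => ?_)
    (Submodule.sum_mem _ fun i _ => ?_), ?_⟩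
  · exact Submodule.subset_span ⟨(_, _), rfl⟩
  · exact Submodule.subset_span ⟨(_, _), rfl⟩
  · rw [dist_eq_norm, TraceClass.norm_def, map_sub, hR]
    linarith

theorem TraceClass.clm_ext {Z : Type*} [NormedAddCommGroup Z] [NormedSpace ℂ Z]
    {A B : TraceClass L →L[ℂ] Z}
    (h : ∀ x y, A (TraceClass.rankOne x y) = B (TraceClass.rankOne x y)) : A = B := by
  refine ContinuousLinearMap.ext_on (s := Set.range fun p : L × L => TraceClass.rankOne p.1 p.2)
    ?_ ?_
  · exact (Submodule.dense_iff_topologicalClosure_eq_top).2 TraceClass.topologicalClosure_span_rankOne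
  · rintro _ ⟨p, rfl⟩
    exact h _ _

/-- The map `T ↦ W T V` from `𝔗(L)` to `𝔗(M)`. -/
def TraceClass.conj (W : L →L[ℂ] M) (V : M →L[ℂ] L) : TraceClass L →L[ℂ] TraceClass M :=
  LinearMap.mkContinuous
    { toFun := fun T => TraceClass.mk (W ∘L T.op ∘L V) (T.isTraceClass.comp W V)
      map_add' := fun S T => TraceClass.op_injective (by ext; simp)
      map_smul' := fun c T => TraceClass.op_injective (by ext; simp) }
    (‖W‖ * ‖V‖) fun T => (traceNorm_comp_le T.isTraceClass W V).trans
      (by rw [← TraceClass.norm_def]; exact (by ring : _ = _).le)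

@[simp]
theorem TraceClass.op_conj (W : L →L[ℂ] M) (V : M →L[ℂ] L) (T : TraceClass L) :
    (TraceClass.conj W V T).op = W ∘L T.op ∘L V := rfl

theorem TraceClass.conj_rankOne (W : L →L[ℂ] M) (V : M →L[ℂ] L) (x y : L) :
    TraceClass.conj W V (TraceClass.rankOne x y) =
      TraceClass.rankOne (W x) (ContinuousLinearMap.adjoint V y) :=
  TraceClass.op_injective (by
    rw [TraceClass.op_conj, TraceClass.op_rankOne, TraceClass.op_rankOne,
      InnerProductSpace.rankOne_comp, InnerProductSpace.comp_rankOne])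

theorem TraceClass.norm_conj_le (W : L →L[ℂ] M) (V : M →L[ℂ] L) (T : TraceClass L) :
    ‖TraceClass.conj W V T‖ ≤ ‖W‖ * ‖T‖ * ‖V‖ :=
  traceNorm_comp_le T.isTraceClass W V

end FiniteRankDense

/-! ### The trace -/

section Trace

open InnerProductSpace ContinuousLinearMap

variable {L M : Type*} [NormedAddCommGroup L] [InnerProductSpace ℂ L] [CompleteSpace L]
  [NormedAddCommGroup M] [InnerProductSpace ℂ M] [CompleteSpace M]

variable (L) in
/-- The orthonormal basis over which the trace is defined. -/
def traceBasis : HilbertBasis (exists_hilbertBasis ℂ L).choose ℂ L :=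
  (exists_hilbertBasis ℂ L).choose_spec.choose

theorem traceBasis_apply (v : (exists_hilbertBasis ℂ L).choose) : traceBasis L v = (v : L) :=
  congrFun (exists_hilbertBasis ℂ L).choose_spec.choose_spec v

theorem trace_eq_tsum (T : L →L[ℂ] L) :
    trace T = ∑' v, ⟪traceBasis L v, T (traceBasis L v)⟫_ℂ := by
  simp only [traceBasis_apply]
  rfl

theorem sum_norm_inner_traceBasis_le {T : L →L[ℂ] L} (hT : IsTraceClass T)
    (s : Finset (exists_hilbertBasis ℂ L).choose) :
    ∑ v ∈ s, ‖⟪traceBasis L v, T (traceBasis L v)⟫_ℂ‖ ≤ traceNorm T := by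
  rw [← Finset.sum_coe_sort]
  have h := (traceBasis L).orthonormal.comp (fun v : s => v.1) Subtype.val_injective
  exact sum_norm_inner_le_traceNorm hT h h

theorem summable_norm_inner_traceBasis {T : L →L[ℂ] L} (hT : IsTraceClass T) :
    Summable fun v => ‖⟪traceBasis L v, T (traceBasis L v)⟫_ℂ‖ :=
  summable_of_sum_le (fun _ => norm_nonneg _) (sum_norm_inner_traceBasis_le hT)

theorem hasSum_trace {T : L →L[ℂ] L} (hT : IsTraceClass T) :
    HasSum (fun v => ⟪traceBasis L v, T (traceBasis L v)⟫_ℂ) (trace T) := by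
  rw [trace_eq_tsum]
  exact (summable_norm_inner_traceBasis hT).of_norm.hasSum

theorem norm_trace_le {T : L →L[ℂ] L} (hT : IsTraceClass T) : ‖trace T‖ ≤ traceNorm T := by
  rw [trace_eq_tsum]
  exact (norm_tsum_le_tsum_norm (summable_norm_inner_traceBasis hT)).trans
    ((summable_norm_inner_traceBasis hT).tsum_le_of_sum_le (sum_norm_inner_traceBasis_le hT))

variable (L) in
/-- The trace as a bounded functional on the trace class. -/
def traceCLM : TraceClass L →L[ℂ] ℂ :=
  LinearMap.mkContinuous
    { toFun := fun T => trace T.op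
      map_add' := fun S T => by
        refine (hasSum_trace (S + T).isTraceClass).unique ?_
        simpa [inner_add_right] using
          (hasSum_trace S.isTraceClass).add (hasSum_trace T.isTraceClass)
      map_smul' := fun c T => by
        refine (hasSum_trace (c • T).isTraceClass).unique ?_
        simpa [inner_smul_right] using (hasSum_trace T.isTraceClass).mul_left c } 1
    fun T => by
      rw [one_mul]
      exact norm_trace_le T.isTraceClass

theorem traceCLM_apply (T : TraceClass L) : traceCLM L T = trace T.op := rfl

theorem trace_rankOne (x y : L) : trace (rankOne ℂ x y) = ⟪y, x⟫_ℂ := by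
  rw [trace_eq_tsum, ← (traceBasis L).tsum_inner_mul_inner y x]
  refine tsum_congr fun v => ?_
  rw [rankOne_apply, inner_smul_right]

/-- Cyclicity of the trace. By density it is enough to check it for operators of rank one. -/
theorem trace_comp_comp_comm (T : TraceClass L) (V : M →L[ℂ] L) (W : L →L[ℂ] M) :
    trace (T.op ∘L V ∘L W) = trace (W ∘L T.op ∘L V) := by
  have h : traceCLM L ∘L TraceClass.conj (.id ℂ L) (V ∘L W) =
      traceCLM M ∘L TraceClass.conj W V := by
    refine TraceClass.clm_ext fun x y => ?_
    simp only [ContinuousLinearMap.comp_apply, TraceClass.conj_rankOne, traceCLM_apply,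
      TraceClass.op_rankOne, trace_rankOne, adjoint_inner_left, ContinuousLinearMap.id_apply]
  exact congrArg (fun F => F T) h

theorem trace_comp_comm (T : TraceClass L) (a : L →L[ℂ] L) :
    trace (T.op ∘L a) = trace (a ∘L T.op) :=
  trace_comp_comp_comm T (.id ℂ L) a

theorem trace_nonneg {T : L →L[ℂ] L} (hT : ∀ x, 0 ≤ ⟪x, T x⟫_ℂ) : 0 ≤ trace T := by
  rw [trace_eq_tsum]
  exact tsum_nonneg fun v => hT _

theorem inner_nonneg_of_nonneg {L : Type*} [NormedAddCommGroup L]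
    [InnerProductSpace ℂ L] {T : L →L[ℂ] L} (hT : 0 ≤ T) (x : L) : 0 ≤ ⟪x, T x⟫_ℂ :=
  ((nonneg_iff_isPositive T).1 hT).inner_nonneg_right x

theorem nonneg_of_inner_nonneg {L : Type*} [NormedAddCommGroup L]
    [InnerProductSpace ℂ L] {T : L →L[ℂ] L} (hT : ∀ x, 0 ≤ ⟪x, T x⟫_ℂ) : 0 ≤ T := by
  rw [nonneg_iff_isPositive, isPositive_iff_complex]
  intro x
  have h := hT x
  rw [← inner_conj_symm] at h
  have h' := Complex.nonneg_iff.1 h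
  simp only [Complex.conj_re, Complex.conj_im] at h'
  refine ⟨Complex.ext rfl ?_, h'.1⟩
  simp only [RCLike.re_to_complex, Complex.ofReal_im]
  linarith [h'.2]

/-- A positive operator has a positive square root. -/
theorem exists_sqrt {a : L →L[ℂ] L} (ha : 0 ≤ a) : ∃ s : L →L[ℂ] L, 0 ≤ s ∧
    ContinuousLinearMap.adjoint s = s ∧ s ∘L s = a :=
  ⟨CFC.sqrt a, CFC.sqrt_nonneg a, (CFC.sqrt_nonneg a).isSelfAdjoint.star_eq,
    CFC.sqrt_mul_sqrt_self a ha⟩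

theorem trace_comp_nonneg (T : TraceClass L) (hT : 0 ≤ T.op) {a : L →L[ℂ] L} (ha : 0 ≤ a) :
    0 ≤ trace (a ∘L T.op) := by
  obtain ⟨s, -, hs, rfl⟩ := exists_sqrt ha
  rw [← trace_comp_comm, trace_comp_comp_comm]
  refine trace_nonneg fun x => ?_
  rw [ContinuousLinearMap.comp_apply, ← adjoint_inner_left, hs]
  exact inner_nonneg_of_nonneg hT _

/-- The pairing `(ϱ, a) ↦ Tr (ϱ a)` of trace class and bounded operators. -/
def tracePairing : TraceClass L →L[ℂ] StrongDual ℂ (L →L[ℂ] L) :=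
  LinearMap.mkContinuous₂
    (LinearMap.mk₂ ℂ (fun (ϱ : TraceClass L) (a : L →L[ℂ] L) =>
        traceCLM L (TraceClass.conj (.id ℂ L) a ϱ))
      (fun ϱ σ a => by rw [map_add, map_add])
      (fun c ϱ a => by rw [map_smul, map_smul])
      (fun ϱ a b => by
        rw [← map_add]
        congr 1
        exact TraceClass.op_injective (by ext; simp))
      (fun c ϱ a => by
        rw [← map_smul]
        congr 1
        exact TraceClass.op_injective (by ext; simp))) 1
    (fun ϱ a => by
      rw [one_mul]
      refine (norm_trace_le (TraceClass.isTraceClass _)).trans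
        ((TraceClass.norm_conj_le (.id ℂ L) a ϱ).trans ?_)
      gcongr
      exact mul_le_of_le_one_left (norm_nonneg _) ContinuousLinearMap.norm_id_le)

theorem tracePairing_apply (ϱ : TraceClass L) (a : L →L[ℂ] L) :
    tracePairing ϱ a = trace (ϱ.op ∘L a) := rfl

theorem norm_tracePairing_le (ϱ : TraceClass L) (a : L →L[ℂ] L) :
    ‖tracePairing ϱ a‖ ≤ ‖ϱ‖ * ‖a‖ := by
  refine (norm_trace_le (TraceClass.isTraceClass (TraceClass.conj (.id ℂ L) a ϱ))).trans
        ((TraceClass.norm_conj_le (.id ℂ L) a ϱ).trans ?_)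
  gcongr
  exact mul_le_of_le_one_left (norm_nonneg _) ContinuousLinearMap.norm_id_le

theorem tracePairing_rankOne (ϱ : TraceClass L) (x y : L) :
    tracePairing ϱ (rankOne ℂ x y) = ⟪y, ϱ.op x⟫_ℂ := by
  rw [tracePairing_apply, InnerProductSpace.comp_rankOne, trace_rankOne]

end Trace

/-! ### Compact operators and dense spans -/

section Density

open InnerProductSpace ContinuousLinearMap

/-- Compact operators on a Hilbert space are norm limits of operators of finite rank: compose with
the projection onto the span of a finite net in the image of the unit ball. -/
theorem compactOps_le_closure_span_rankOne {K : Type*} [NormedAddCommGroup K]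
    [InnerProductSpace ℂ K] [CompleteSpace K] :
    CompactOps K ≤
      (Submodule.span ℂ (Set.range fun p : K × K => rankOne ℂ p.1 p.2)).topologicalClosure := by
  intro k hk
  have hk' : IsCompactOperator k := hk
  rw [← SetLike.mem_coe, Submodule.topologicalClosure_coe, Metric.mem_closure_iff]
  intro ε hε
  have htb := ((isCompactOperator_iff_isCompact_closure_image_closedBall
    (k : K →ₗ[ℂ] K) one_pos).1 hk').totallyBounded
  obtain ⟨t, ht, hcov⟩ := Metric.totallyBounded_iff.1 htb (ε / 2) (half_pos hε)
  let E : Submodule ℂ K := Submodule.span ℂ t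
  have : FiniteDimensional ℂ E := FiniteDimensional.span_of_finite ℂ ht
  let b := stdOrthonormalBasis ℂ E
  have hF : E.starProjection ∘L k ∈
      Submodule.span ℂ (Set.range fun p : K × K => rankOne ℂ p.1 p.2) := by
    have h1 : E.starProjection ∘L k =
        ∑ i, rankOne ℂ (b i : K) (ContinuousLinearMap.adjoint k (b i : K)) := by
      rw [b.starProjection_eq_sum_rankOne]
      simp_rw [← InnerProductSpace.rankOne_comp]
      ext x
      simp [sum_apply]
    rw [h1]
    exact Submodule.sum_mem _ fun i _ => Submodule.subset_span ⟨(_, _), rfl⟩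
  refine ⟨_, hF, ?_⟩
  rw [dist_eq_norm]
  refine lt_of_le_of_lt ?_ (half_lt_self hε)
  refine ContinuousLinearMap.opNorm_le_of_unit_norm (half_pos hε).le fun x hx => ?_
  have h1 : k x ∈ closure ((k : K →ₗ[ℂ] K) '' Metric.closedBall 0 1) :=
    subset_closure ⟨x, by simp [hx], rfl⟩
  obtain ⟨y, hy, hxy⟩ := Set.mem_iUnion₂.1 (hcov h1)
  have h2 : (k - E.starProjection ∘L k) x = Eᗮ.starProjection (k x - y) := by
    rw [map_sub, Submodule.starProjection_orthogonal_apply_eq_zero (Submodule.subset_span hy),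
      sub_zero, sub_apply, ContinuousLinearMap.comp_apply, sub_eq_iff_eq_add, add_comm]
    exact (E.starProjection_add_starProjection_orthogonal _).symm
  rw [h2]
  refine (Submodule.norm_starProjection_apply_le _ _).trans ?_
  rw [← dist_eq_norm]
  exact (Metric.mem_ball.1 hxy).le

/-- Bounded linear maps on a closed span are determined by their values on the spanning set. -/
theorem clm_ext_of_subset_closure_span {E Z : Type*} [NormedAddCommGroup E] [NormedSpace ℂ E]
    [NormedAddCommGroup Z] [NormedSpace ℂ Z] {p : Submodule ℂ E} {s : Set E} (hs : s ⊆ p)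
    (hp : p ≤ (Submodule.span ℂ s).topologicalClosure) {A B : p →L[ℂ] Z}
    (h : ∀ x (hx : x ∈ s), A ⟨x, hs hx⟩ = B ⟨x, hs hx⟩) : A = B := by
  have hsp : Submodule.span ℂ s ≤ p := Submodule.span_le.2 hs
  have hd : DenseRange (Set.inclusion hsp) := (denseRange_inclusion_iff hsp).2 hp
  ext x
  refine hd.induction_on (p := fun x => A x = B x) x
    (isClosed_eq A.continuous B.continuous) ?_
  rintro ⟨y, hy⟩
  change A ⟨y, hsp hy⟩ = B ⟨y, hsp hy⟩
  induction hy using Submodule.span_induction with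
  | mem x hx => exact h x hx
  | zero => exact (map_zero A).trans (map_zero B).symm
  | add x y hx hy h1 h2 =>
    exact (map_add A ⟨x, hsp hx⟩ ⟨y, hsp hy⟩).trans
      ((congrArg₂ _ h1 h2).trans (map_add B ⟨x, hsp hx⟩ ⟨y, hsp hy⟩).symm)
  | smul c x hx h1 =>
    exact (map_smul A c ⟨x, hsp hx⟩).trans
      ((congrArg _ h1).trans (map_smul B c ⟨x, hsp hx⟩).symm)

end Density

/-! ### Operators on `H ⊗ K` and the algebra `B(H) ⊗ 𝔎(K)` -/

section TensorOperators

open InnerProductSpace ContinuousLinearMap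

variable {H K : Type*} [NormedAddCommGroup H] [InnerProductSpace ℂ H]
  [NormedAddCommGroup K] [InnerProductSpace ℂ K]

theorem norm_htmul (f : H) (g : K) : ‖(htmul f g : HTensor H K)‖ = ‖f‖ * ‖g‖ := by
  rw [htmul, LinearIsometry.norm_map, TensorProduct.norm_tmul]

theorem span_htmul_topologicalClosure :
    (Submodule.span ℂ (Set.range fun p : H × K => (htmul p.1 p.2 : HTensor H K))).topologicalClosure
      = ⊤ := by
  rw [← Submodule.dense_iff_topologicalClosure_eq_top]
  refine (HTensor.denseRange_of (H := H) (K := K)).mono ?_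
  rintro _ ⟨u, rfl⟩
  induction u using TensorProduct.induction_on with
  | zero => simp
  | tmul f g => exact Submodule.subset_span ⟨(f, g), rfl⟩
  | add x y hx hy =>
    rw [map_add]
    exact Submodule.add_mem _ hx hy

theorem HTensor.clm_ext {Z : Type*} [NormedAddCommGroup Z] [NormedSpace ℂ Z]
    {S T : HTensor H K →L[ℂ] Z} (h : ∀ f g, S (htmul f g) = T (htmul f g)) : S = T := by
  refine ContinuousLinearMap.ext_on
    (Submodule.dense_iff_topologicalClosure_eq_top.2 span_htmul_topologicalClosure) ?_
  rintro _ ⟨p, rfl⟩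
  exact h _ _

theorem HTensor.ext_inner {x y : HTensor H K}
    (h : ∀ f g, ⟪htmul f g, x⟫_ℂ = ⟪htmul f g, y⟫_ℂ) : x = y := by
  have h1 : innerSL ℂ x = innerSL ℂ y := HTensor.clm_ext fun f g => by
    rw [innerSL_apply_apply, innerSL_apply_apply, ← inner_conj_symm, h, inner_conj_symm]
  refine ext_inner_right ℂ fun v => ?_
  exact congrArg (fun F => F v) h1

theorem HTensor.op_ext {S T : HTensor H K →L[ℂ] HTensor H K}
    (h : ∀ f g f' g', ⟪htmul f' g', S (htmul f g)⟫_ℂ = ⟪htmul f' g', T (htmul f g)⟫_ℂ) : S = T :=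
  HTensor.clm_ext fun f g => HTensor.ext_inner fun f' g' => h f g f' g'

/-- The operator `f ↦ f ⊗ g` from `H` to `H ⊗ K`. -/
def tensorRight (g : K) : H →L[ℂ] HTensor H K :=
  LinearMap.mkContinuous
    { toFun := fun f => htmul f g
      map_add' := fun f f' => by simp [htmul, TensorProduct.add_tmul]
      map_smul' := fun c f => by simp [htmul, ← TensorProduct.smul_tmul'] } ‖g‖
    fun f => by
      change ‖htmul f g‖ ≤ _
      rw [norm_htmul, mul_comm]

@[simp]
theorem tensorRight_apply (g : K) (f : H) : tensorRight g f = htmul f g := rfl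

theorem norm_tensorRight_le (g : K) : ‖(tensorRight g : H →L[ℂ] HTensor H K)‖ ≤ ‖g‖ :=
  LinearMap.mkContinuous_norm_le _ (norm_nonneg _) _

theorem htmul_smul (c : ℂ) (f : H) (g : K) : htmul f (c • g) = c • htmul f g := by
  simp [htmul]

theorem htmul_add (f : H) (g g' : K) : htmul f (g + g') = htmul f g + htmul f g' := by
  simp [htmul, TensorProduct.tmul_add]

theorem smul_htmul (c : ℂ) (f : H) (g : K) : htmul (c • f) g = c • htmul f g :=
  (tensorRight g).map_smul c f

theorem adjoint_tensorRight_htmul [CompleteSpace H] (g g' : K) (f : H) :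
    ContinuousLinearMap.adjoint (tensorRight g) (htmul f g') = ⟪g, g'⟫_ℂ • f := by
  refine ext_inner_left ℂ fun v => ?_
  rw [adjoint_inner_right, tensorRight_apply, inner_htmul, inner_smul_right, mul_comm]

/-- Operators of the form `a ⊗ |g⟩⟨g'|` factor through `H`. -/
theorem tensorOp_rankOne [CompleteSpace H] (a : H →L[ℂ] H) (g g' : K) :
    tensorOp a (rankOne ℂ g g') =
      tensorRight g ∘L a ∘L ContinuousLinearMap.adjoint (tensorRight g') :=
  HTensor.clm_ext fun f k => by
    rw [tensorOp_htmul, rankOne_apply, ContinuousLinearMap.comp_apply,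
      ContinuousLinearMap.comp_apply, adjoint_tensorRight_htmul, map_smul, map_smul,
      tensorRight_apply, htmul_smul]

theorem rankOne_htmul (f f' : H) (g g' : K) :
    rankOne ℂ (htmul f g) (htmul f' g') = tensorOp (rankOne ℂ f f') (rankOne ℂ g g') :=
  HTensor.clm_ext fun h k => by
    rw [tensorOp_htmul, rankOne_apply, rankOne_apply, rankOne_apply, htmul_smul, smul_htmul,
      smul_smul, inner_htmul, mul_comm]

theorem adjoint_tensorOp [CompleteSpace H] [CompleteSpace K] (a : H →L[ℂ] H) (b : K →L[ℂ] K) :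
    ContinuousLinearMap.adjoint (tensorOp a b) =
      tensorOp (ContinuousLinearMap.adjoint a) (ContinuousLinearMap.adjoint b) :=
  HTensor.op_ext fun f g f' g' => by
    rw [adjoint_inner_right, tensorOp_htmul, tensorOp_htmul, inner_htmul, inner_htmul,
      adjoint_inner_right, adjoint_inner_right]

/-- The map `b ↦ a ⊗ b`. -/
def tensorOpRight (a : H →L[ℂ] H) : (K →L[ℂ] K) →L[ℂ] (HTensor H K →L[ℂ] HTensor H K) :=
  LinearMap.mkContinuous
    { toFun := tensorOp a
      map_add' := tensorOp_add_right a
      map_smul' := fun c b => tensorOp_smul_right c a b } ‖a‖ (norm_tensorOp_le a)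

@[simp]
theorem tensorOpRight_apply (a : H →L[ℂ] H) (b : K →L[ℂ] K) : tensorOpRight a b = tensorOp a b := rfl

theorem rankOne_mem_compactOps (g g' : K) : rankOne ℂ g g' ∈ CompactOps K := by
  change IsCompactOperator (rankOne ℂ g g')
  rw [rankOne_def']
  exact (isCompactOperator_of_locallyCompactSpace_rng
    (ContinuousLinearMap.toSpanSingleton ℂ g)).comp_clm _

variable (H K) in
/-- The operators `a ⊗ |g⟩⟨g'|`. -/
def bkGenerators : Set (HTensor H K →L[ℂ] HTensor H K) :=
  {T | ∃ (a : H →L[ℂ] H) (g g' : K), T = tensorOp a (rankOne ℂ g g')}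

theorem bkGenerators_subset : bkGenerators H K ⊆ bkAlg H K := by
  rintro _ ⟨a, g, g', rfl⟩
  exact tensorOp_mem_bkAlg a (rankOne_mem_compactOps g g')

theorem bkAlg_le_closure [CompleteSpace K] :
    bkAlg H K ≤ (Submodule.span ℂ (bkGenerators H K)).topologicalClosure := by
  refine Submodule.topologicalClosure_minimal _ ?_ (Submodule.isClosed_topologicalClosure _)
  rw [Submodule.span_le]
  rintro _ ⟨a, k, hk, rfl⟩
  have h : CompactOps K ≤ ((Submodule.span ℂ (bkGenerators H K)).topologicalClosure).comap
      (tensorOpRight a).toLinearMap := by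
    refine compactOps_le_closure_span_rankOne.trans (Submodule.topologicalClosure_minimal _ ?_ ?_)
    · rw [Submodule.span_le]
      rintro _ ⟨p, rfl⟩
      exact Submodule.le_topologicalClosure _ (Submodule.subset_span ⟨a, p.1, p.2, rfl⟩)
    · exact (Submodule.isClosed_topologicalClosure _).preimage (tensorOpRight a).continuous
  exact h hk

theorem bkAlg_clm_ext [CompleteSpace K] {Z : Type*} [NormedAddCommGroup Z] [NormedSpace ℂ Z]
    {A B : bkAlg H K →L[ℂ] Z}
    (h : ∀ a g g', A (bkTmul a ⟨rankOne ℂ g g', rankOne_mem_compactOps g g'⟩) =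
      B (bkTmul a ⟨rankOne ℂ g g', rankOne_mem_compactOps g g'⟩)) : A = B :=
  clm_ext_of_subset_closure_span bkGenerators_subset bkAlg_le_closure (by
    rintro _ ⟨a, g, g', rfl⟩
    exact h a g g')

theorem adjoint_mem_bkAlg [CompleteSpace H] [CompleteSpace K]
    {T : HTensor H K →L[ℂ] HTensor H K} (hT : T ∈ bkAlg H K) :
    ContinuousLinearMap.adjoint T ∈ bkAlg H K := by
  let p : Submodule ℂ (HTensor H K →L[ℂ] HTensor H K) :=
    { carrier := {T | ContinuousLinearMap.adjoint T ∈ bkAlg H K}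
      add_mem' := fun {S T} hS hT => by
        rw [Set.mem_ofPred_eq, map_add]
        exact Submodule.add_mem _ hS hT
      zero_mem' := by
        rw [Set.mem_ofPred_eq, map_zero]
        exact Submodule.zero_mem _
      smul_mem' := fun c T hT => by
        rw [Set.mem_ofPred_eq, map_smulₛₗ]
        exact Submodule.smul_mem _ _ hT }
  have hp : IsClosed (p : Set (HTensor H K →L[ℂ] HTensor H K)) :=
    isClosed_bkAlg.preimage (LinearIsometryEquiv.continuous ContinuousLinearMap.adjoint)
  have h : bkAlg H K ≤ p := by
    refine bkAlg_le_closure.trans (Submodule.topologicalClosure_minimal _ ?_ hp)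
    rw [Submodule.span_le]
    rintro _ ⟨a, g, g', rfl⟩
    change ContinuousLinearMap.adjoint (tensorOp a _) ∈ bkAlg H K
    rw [adjoint_tensorOp, adjoint_rankOne]
    exact bkGenerators_subset ⟨_, _, _, rfl⟩
  exact h hT

/-- The algebra `B(H) ⊗ 𝔎(K)` contains the operators of finite rank on `H ⊗ K`. -/
theorem rankOne_mem_bkAlg [CompleteSpace H] [CompleteSpace K] (x y : HTensor H K) :
    rankOne ℂ x y ∈ bkAlg H K := by
  have key (z : HTensor H K) (h : ∀ f g, rankOne ℂ (htmul f g) z ∈ bkAlg H K)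
      (x : HTensor H K) : rankOne ℂ x z ∈ bkAlg H K := by
    let F : HTensor H K →L[ℂ] (HTensor H K →L[ℂ] HTensor H K) := (rankOne ℂ).flip z
    let p : Submodule ℂ (HTensor H K) := (bkAlg H K).comap F.toLinearMap
    have hp : IsClosed (p : Set (HTensor H K)) := isClosed_bkAlg.preimage F.continuous
    have h1 : (⊤ : Submodule ℂ (HTensor H K)) ≤ p := by
      rw [← span_htmul_topologicalClosure]
      refine Submodule.topologicalClosure_minimal _ (Submodule.span_le.2 ?_) hp
      rintro _ ⟨q, rfl⟩
      exact h _ _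
    exact h1 trivial
  refine key y (fun f g => ?_) x
  rw [← adjoint_rankOne]
  refine adjoint_mem_bkAlg (key _ (fun f' g' => ?_) y)
  rw [rankOne_htmul]
  exact bkGenerators_subset ⟨_, _, _, rfl⟩

end TensorOperators

/-! ### The projective tensor product -/

section ProjectiveLift

variable {X Y Z : Type*} [NormedAddCommGroup X] [NormedSpace ℂ X] [NormedAddCommGroup Y]
  [NormedSpace ℂ Y] [NormedAddCommGroup Z] [NormedSpace ℂ Z]

variable (X Y) in
/-- The dense embedding of the algebraic tensor product into `X ⊗_π Y`. -/
def projEmbedding : X ⊗[ℂ] Y →ₗ[ℂ] ProjectiveTensor X Y :=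
  (ProjectiveTensor.ofCompletion X Y).toLinearEquiv.toLinearMap ∘ₗ
    (UniformSpace.Completion.toComplL (𝕜 := ℂ) (E := ProjTensor X Y)).toLinearMap ∘ₗ
    (ProjTensor.of X Y).toLinearMap

theorem projEmbedding_tmul (x : X) (y : Y) : projEmbedding X Y (x ⊗ₜ y) = ptmul x y := rfl

theorem norm_projEmbedding (u : X ⊗[ℂ] Y) : ‖projEmbedding X Y u‖ = projNorm u :=
  UniformSpace.Completion.norm_coe (ProjTensor.of X Y u)

theorem denseRange_projEmbedding : DenseRange (projEmbedding X Y) :=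
  UniformSpace.Completion.denseRange_coe (α := ProjTensor X Y)

theorem ProjectiveTensor.clm_ext {A B : ProjectiveTensor X Y →L[ℂ] Z}
    (h : ∀ x y, A (ptmul x y) = B (ptmul x y)) : A = B := by
  ext u
  refine denseRange_projEmbedding.induction_on (p := fun u => A u = B u) u
    (isClosed_eq A.continuous B.continuous) fun v => ?_
  have h1 : A.toLinearMap ∘ₗ projEmbedding X Y = B.toLinearMap ∘ₗ projEmbedding X Y :=
    TensorProduct.ext' h
  exact LinearMap.congr_fun h1 v

theorem norm_ptmul_le (x : X) (y : Y) : ‖ptmul x y‖ ≤ ‖x‖ * ‖y‖ := by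
  rw [← projEmbedding_tmul, norm_projEmbedding]
  exact projNorm_le ⟨1, fun _ => x, fun _ => y, by simp, by simp⟩

/-- The universal property of `X ⊗_π Y`: a bounded bilinear map is linearized with the same bound. -/
theorem exists_projective_lift [CompleteSpace Z] (B : X →ₗ[ℂ] Y →ₗ[ℂ] Z) {C : ℝ} (hC : 0 ≤ C)
    (hB : ∀ x y, ‖B x y‖ ≤ C * ‖x‖ * ‖y‖) :
    ∃ ψ : ProjectiveTensor X Y →L[ℂ] Z, (∀ x y, ψ (ptmul x y) = B x y) ∧ ‖ψ‖ ≤ C := by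
  have hbd : ∀ u, ‖TensorProduct.lift B u‖ ≤ C * ‖projEmbedding X Y u‖ := by
    intro u
    rw [norm_projEmbedding]
    -- the projective norm is an infimum, so that a bound by `C` times it needs `C ≠ 0`
    rcases hC.eq_or_lt with rfl | hC
    · have h0 : TensorProduct.lift B = 0 := TensorProduct.ext' fun x y => by
        simpa using hB x y
      simp [h0]
    rw [← div_le_iff₀' hC]
    refine le_csInf (projNormSet_nonempty u) ?_
    rintro r ⟨n, x, y, hu, rfl⟩
    rw [div_le_iff₀' hC, hu, map_sum, Finset.mul_sum]
    refine (norm_sum_le _ _).trans (Finset.sum_le_sum fun i _ => ?_)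
    rw [TensorProduct.lift.tmul, ← mul_assoc]
    exact hB _ _
  refine ⟨(TensorProduct.lift B).extendOfNorm (projEmbedding X Y), fun x y => ?_,
    LinearMap.opNorm_extendOfNorm_le denseRange_projEmbedding hC hbd⟩
  rw [← projEmbedding_tmul, LinearMap.extendOfNorm_eq denseRange_projEmbedding ⟨C, hbd⟩,
    TensorProduct.lift.tmul]

end ProjectiveLift

/-! ### Inclusions of dual spaces -/

section DualMap

variable {V W A : Type*} [AddCommGroup V] [Module ℂ V] [NormedAddCommGroup W] [NormedSpace ℂ W]
  [NormedAddCommGroup A] [NormedSpace ℂ A]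

/-- If the norm that `V` inherits from `W` is dominated by the one it inherits from `A`, then the
dual space of `W` is contractively included in that of `A`. -/
theorem exists_dual_map_of_norm_le (E : V →ₗ[ℂ] W) (p : V →ₗ[ℂ] A) (hE : DenseRange E)
    (hp : DenseRange p) (h : ∀ u, ‖E u‖ ≤ ‖p u‖) :
    ∃ J : StrongDual ℂ W →ₗ[ℂ] StrongDual ℂ A, Function.Injective J ∧ (∀ ζ, ‖J ζ‖ ≤ ‖ζ‖) ∧
      ∀ ζ u, J ζ (p u) = ζ (E u) := by
  have hbd : ∀ (ζ : StrongDual ℂ W) u, ‖(ζ.toLinearMap ∘ₗ E) u‖ ≤ ‖ζ‖ * ‖p u‖ := fun ζ u =>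
    (ζ.le_opNorm (E u)).trans (mul_le_mul_of_nonneg_left (h u) (norm_nonneg ζ))
  let J₀ : StrongDual ℂ W → StrongDual ℂ A := fun ζ => (ζ.toLinearMap ∘ₗ E).extendOfNorm p
  have hJ : ∀ ζ u, J₀ ζ (p u) = ζ (E u) := fun ζ u =>
    LinearMap.extendOfNorm_eq hp ⟨_, hbd ζ⟩ u
  have hext : ∀ F G : StrongDual ℂ A, (∀ u, F (p u) = G (p u)) → F = G := fun F G hFG =>
    ContinuousLinearMap.ext fun x => hp.induction_on (p := fun x => F x = G x) x
      (isClosed_eq F.continuous G.continuous) hFG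
  refine ⟨⟨⟨J₀, fun ζ η => ?_⟩, fun c ζ => ?_⟩, ?_, fun ζ => ?_, hJ⟩
  · refine hext _ _ fun u => ?_
    rw [add_apply, hJ, hJ, hJ, add_apply]
  · refine hext _ _ fun u => ?_
    rw [smul_apply, hJ, hJ, smul_apply, RingHom.id_apply]
  · intro ζ η hζη
    ext x
    refine hE.induction_on (p := fun x => ζ x = η x) x
      (isClosed_eq ζ.continuous η.continuous) fun u => ?_
    rw [← hJ, ← hJ]
    exact congrArg (fun F => F (p u)) hζη
  · exact LinearMap.opNorm_extendOfNorm_le hp (norm_nonneg ζ) (hbd ζ)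

end DualMap

section OpNormInner

variable {L M : Type*} [NormedAddCommGroup L] [InnerProductSpace ℂ L]
  [NormedAddCommGroup M] [InnerProductSpace ℂ M]

theorem opNorm_le_of_inner {T : L →L[ℂ] M} {C : ℝ} (hC : 0 ≤ C)
    (h : ∀ x y, ‖⟪y, T x⟫_ℂ‖ ≤ C * ‖x‖ * ‖y‖) : ‖T‖ ≤ C := by
  refine T.opNorm_le_bound hC fun x => ?_
  have h1 := h x (T x)
  rw [inner_self_eq_norm_sq_to_K] at h1
  simp only [norm_pow, RCLike.norm_ofReal, abs_norm] at h1
  rcases eq_or_ne (T x) 0 with h0 | h0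
  · rw [h0, norm_zero]
    positivity
  · rw [sq] at h1
    exact le_of_mul_le_mul_right h1 (norm_pos_iff.2 h0)

end OpNormInner

section DualInclusions

open InnerProductSpace ContinuousLinearMap

variable {H K : Type*} [NormedAddCommGroup H] [InnerProductSpace ℂ H]
  [NormedAddCommGroup K] [InnerProductSpace ℂ K]

variable (H K) in
/-- The algebraic tensor product `B(H) ⊙ 𝔎(K)` acting on `H ⊗ K`. -/
def algTensorOp : (H →L[ℂ] H) ⊗[ℂ] CompactOps K →ₗ[ℂ] bkAlg H K :=
  TensorProduct.lift (LinearMap.mk₂ ℂ bkTmul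
    (fun a a' k => Subtype.ext (tensorOp_add_left a a' k.1))
    (fun c a k => Subtype.ext (tensorOp_smul_left c a k.1))
    (fun a k k' => Subtype.ext (tensorOp_add_right a k.1 k'.1))
    (fun c a k => Subtype.ext (tensorOp_smul_right c a k.1)))

theorem algTensorOp_tmul (a : H →L[ℂ] H) (k : CompactOps K) :
    algTensorOp H K (a ⊗ₜ k) = bkTmul a k := by
  simp [algTensorOp]

/-- The slice map `f ⊗ id` on `B(H) ⊙ 𝔎(K)`. -/
def leftSlice (f : StrongDual ℂ (H →L[ℂ] H)) :
    (H →L[ℂ] H) ⊗[ℂ] CompactOps K →ₗ[ℂ] CompactOps K :=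
  TensorProduct.lid ℂ (CompactOps K) ∘ₗ TensorProduct.map f.toLinearMap LinearMap.id

theorem leftSlice_tmul (f : StrongDual ℂ (H →L[ℂ] H)) (a : H →L[ℂ] H) (k : CompactOps K) :
    leftSlice f (a ⊗ₜ k) = f a • k := by
  simp [leftSlice]

/-- The matrix elements of a slice are values of `f` at compressions of the operator, which bounds
the slice map in the operator norm. -/
theorem inner_leftSlice [CompleteSpace H] (f : StrongDual ℂ (H →L[ℂ] H))
    (u : (H →L[ℂ] H) ⊗[ℂ] CompactOps K) (x y : K) :
    ⟪y, (leftSlice f u).1 x⟫_ℂ = f (ContinuousLinearMap.adjoint (tensorRight y) ∘L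
      (algTensorOp H K u).1 ∘L tensorRight x) := by
  induction u using TensorProduct.induction_on with
  | zero =>
    simp
  | tmul a k =>
    have h : ContinuousLinearMap.adjoint (tensorRight y) ∘L
        (algTensorOp H K (a ⊗ₜ k)).1 ∘L tensorRight x = ⟪y, k.1 x⟫_ℂ • a := by
      ext v
      rw [algTensorOp_tmul, ContinuousLinearMap.comp_apply, ContinuousLinearMap.comp_apply]
      exact (congrArg _ (tensorOp_htmul a k.1 v x)).trans (adjoint_tensorRight_htmul _ _ _)
    rw [h, leftSlice_tmul, map_smul]
    simp [mul_comm]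
  | add u v hu hv =>
    rw [map_add, map_add, Submodule.coe_add, Submodule.coe_add, add_apply, inner_add_right, hu, hv,
      ContinuousLinearMap.add_comp, ContinuousLinearMap.comp_add, map_add]

theorem norm_leftSlice_le [CompleteSpace H] {f : StrongDual ℂ (H →L[ℂ] H)} (hf : ‖f‖ ≤ 1)
    (u : (H →L[ℂ] H) ⊗[ℂ] CompactOps K) : ‖leftSlice f u‖ ≤ ‖algTensorOp H K u‖ := by
  refine opNorm_le_of_inner (norm_nonneg _) fun x y => ?_
  have h := inner_leftSlice f u x y
  refine (congrArg _ h).trans_le ?_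
  refine (f.le_of_opNorm_le hf _).trans ?_
  rw [one_mul]
  refine (ContinuousLinearMap.opNorm_comp_le _ _).trans ?_
  rw [LinearIsometryEquiv.norm_map]
  have h1 := (ContinuousLinearMap.opNorm_comp_le (algTensorOp H K u).1 (tensorRight x)).trans
    (mul_le_mul_of_nonneg_left (norm_tensorRight_le (H := H) x) (norm_nonneg _))
  calc _ ≤ ‖y‖ * (‖(algTensorOp H K u).1‖ * ‖x‖) :=
        mul_le_mul (norm_tensorRight_le y) h1 (norm_nonneg _) (norm_nonneg _)
    _ = ‖algTensorOp H K u‖ * ‖x‖ * ‖y‖ := by rw [Submodule.coe_norm]; ring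

variable [CompleteSpace K]

theorem canonicalMap_ptmul_rankOne (a : H →L[ℂ] H) (g g' : K) :
    canonicalMap (ptmul a (TraceClass.rankOne g g')) =
      bkTmul a ⟨rankOne ℂ g g', rankOne_mem_compactOps g g'⟩ :=
  Subtype.ext (canonicalMap_ptmul _ _)

theorem norm_canonicalMap_le (u : BPiT H K) : ‖canonicalMap u‖ ≤ ‖u‖ := by
  obtain ⟨ψ, h1, h2⟩ := exists_projective_lift (tensorBilin (H := H) (K := K)) zero_le_one
    (fun a b => (norm_tensorBilin_le a b).trans_eq (by rw [one_mul]))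
  have h3 : canonicalMap = ψ := ProjectiveTensor.clm_ext fun x y => by
    rw [h1]
    exact projLift_ptmul _ _ _ _
  rw [h3]
  exact (ψ.le_of_opNorm_le h2 u).trans_eq (one_mul ‖u‖)

theorem restrictFunctional_injective :
    Function.Injective (restrictFunctional (H := H) (K := K)) := by
  intro ρ σ h
  refine bkAlg_clm_ext fun a g g' => ?_
  rw [← canonicalMap_ptmul_rankOne]
  exact congrArg (fun F => F (ptmul a (TraceClass.rankOne g g'))) h

theorem norm_restrictFunctional_le (ρ : StrongDual ℂ (bkAlg H K)) :
    ‖restrictFunctional ρ‖ ≤ ‖ρ‖ :=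
  ContinuousLinearMap.opNorm_le_bound _ (norm_nonneg ρ) fun u =>
    (ρ.le_opNorm _).trans (mul_le_mul_of_nonneg_left (norm_canonicalMap_le u) (norm_nonneg ρ))

theorem denseRange_algTensorOp : DenseRange (algTensorOp H K) := by
  have hsp : ∀ T ∈ Submodule.span ℂ (bkGenerators H K), ∃ u, (algTensorOp H K u).1 = T := by
    intro T hT
    have h : Submodule.span ℂ (bkGenerators H K) ≤
        LinearMap.range ((bkAlg H K).subtype ∘ₗ algTensorOp H K) := by
      rw [Submodule.span_le]
      rintro _ ⟨a, g, g', rfl⟩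
      exact ⟨a ⊗ₜ ⟨rankOne ℂ g g', rankOne_mem_compactOps g g'⟩, by
        rw [LinearMap.comp_apply, algTensorOp_tmul]; rfl⟩
    exact h hT
  intro x
  rw [closure_subtype]
  refine closure_mono ?_ (bkAlg_le_closure x.2)
  intro T hT
  obtain ⟨u, hu⟩ := hsp T hT
  exact ⟨_, ⟨u, rfl⟩, hu⟩

variable (H K) in
/-- The dense embedding of the algebraic tensor product into `B(H) ⊗_ε 𝔎(K)`. -/
def injEmbedding : (H →L[ℂ] H) ⊗[ℂ] CompactOps K →ₗ[ℂ] BEpsK H K :=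
  (InjectiveTensor.ofCompletion (H →L[ℂ] H) (CompactOps K)).toLinearEquiv.toLinearMap ∘ₗ
    (UniformSpace.Completion.toComplL (𝕜 := ℂ)
      (E := InjTensor (H →L[ℂ] H) (CompactOps K))).toLinearMap ∘ₗ
    (InjTensor.of (H →L[ℂ] H) (CompactOps K)).toLinearMap

theorem injEmbedding_tmul (a : H →L[ℂ] H) (k : CompactOps K) :
    injEmbedding H K (a ⊗ₜ k) = itmul a k := rfl

theorem norm_injEmbedding (u : (H →L[ℂ] H) ⊗[ℂ] CompactOps K) :
    ‖injEmbedding H K u‖ = injNorm u :=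
  UniformSpace.Completion.norm_coe (InjTensor.of (H →L[ℂ] H) (CompactOps K) u)

theorem denseRange_injEmbedding : DenseRange (injEmbedding H K) :=
  UniformSpace.Completion.denseRange_coe (α := InjTensor (H →L[ℂ] H) (CompactOps K))

/-- The injective norm is dominated by the operator norm. -/
theorem injNorm_le_norm_algTensorOp [CompleteSpace H] (u : (H →L[ℂ] H) ⊗[ℂ] CompactOps K) :
    injNorm u ≤ ‖algTensorOp H K u‖ := by
  refine csSup_le ⟨0, zero_mem_injNormSet u⟩ ?_
  rintro r ⟨f, g, hf, hg, rfl⟩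
  have h : TensorProduct.lid ℂ ℂ (TensorProduct.map f.toLinearMap g.toLinearMap u) =
      g (leftSlice f u) := by
    have h1 : (TensorProduct.lid ℂ ℂ).toLinearMap ∘ₗ
        TensorProduct.map f.toLinearMap g.toLinearMap = g.toLinearMap ∘ₗ leftSlice f :=
      TensorProduct.ext' fun a k => by
        simp [leftSlice_tmul]
    exact LinearMap.congr_fun h1 u
  rw [h]
  exact ((g.le_of_opNorm_le hg _).trans (one_mul _).le).trans (norm_leftSlice_le hf u)

/-- Functionals which are bounded for the injective norm are bounded for the operator norm. -/
theorem exists_extension_of_injective [CompleteSpace H] :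
    ∃ J : StrongDual ℂ (BEpsK H K) →ₗ[ℂ] StrongDual ℂ (bkAlg H K),
      Function.Injective J ∧ (∀ ζ, ‖J ζ‖ ≤ ‖ζ‖) ∧
      ∀ ζ a k, J ζ (bkTmul a k) = ζ (itmul a k) := by
  obtain ⟨J, h1, h2, h3⟩ := exists_dual_map_of_norm_le (injEmbedding H K) (algTensorOp H K)
    denseRange_injEmbedding denseRange_algTensorOp fun u =>
      (norm_injEmbedding u).trans_le (injNorm_le_norm_algTensorOp u)
  refine ⟨J, h1, h2, fun ζ a k => ?_⟩
  rw [← algTensorOp_tmul, h3, injEmbedding_tmul]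

end DualInclusions

/-! ### Operators from sesquilinear forms -/

section SesquilinearForms

open ContinuousLinearMap

variable {L : Type*} [NormedAddCommGroup L] [InnerProductSpace ℂ L] [CompleteSpace L]

/-- A bounded sesquilinear form is given by a bounded operator. -/
theorem exists_op_of_sesquilinear (B : L →ₗ⋆[ℂ] L →ₗ[ℂ] ℂ) {C : ℝ} (hC : 0 ≤ C)
    (hB : ∀ y x, ‖B y x‖ ≤ C * ‖y‖ * ‖x‖) :
    ∃ T : L →L[ℂ] L, (∀ x y, ⟪y, T x⟫_ℂ = B y x) ∧ ‖T‖ ≤ C := by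
  let B' : L →L⋆[ℂ] L →L[ℂ] ℂ := LinearMap.mkContinuous₂ B C hB
  have h : ∀ x y, ⟪y, ContinuousLinearMap.adjoint
      (InnerProductSpace.continuousLinearMapOfBilin B') x⟫_ℂ = B y x := fun x y => by
    rw [adjoint_inner_right, InnerProductSpace.continuousLinearMapOfBilin_apply]
    rfl
  refine ⟨_, h, opNorm_le_of_inner hC fun x y => ?_⟩
  rw [h]
  exact (hB y x).trans_eq (by ring)

/-- A bounded sesquilinear form which satisfies the trace norm estimate is given by an operator of
trace class. -/
theorem exists_traceClass_of_sesquilinear (B : L →ₗ⋆[ℂ] L →ₗ[ℂ] ℂ) {C : ℝ} (hC : 0 ≤ C)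
    (hB : ∀ y x, ‖B y x‖ ≤ C * ‖y‖ * ‖x‖)
    (h : ∀ (n : ℕ) (e f : Fin n → L) (c : Fin n → ℂ), Orthonormal ℂ e → Orthonormal ℂ f →
      (∀ i, ‖c i‖ = 1) → ‖∑ i, c i * B (f i) (e i)‖ ≤ C) :
    ∃ ϱ : TraceClass L, ∀ x y, ⟪y, ϱ.op x⟫_ℂ = B y x := by
  obtain ⟨T, hT, -⟩ := exists_op_of_sesquilinear B hC hB
  refine ⟨TraceClass.mk T (isTraceClass_of_forall (C := C) fun n e f he hf => ?_), hT⟩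
  choose c hc hc' using fun i => RCLike.exists_norm_eq_mul_self (⟪f i, T (e i)⟫_ℂ)
  have h1 : ((∑ i, ‖⟪f i, T (e i)⟫_ℂ‖ : ℝ) : ℂ) = ∑ i, c i * B (f i) (e i) := by
    push_cast
    exact Finset.sum_congr rfl fun i _ => (hc' i).trans (by rw [hT])
  have h2 := h n e f c he hf hc
  rwa [← h1, Complex.norm_real, Real.norm_of_nonneg (by positivity)] at h2

end SesquilinearForms

/-! ### Normal and singular functionals -/

section NormalFunctionals

open InnerProductSpace ContinuousLinearMap

variable {H K : Type*} [NormedAddCommGroup H] [InnerProductSpace ℂ H]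
  [NormedAddCommGroup K] [InnerProductSpace ℂ K]

/-- The functional `x ↦ Tr (ϱ x)` on `B(H) ⊗ 𝔎(K)`. -/
def densityFunctional : TraceClass (HTensor H K) →ₗ[ℂ] StrongDual ℂ (bkAlg H K) where
  toFun ϱ := tracePairing ϱ ∘L (bkAlg H K).subtypeL
  map_add' ϱ σ := by rw [map_add, ContinuousLinearMap.add_comp]
  map_smul' c ϱ := by rw [map_smul, ContinuousLinearMap.smul_comp, RingHom.id_apply]

theorem densityFunctional_apply (ϱ : TraceClass (HTensor H K)) (x : bkAlg H K) :
    densityFunctional ϱ x = trace (ϱ.op ∘L x.1) := rfl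

/-- The ultraweakly continuous functionals are those with a density operator. -/
theorem isUltraweaklyContinuous_iff (ρ : StrongDual ℂ (bkAlg H K)) :
    IsUltraweaklyContinuous ρ ↔ ∃ ϱ, ρ = densityFunctional ϱ := by
  let F : TraceClass (HTensor H K) →ₗ[ℂ] (bkAlg H K →ₗ[ℂ] ℂ) :=
    ContinuousLinearMap.coeLM ℂ ∘ₗ densityFunctional
  have h1 := LinearMap.mem_span_iff_continuous (f := F) ρ.toLinearMap
  have h2 : IsUltraweaklyContinuous ρ ↔ ρ.toLinearMap ∈ Submodule.span ℂ (Set.range F) := by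
    have ht : TopologicalSpace.induced Subtype.val (ultraweakTopology (HTensor H K)) =
        ⨅ ϱ, TopologicalSpace.induced (F ϱ) inferInstance := by
      rw [ultraweakTopology, induced_iInf]
      exact iInf_congr fun ϱ => induced_compose
    rw [h1, IsUltraweaklyContinuous, ht]
    rfl
  rw [h2, ← LinearMap.coe_range, Submodule.span_eq]
  constructor
  · rintro ⟨ϱ, hϱ⟩
    exact ⟨ϱ, ContinuousLinearMap.coe_injective hϱ.symm⟩
  · rintro ⟨ϱ, rfl⟩
    exact ⟨ϱ, rfl⟩

theorem isPositiveFunctional_densityFunctional {ϱ : TraceClass (HTensor H K)} (hϱ : 0 ≤ ϱ.op) :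
    IsPositiveFunctional (densityFunctional ϱ) := fun x hx => by
  rw [densityFunctional_apply, trace_comp_comm]
  exact trace_comp_nonneg ϱ hϱ hx

variable [CompleteSpace H] [CompleteSpace K]

/-- The operator `z ↦ ⟪y, z⟫ x` as an element of `B(H) ⊗ 𝔎(K)`. -/
def bkRankOne (x y : HTensor H K) : bkAlg H K := ⟨rankOne ℂ x y, rankOne_mem_bkAlg x y⟩

theorem bkRankOne_add_left (x x' y : HTensor H K) :
    bkRankOne (x + x') y = bkRankOne x y + bkRankOne x' y :=
  Subtype.ext (by simp [bkRankOne])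

theorem bkRankOne_add_right (x y y' : HTensor H K) :
    bkRankOne x (y + y') = bkRankOne x y + bkRankOne x y' :=
  Subtype.ext (by simp [bkRankOne])

theorem bkRankOne_smul_left (c : ℂ) (x y : HTensor H K) :
    bkRankOne (c • x) y = c • bkRankOne x y :=
  Subtype.ext (by simp [bkRankOne])

theorem bkRankOne_smul_right (c : ℂ) (x y : HTensor H K) :
    bkRankOne x (c • y) = (starRingEnd ℂ) c • bkRankOne x y :=
  Subtype.ext (by simp [bkRankOne])

theorem norm_bkRankOne (x y : HTensor H K) : ‖bkRankOne x y‖ = ‖x‖ * ‖y‖ := by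
  rw [Submodule.coe_norm, bkRankOne, norm_rankOne]

theorem densityFunctional_bkRankOne (ϱ : TraceClass (HTensor H K)) (x y : HTensor H K) :
    densityFunctional ϱ (bkRankOne x y) = ⟪y, ϱ.op x⟫_ℂ :=
  tracePairing_rankOne ϱ x y

theorem norm_sum_smul_rankOne_le_one {L : Type*} [NormedAddCommGroup L] [InnerProductSpace ℂ L]
    {n : ℕ} {e f : Fin n → L} (he : Orthonormal ℂ e) (hf : Orthonormal ℂ f) {c : Fin n → ℂ}
    (hc : ∀ i, ‖c i‖ = 1) : ‖∑ i, c i • rankOne ℂ (e i) (f i)‖ ≤ 1 := by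
  refine ContinuousLinearMap.opNorm_le_bound _ zero_le_one fun x => ?_
  rw [one_mul, ← sq_le_sq₀ (norm_nonneg _) (norm_nonneg _)]
  have h : (∑ i, c i • rankOne ℂ (e i) (f i)) x = ∑ i, (c i * ⟪f i, x⟫_ℂ) • e i := by
    simp [sum_apply, smul_smul]
  rw [h, norm_sum_smul_sq_of_orthonormal he]
  simp only [norm_mul, hc, one_mul]
  exact hf.sum_inner_products_le x

/-- The restriction of a bounded functional to the operators of finite rank has a density operator,
which is of trace class because `∑ i, c i • |e i⟩⟨f i|` is a contraction for orthonormal `e`, `f`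
and phases `c i`. -/
theorem exists_density (ω : StrongDual ℂ (bkAlg H K)) :
    ∃ ϱ : TraceClass (HTensor H K), ∀ x y, ω (bkRankOne x y) = densityFunctional ϱ (bkRankOne x y) := by
  let B : HTensor H K →ₗ⋆[ℂ] HTensor H K →ₗ[ℂ] ℂ :=
    LinearMap.mk₂'ₛₗ (starRingEnd ℂ) (RingHom.id ℂ) (fun y x => ω (bkRankOne x y))
      (fun y y' x => by rw [bkRankOne_add_right, map_add])
      (fun c y x => by rw [bkRankOne_smul_right, map_smul])
      (fun y x x' => by rw [bkRankOne_add_left, map_add])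
      (fun c y x => by rw [bkRankOne_smul_left, map_smul, RingHom.id_apply])
  obtain ⟨ϱ, hϱ⟩ := exists_traceClass_of_sesquilinear B (norm_nonneg ω)
    (fun y x => (ω.le_opNorm (bkRankOne x y)).trans_eq
      ((congrArg _ (norm_bkRankOne x y)).trans (by ring)))
    (fun n e f c he hf hc => by
      have h1 : ∑ i, c i * B (f i) (e i) = ω (∑ i, c i • bkRankOne (e i) (f i)) := by
        rw [map_sum]
        exact Finset.sum_congr rfl fun i _ => (map_smul ω _ _).symm
      have h2 : ‖∑ i, c i • bkRankOne (e i) (f i)‖ ≤ 1 := by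
        refine le_of_eq_of_le ?_ (norm_sum_smul_rankOne_le_one he hf hc)
        rw [Submodule.coe_norm, Submodule.coe_sum]
        rfl
      rw [h1]
      exact (ω.le_of_opNorm_le_of_le le_rfl h2).trans_eq (mul_one _))
  exact ⟨ϱ, fun x y => (densityFunctional_bkRankOne ϱ x y).symm ▸ (hϱ x y).symm⟩

/-- A normal functional is determined by its values on the operators of finite rank. -/
theorem densityFunctional_ext {ϱ σ : TraceClass (HTensor H K)}
    (h : ∀ x y, densityFunctional ϱ (bkRankOne x y) = densityFunctional σ (bkRankOne x y)) :
    ϱ = σ := by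
  refine TraceClass.op_injective (ContinuousLinearMap.ext fun x => ext_inner_left ℂ fun y => ?_)
  rw [← densityFunctional_bkRankOne, ← densityFunctional_bkRankOne, h]

theorem densityFunctional_injective :
    Function.Injective (densityFunctional (H := H) (K := K)) :=
  fun _ _ h => densityFunctional_ext fun x y => by rw [h]

theorem bkRankOne_self_nonneg (x : HTensor H K) : 0 ≤ (bkRankOne x x).1 :=
  (nonneg_iff_isPositive _).2 (isPositive_rankOne_self x)

theorem density_nonneg {ω : StrongDual ℂ (bkAlg H K)} (hω : IsPositiveFunctional ω)
    {ϱ : TraceClass (HTensor H K)}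
    (h : ∀ x y, ω (bkRankOne x y) = densityFunctional ϱ (bkRankOne x y)) : 0 ≤ ϱ.op :=
  nonneg_of_inner_nonneg fun x => by
    rw [← densityFunctional_bkRankOne, ← h]
    exact hω _ (bkRankOne_self_nonneg x)

/-- A positive functional dominates its normal part. For `T ≥ 0` the finite rank operators
`T^{1/2} p T^{1/2}`, with `p` the projection onto the span of finitely many basis vectors, are
dominated by `T`, and `Tr (ϱ T^{1/2} p T^{1/2})` converges to `Tr (ϱ T)`. -/
theorem isPositiveFunctional_sub_densityFunctional {ω : StrongDual ℂ (bkAlg H K)}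
    (hω : IsPositiveFunctional ω) {ϱ : TraceClass (HTensor H K)}
    (h : ∀ x y, ω (bkRankOne x y) = densityFunctional ϱ (bkRankOne x y)) :
    IsPositiveFunctional (ω - densityFunctional ϱ) := by
  intro T hT
  obtain ⟨s, -, hs, hss⟩ := exists_sqrt hT
  have htr : trace (ϱ.op ∘L T.1) = trace (TraceClass.conj s s ϱ).op := by
    rw [← hss, trace_comp_comp_comm, TraceClass.op_conj]
  have hsum := hasSum_trace (TraceClass.conj s s ϱ).isTraceClass
  rw [← htr, ← densityFunctional_apply] at hsum
  rw [sub_apply, sub_nonneg]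
  refine hasSum_le_of_sum_le hsum fun F => ?_
  let b := traceBasis (HTensor H K)
  have h1 : ∀ v, ⟪b v, (TraceClass.conj s s ϱ).op (b v)⟫_ℂ = ω (bkRankOne (s (b v)) (s (b v))) := by
    intro v
    rw [h, densityFunctional_bkRankOne, TraceClass.op_conj, ContinuousLinearMap.comp_apply,
      ContinuousLinearMap.comp_apply, ← adjoint_inner_left, hs]
  change ∑ v ∈ F, ⟪b v, (TraceClass.conj s s ϱ).op (b v)⟫_ℂ ≤ _
  simp only [h1]
  rw [← map_sum, ← sub_nonneg, ← map_sub]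
  refine hω _ (nonneg_of_inner_nonneg fun x => ?_)
  have h2 : ⟪x, T.1 x⟫_ℂ = ((‖s x‖ ^ 2 : ℝ) : ℂ) := by
    rw [← hss, ContinuousLinearMap.comp_apply, ← adjoint_inner_left, hs,
      inner_self_eq_norm_sq_to_K]
    simp
  have h3 : ⟪x, (∑ v ∈ F, bkRankOne (s (b v)) (s (b v))).1 x⟫_ℂ =
      ((∑ v ∈ F, ‖⟪b v, s x⟫_ℂ‖ ^ 2 : ℝ) : ℂ) := by
    rw [Submodule.coe_sum, sum_apply, inner_sum]
    push_cast
    refine Finset.sum_congr rfl fun v _ => ?_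
    have h4 : ⟪s (b v), x⟫_ℂ = ⟪b v, s x⟫_ℂ := by
      rw [← adjoint_inner_right, hs]
    change ⟪x, rankOne ℂ (s (b v)) (s (b v)) x⟫_ℂ = _
    rw [rankOne_apply, inner_smul_right, h4, ← inner_conj_symm x, h4, Complex.mul_conj']
  rw [Submodule.coe_sub, sub_apply, inner_sub_right, h2, h3, ← Complex.ofReal_sub,
    Complex.zero_le_real, sub_nonneg]
  exact b.orthonormal.sum_inner_products_le (s x)

/-- A positive functional is singular if and only if it vanishes on the operators of finite rank. -/
theorem isPositiveSingular_iff (ω : StrongDual ℂ (bkAlg H K)) :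
    IsPositiveSingular ω ↔ IsPositiveFunctional ω ∧ ∀ x y, ω (bkRankOne x y) = 0 := by
  refine and_congr_right fun hω => ⟨fun h x y => ?_, fun h σ hσ hσ' hωσ => ?_⟩
  · obtain ⟨ϱ, hϱ⟩ := exists_density ω
    rw [hϱ, h _ (isPositiveFunctional_densityFunctional (density_nonneg hω hϱ))
      ((isUltraweaklyContinuous_iff _).2 ⟨ϱ, rfl⟩)
      (isPositiveFunctional_sub_densityFunctional hω hϱ)]
    rfl
  · obtain ⟨ϱ, rfl⟩ := (isUltraweaklyContinuous_iff _).1 hσ'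
    have h0 : ϱ.op = 0 := by
      refine ContinuousLinearMap.coe_injective ((inner_map_self_eq_zero _).1 fun x => ?_)
      have h1 := hσ _ (bkRankOne_self_nonneg x)
      have h2 := hωσ _ (bkRankOne_self_nonneg x)
      rw [sub_apply, h, zero_sub, neg_nonneg] at h2
      have h3 := le_antisymm h2 h1
      rw [densityFunctional_bkRankOne] at h3
      exact inner_eq_zero_symm.1 h3
    rw [TraceClass.op_injective (h0.trans (map_zero _).symm), map_zero]

theorem IsSingular.apply_bkRankOne {ω : StrongDual ℂ (bkAlg H K)} (hω : IsSingular ω)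
    (x y : HTensor H K) : ω (bkRankOne x y) = 0 := by
  induction hω using Submodule.span_induction with
  | mem σ hσ => exact ((isPositiveSingular_iff σ).1 hσ).2 x y
  | zero => rfl
  | add σ τ _ _ h1 h2 => rw [add_apply, h1, h2, add_zero]
  | smul c σ _ h1 => rw [smul_apply, h1, smul_zero]

end NormalFunctionals

/-! ### Decomposition of functionals into positive ones -/

section JordanDecomposition

variable {E : Type*} [NormedAddCommGroup E] [NormedSpace ℂ E] {P : E → Prop}

/-- Let the norm be monotone on the cone `P`, and `ρ` a bounded real-linear functional. By
Hahn–Banach there is a bounded real-linear functional `g` with `g ≥ 0` and `g ≥ ρ` on `P`. The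
sublinear functional is `a ↦ inf {‖ρ‖ ‖a + b + d‖ - ρ b : b, d ∈ P}`: it is at most `-ρ b` at `-b`,
and at most `0` at `-d`. -/
theorem exists_real_functional_ge (hadd : ∀ x y, P x → P y → P (x + y))
    (hsmul : ∀ (t : ℝ) x, 0 < t → P x → P (t • x)) (h0 : P 0)
    (hnorm : ∀ x y, P x → P y → ‖x‖ ≤ ‖x + y‖) (ρ : StrongDual ℂ E) :
    ∃ g : E →ₗ[ℝ] ℝ, (∀ x, |g x| ≤ ‖ρ‖ * ‖x‖) ∧ (∀ x, P x → 0 ≤ g x) ∧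
      ∀ x, P x → (ρ x).re ≤ g x := by
  let Q : E → Set ℝ := fun a =>
    {r | ∃ b d, P b ∧ P d ∧ r = ‖ρ‖ * ‖a + b + d‖ - (ρ b).re}
  have hQ : ∀ a b d, P b → P d → ‖ρ‖ * ‖a + b + d‖ - (ρ b).re ∈ Q a :=
    fun a b d hb hd => ⟨b, d, hb, hd, rfl⟩
  have hne : ∀ a, (Q a).Nonempty := fun a => ⟨_, hQ a 0 0 h0 h0⟩
  have hlow : ∀ a, -(‖ρ‖ * ‖a‖) ∈ lowerBounds (Q a) := by
    rintro a r ⟨b, d, hb, hd, rfl⟩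
    have h1 : ‖b + d‖ ≤ ‖a + b + d‖ + ‖a‖ := by
      have := norm_sub_le (a + b + d) a
      rwa [show a + b + d - a = b + d by abel] at this
    have h2 : (ρ b).re ≤ ‖ρ‖ * (‖a + b + d‖ + ‖a‖) :=
      ((Complex.re_le_norm _).trans (ρ.le_opNorm b)).trans
        (mul_le_mul_of_nonneg_left ((hnorm b d hb hd).trans h1) (norm_nonneg _))
    linarith
  have hbdd : ∀ a, BddBelow (Q a) := fun a => ⟨_, hlow a⟩
  let q : E → ℝ := fun a => sInf (Q a)
  have hle : ∀ a b d, P b → P d → q a ≤ ‖ρ‖ * ‖a + b + d‖ - (ρ b).re :=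
    fun a b d hb hd => csInf_le (hbdd a) (hQ a b d hb hd)
  have hsc : ∀ t : ℝ, 0 < t → ∀ a, q (t • a) ≤ t * q a := by
    intro t ht a
    rw [← div_le_iff₀' ht]
    refine le_csInf (hne a) ?_
    rintro r ⟨b, d, hb, hd, rfl⟩
    rw [div_le_iff₀' ht]
    refine (hle (t • a) (t • b) (t • d) (hsmul t b ht hb) (hsmul t d ht hd)).trans_eq ?_
    rw [← smul_add, ← smul_add, norm_smul, Real.norm_of_nonneg ht.le, ← Complex.coe_smul, map_smul,
      smul_eq_mul, Complex.re_ofReal_mul]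
    ring
  obtain ⟨g, -, hg⟩ := exists_extension_of_le_sublinear (E := E) ⊥ q
    (fun t ht a => by
      refine le_antisymm (hsc t ht a) ?_
      have h := hsc t⁻¹ (inv_pos.2 ht) (t • a)
      rw [smul_smul, inv_mul_cancel₀ ht.ne', one_smul] at h
      rwa [le_inv_mul_iff₀ ht] at h)
    (fun x y => by
      rw [← sub_le_iff_le_add]
      refine le_csInf (hne x) ?_
      rintro r ⟨b', d', hb', hd', rfl⟩
      rw [sub_le_iff_le_add, ← sub_le_iff_le_add']
      refine le_csInf (hne y) ?_
      rintro r ⟨b, d, hb, hd, rfl⟩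
      have h1 := hle (x + y) (b' + b) (d' + d) (hadd _ _ hb' hb) (hadd _ _ hd' hd)
      rw [map_add, Complex.add_re,
        show x + y + (b' + b) + (d' + d) = (x + b' + d') + (y + b + d) by abel] at h1
      have h2 := mul_le_mul_of_nonneg_left (norm_add_le (x + b' + d') (y + b + d)) (norm_nonneg ρ)
      linarith)
    (by
      intro x
      have hx : x = 0 := Subtype.ext ((Submodule.mem_bot ℝ).1 x.2)
      rw [hx, LinearPMap.map_zero]
      refine le_csInf (hne 0) fun r hr => ?_
      have := hlow 0 hr
      simpa using this)
  have hgn : ∀ x, g x ≤ ‖ρ‖ * ‖x‖ := fun x =>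
    (hg x).trans ((hle x 0 0 h0 h0).trans_eq (by simp))
  refine ⟨g, fun x => abs_le.2 ⟨?_, hgn x⟩, fun x hx => ?_, fun x hx => ?_⟩
  · have := hgn (-x)
    rw [map_neg, norm_neg] at this
    linarith
  · have := (hg (-x)).trans (hle (-x) 0 x h0 hx)
    simp only [map_neg, add_zero, neg_add_cancel, norm_zero, mul_zero, map_zero, Complex.zero_re,
      sub_zero] at this
    linarith
  · have := (hg (-x)).trans (hle (-x) x 0 hx h0)
    simp only [map_neg, add_zero, neg_add_cancel, norm_zero, mul_zero, zero_sub] at this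
    linarith

variable (σ : E →ₗ⋆[ℂ] E)

/-- A bounded functional which is real on the cone `P` is the difference of two positive ones. -/
theorem exists_positive_ge (hadd : ∀ x y, P x → P y → P (x + y))
    (hsmul : ∀ (t : ℝ) x, 0 < t → P x → P (t • x)) (h0 : P 0)
    (hnorm : ∀ x y, P x → P y → ‖x‖ ≤ ‖x + y‖) (hσ : ∀ x, ‖σ x‖ ≤ ‖x‖)
    (hfix : ∀ x, P x → σ x = x) (ρ : StrongDual ℂ E) (hρ : ∀ x, P x → (ρ x).im = 0) :
    ∃ ω : StrongDual ℂ E, (∀ x, P x → 0 ≤ ω x) ∧ ∀ x, P x → 0 ≤ (ω - ρ) x := by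
  obtain ⟨g, hgn, hg0, hgρ⟩ := exists_real_functional_ge hadd hsmul h0 hnorm ρ
  -- `g` is made hermitian before it is extended to a complex-linear functional
  let h : Module.Dual ℝ E :=
    { toFun := fun x => (g x + g (σ x)) / 2
      map_add' := fun x y => by
        simp only [map_add]
        ring
      map_smul' := fun t x => by
        have h1 : σ (t • x) = t • σ x := by
          rw [← Complex.coe_smul, map_smulₛₗ, Complex.conj_ofReal, Complex.coe_smul]
        simp only [h1, map_smul, smul_eq_mul, RingHom.id_apply]
        ring }
  have hh : ∀ x, h x = (g x + g (σ x)) / 2 := fun x => rfl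
  have hhn : ∀ x, |h x| ≤ ‖ρ‖ * ‖x‖ := by
    intro x
    have h1 := abs_add_le (g x) (g (σ x))
    have h2 := (hgn (σ x)).trans (mul_le_mul_of_nonneg_left (hσ x) (norm_nonneg ρ))
    rw [hh, abs_div, abs_two, div_le_iff₀ two_pos]
    linarith [hgn x]
  let ω : StrongDual ℂ E := LinearMap.mkContinuous (h.extendRCLike (𝕜 := ℂ)) (2 * ‖ρ‖) fun x => by
    rw [Module.Dual.extendRCLike_apply]
    refine (norm_sub_le _ _).trans ?_
    have h1 := hhn x
    have h2 := hhn (Complex.I • x)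
    rw [norm_smul, Complex.norm_I, one_mul] at h2
    simp only [norm_mul, RCLike.norm_ofReal, RCLike.I_to_complex, Complex.norm_I, one_mul]
    linarith
  have hω : ∀ x, P x → ω x = ((g x : ℝ) : ℂ) := by
    intro x hx
    have h1 : ω x = (h x : ℂ) - Complex.I * (h (Complex.I • x) : ℂ) := rfl
    have h2 : σ (Complex.I • x) = -(Complex.I • x) := by
      rw [map_smulₛₗ, hfix x hx, Complex.conj_I, neg_smul]
    rw [h1, hh, hh, h2, hfix x hx, map_neg]
    simp
  refine ⟨ω, fun x hx => ?_, fun x hx => ?_⟩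
  · rw [hω x hx]
    exact_mod_cast hg0 x hx
  · have h1 : ρ x = (((ρ x).re : ℝ) : ℂ) := Complex.ext rfl (by rw [hρ x hx, Complex.ofReal_im])
    rw [sub_apply, hω x hx, h1, sub_nonneg]
    exact_mod_cast hgρ x hx

/-- Bounded functionals are linear combinations of positive ones. -/
theorem mem_span_positive (hadd : ∀ x y, P x → P y → P (x + y))
    (hsmul : ∀ (t : ℝ) x, 0 < t → P x → P (t • x)) (h0 : P 0)
    (hnorm : ∀ x y, P x → P y → ‖x‖ ≤ ‖x + y‖) (hσ : ∀ x, ‖σ x‖ ≤ ‖x‖)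
    (hfix : ∀ x, P x → σ x = x) (ρ : StrongDual ℂ E) :
    ρ ∈ Submodule.span ℂ {ω : StrongDual ℂ E | ∀ x, P x → 0 ≤ ω x} := by
  have key : ∀ ρ : StrongDual ℂ E, (∀ x, P x → (ρ x).im = 0) →
      ρ ∈ Submodule.span ℂ {ω : StrongDual ℂ E | ∀ x, P x → 0 ≤ ω x} := by
    intro ρ hρ
    obtain ⟨ω, h1, h2⟩ := exists_positive_ge σ hadd hsmul h0 hnorm hσ hfix ρ hρ
    rw [← sub_sub_cancel ω ρ]
    exact Submodule.sub_mem _ (Submodule.subset_span h1) (Submodule.subset_span h2)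
  let ρs : StrongDual ℂ E := LinearMap.mkContinuous
    { toFun := fun x => (starRingEnd ℂ) (ρ (σ x))
      map_add' := fun x y => by simp
      map_smul' := fun c x => by simp } ‖ρ‖ fun x => by
        change ‖(starRingEnd ℂ) (ρ (σ x))‖ ≤ _
        rw [RCLike.norm_conj]
        exact (ρ.le_opNorm _).trans (mul_le_mul_of_nonneg_left (hσ x) (norm_nonneg ρ))
  have hρs : ∀ x, P x → ρs x = (starRingEnd ℂ) (ρ x) := fun x hx => by
    change (starRingEnd ℂ) (ρ (σ x)) = _
    rw [hfix x hx]
  have h1 := key (ρ + ρs) fun x hx => by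
    rw [add_apply, hρs x hx]
    simp
  have h2 := key (Complex.I • (ρ - ρs)) fun x hx => by
    rw [smul_apply, sub_apply, hρs x hx]
    simp
  have h3 : ρ = (2⁻¹ : ℂ) • (ρ + ρs) - (2⁻¹ * Complex.I) • (Complex.I • (ρ - ρs)) := by
    rw [smul_smul, mul_assoc, Complex.I_mul_I]
    module
  rw [h3]
  exact Submodule.sub_mem _ (Submodule.smul_mem _ _ h1) (Submodule.smul_mem _ _ h2)

end JordanDecomposition

/-! ### The decomposition into a normal and a singular part -/

section NormalSingular

open InnerProductSpace ContinuousLinearMap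

variable {H K : Type*} [NormedAddCommGroup H] [InnerProductSpace ℂ H]
  [NormedAddCommGroup K] [InnerProductSpace ℂ K] [CompleteSpace K]

/-- The normal functionals on `B(H) ⊗_π 𝔗(K)` are those with a density operator. -/
theorem isNormal_iff_exists (ψ : StrongDual ℂ (BPiT H K)) :
    IsNormal ψ ↔ ∃ ϱ : TraceClass (HTensor H K), ∀ u : BPiT H K,
      ψ u = trace (ϱ.op ∘L (canonicalMap u : bkAlg H K).1) := by
  constructor
  · rintro ⟨ρ, hρ, rfl⟩
    obtain ⟨ϱ, rfl⟩ := (isUltraweaklyContinuous_iff _).1 hρ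
    exact ⟨ϱ, fun u => rfl⟩
  · rintro ⟨ϱ, h⟩
    exact ⟨densityFunctional ϱ, (isUltraweaklyContinuous_iff _).2 ⟨ϱ, rfl⟩,
      ContinuousLinearMap.ext h⟩

variable [CompleteSpace H]

variable (H K) in
/-- The involution of `B(H) ⊗ 𝔎(K)`. -/
def bkStar : bkAlg H K →ₗ⋆[ℂ] bkAlg H K where
  toFun x := ⟨ContinuousLinearMap.adjoint x.1, adjoint_mem_bkAlg x.2⟩
  map_add' x y := Subtype.ext (map_add _ x.1 y.1)
  map_smul' c x := Subtype.ext (map_smulₛₗ _ c x.1)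

theorem mem_span_isPositiveFunctional (ρ : StrongDual ℂ (bkAlg H K)) :
    ρ ∈ Submodule.span ℂ {ω : StrongDual ℂ (bkAlg H K) | IsPositiveFunctional ω} := by
  refine mem_span_positive (P := fun x : bkAlg H K => 0 ≤ x.1) (bkStar H K)
    (fun x y hx hy => ?_) (fun t x ht hx => ?_) le_rfl (fun x y hx hy => ?_)
    (fun x => ?_) (fun x hx => ?_) ρ
  · exact add_nonneg hx hy
  · have ht' : (0 : ℂ) ≤ (t : ℂ) := by exact_mod_cast ht.le
    exact smul_nonneg ht' hx
  · exact CStarAlgebra.norm_le_norm_of_nonneg_of_le hx (le_add_of_nonneg_right hy)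
  · exact (LinearIsometryEquiv.norm_map ContinuousLinearMap.adjoint x.1).le
  · exact Subtype.ext (IsSelfAdjoint.of_nonneg hx).star_eq

/-- Every functional is uniquely the sum of a normal and a singular one. For a positive functional
the normal part is given by the density operator of its restriction to the finite rank operators. -/
theorem existsUnique_normal_add_singular (ρ : StrongDual ℂ (bkAlg H K)) :
    ∃! p : StrongDual ℂ (bkAlg H K) × StrongDual ℂ (bkAlg H K),
      IsUltraweaklyContinuous p.1 ∧ IsSingular p.2 ∧ ρ = p.1 + p.2 := by
  have hex : ∃ ϱ τ, IsSingular τ ∧ ρ = densityFunctional ϱ + τ := by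
    induction mem_span_isPositiveFunctional ρ using Submodule.span_induction with
    | mem ω hω =>
      obtain ⟨ϱ, hϱ⟩ := exists_density ω
      refine ⟨ϱ, ω - densityFunctional ϱ, Submodule.subset_span ?_, by abel⟩
      refine (isPositiveSingular_iff _).2
        ⟨isPositiveFunctional_sub_densityFunctional hω hϱ, fun x y => ?_⟩
      rw [sub_apply, hϱ, sub_self]
    | zero => exact ⟨0, 0, Submodule.zero_mem _, by simp⟩
    | add ω ω' _ _ h1 h2 =>
      obtain ⟨ϱ, τ, hτ, rfl⟩ := h1
      obtain ⟨ϱ', τ', hτ', rfl⟩ := h2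
      exact ⟨ϱ + ϱ', τ + τ', Submodule.add_mem _ hτ hτ', by rw [map_add]; abel⟩
    | smul c ω _ h1 =>
      obtain ⟨ϱ, τ, hτ, rfl⟩ := h1
      exact ⟨c • ϱ, c • τ, Submodule.smul_mem _ _ hτ, by rw [map_smul, smul_add]⟩
  obtain ⟨ϱ, τ, hτ, rfl⟩ := hex
  refine ⟨(densityFunctional ϱ, τ), ⟨(isUltraweaklyContinuous_iff _).2 ⟨ϱ, rfl⟩, hτ, rfl⟩, ?_⟩
  rintro ⟨ν, τ'⟩ ⟨hν, hτ', h⟩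
  obtain ⟨ϱ', rfl⟩ := (isUltraweaklyContinuous_iff _).1 hν
  have h1 : ϱ' = ϱ := densityFunctional_ext fun x y => by
    have h2 := congrArg (fun F => F (bkRankOne x y)) h
    simp only [add_apply, IsSingular.apply_bkRankOne hτ, IsSingular.apply_bkRankOne hτ',
      add_zero] at h2
    exact h2.symm
  subst h1
  have h2 : τ' = τ := ContinuousLinearMap.ext fun x =>
    (add_left_cancel (congrArg (fun F => F x) h)).symm
  rw [h2]

theorem restrictFunctional_densityFunctional_injective {ϱ σ : TraceClass (HTensor H K)}
    (h : ∀ u : BPiT H K, trace (ϱ.op ∘L (canonicalMap u : bkAlg H K).1) =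
      trace (σ.op ∘L (canonicalMap u : bkAlg H K).1)) : ϱ = σ :=
  densityFunctional_injective (restrictFunctional_injective (ContinuousLinearMap.ext h))

theorem isNormal_iff_existsUnique (ψ : StrongDual ℂ (BPiT H K)) :
    IsNormal ψ ↔ ∃! ϱ : TraceClass (HTensor H K), ∀ u : BPiT H K,
      ψ u = trace (ϱ.op ∘L (canonicalMap u : bkAlg H K).1) := by
  rw [isNormal_iff_exists]
  refine ⟨fun ⟨ϱ, h⟩ => ⟨ϱ, h, fun σ hσ => ?_⟩, fun h => h.exists⟩
  exact restrictFunctional_densityFunctional_injective fun u => (hσ u).symm.trans (h u)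

end NormalSingular

/-! ### Transposition -/

section Transposition

open InnerProductSpace ContinuousLinearMap

variable {K ι : Type*} [NormedAddCommGroup K] [InnerProductSpace ℂ K] (e : HilbertBasis ι ℂ K)

theorem conjBasis_apply (x : K) : conjBasis e x = e.repr.symm (star (e.repr x)) := rfl

@[simp]
theorem conjBasis_conjBasis (x : K) : conjBasis e (conjBasis e x) = x := by
  simp [conjBasis_apply]

theorem inner_conjBasis_conjBasis (x y : K) :
    ⟪conjBasis e x, conjBasis e y⟫_ℂ = ⟪y, x⟫_ℂ := by
  rw [← e.tsum_inner_mul_inner, ← e.tsum_inner_mul_inner y x]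
  refine tsum_congr fun i => ?_
  rw [inner_conjBasis, ← inner_conj_symm, inner_conjBasis, inner_conj_symm, mul_comm]

theorem inner_conjBasis_right (x y : K) : ⟪y, conjBasis e x⟫_ℂ = ⟪x, conjBasis e y⟫_ℂ := by
  rw [← inner_conjBasis_conjBasis e, conjBasis_conjBasis]

theorem norm_conjBasis (x : K) : ‖conjBasis e x‖ = ‖x‖ := by
  rw [← sq_eq_sq₀ (norm_nonneg _) (norm_nonneg _), ← inner_self_eq_norm_sq (𝕜 := ℂ),
    ← inner_self_eq_norm_sq (𝕜 := ℂ), inner_conjBasis_conjBasis]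

theorem orthonormal_conjBasis_comp {κ : Type*} {f : κ → K} (hf : Orthonormal ℂ f) :
    Orthonormal ℂ fun i => conjBasis e (f i) :=
  ⟨fun i => by rw [norm_conjBasis, hf.1], fun i j hij => by
    dsimp only
    rw [inner_conjBasis_conjBasis, hf.2 hij.symm]⟩

variable [CompleteSpace K]

theorem inner_transpose_apply (b : K →L[ℂ] K) (x y : K) :
    ⟪y, transpose e b x⟫_ℂ = ⟪conjBasis e x, b (conjBasis e y)⟫_ℂ := by
  change ⟪y, conjBasis e (ContinuousLinearMap.adjoint b (conjBasis e x))⟫_ℂ = _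
  rw [inner_conjBasis_right, adjoint_inner_left]

theorem sum_norm_inner_transpose_le {b : K →L[ℂ] K} (hb : IsTraceClass b) (n : ℕ)
    (f g : Fin n → K) (hf : Orthonormal ℂ f) (hg : Orthonormal ℂ g) :
    ∑ i, ‖⟪g i, transpose e b (f i)⟫_ℂ‖ ≤ traceNorm b := by
  simp only [inner_transpose_apply]
  exact le_traceNorm hb (orthonormal_conjBasis_comp e hg) (orthonormal_conjBasis_comp e hf)

/-- The transposition of trace class operators. -/
def TraceClass.transpose : TraceClass K →L[ℂ] TraceClass K :=
  LinearMap.mkContinuous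
    { toFun := fun b => TraceClass.mk (PosMaps.transpose e b.op)
        (isTraceClass_of_forall (sum_norm_inner_transpose_le e b.isTraceClass))
      map_add' := fun b c => TraceClass.op_injective (by
        ext x
        refine ext_inner_left ℂ fun y => ?_
        simp only [map_add, TraceClass.op_mk, add_apply, inner_add_right, inner_transpose_apply])
      map_smul' := fun c b => TraceClass.op_injective (by
        ext x
        refine ext_inner_left ℂ fun y => ?_
        simp only [map_smul, TraceClass.op_mk, smul_apply, inner_smul_right, inner_transpose_apply,
          RingHom.id_apply]) } 1
    fun b => by
      rw [one_mul]
      exact traceNorm_le_of_forall (sum_norm_inner_transpose_le e b.isTraceClass)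

theorem TraceClass.op_transpose (b : TraceClass K) :
    (TraceClass.transpose e b).op = PosMaps.transpose e b.op := rfl

theorem TraceClass.norm_transpose_le (b : TraceClass K) : ‖TraceClass.transpose e b‖ ≤ ‖b‖ :=
  traceNorm_le_of_forall (sum_norm_inner_transpose_le e b.isTraceClass)

theorem TraceClass.transpose_rankOne (x y : K) :
    TraceClass.transpose e (TraceClass.rankOne x y) =
      TraceClass.rankOne (conjBasis e y) (conjBasis e x) := by
  refine TraceClass.op_injective (ContinuousLinearMap.ext fun z => ext_inner_left ℂ fun w => ?_)
  rw [TraceClass.op_transpose, inner_transpose_apply, TraceClass.op_rankOne, TraceClass.op_rankOne,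
    rankOne_apply, rankOne_apply, inner_smul_right, inner_smul_right, inner_conjBasis_right e w y,
    ← inner_conj_symm (conjBasis e z), inner_conjBasis_right e z x, inner_conj_symm, mul_comm]

theorem transpose_nonneg {b : K →L[ℂ] K} (hb : 0 ≤ b) : 0 ≤ transpose e b :=
  nonneg_of_inner_nonneg fun x => by
    rw [inner_transpose_apply]
    exact inner_nonneg_of_nonneg hb _

end Transposition

/-! ### The duality of maps and functionals -/

section MapsAndFunctionals

open InnerProductSpace ContinuousLinearMap

variable {X Y : Type*} [NormedAddCommGroup X] [NormedSpace ℂ X] [NormedAddCommGroup Y]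
  [NormedSpace ℂ Y]

/-- The map `y ↦ x ⊗ y` into `X ⊗_π Y`. -/
def ptmulRight (x : X) : Y →L[ℂ] ProjectiveTensor X Y :=
  LinearMap.mkContinuous (projEmbedding X Y ∘ₗ TensorProduct.mk ℂ X Y x) ‖x‖ (norm_ptmul_le x)

theorem ptmulRight_apply (x : X) (y : Y) : ptmulRight x y = ptmul x y := rfl

theorem ptmul_add_left (x x' : X) (y : Y) : ptmul (x + x') y = ptmul x y + ptmul x' y := by
  simp only [← projEmbedding_tmul, TensorProduct.add_tmul, map_add]

theorem ptmul_smul_left (c : ℂ) (x : X) (y : Y) : ptmul (c • x) y = c • ptmul x y := by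
  simp only [← projEmbedding_tmul, ← TensorProduct.smul_tmul', map_smul]

variable {H K ι : Type*} [NormedAddCommGroup H] [InnerProductSpace ℂ H]
  [NormedAddCommGroup K] [InnerProductSpace ℂ K] (e : HilbertBasis ι ℂ K)

theorem norm_apply_ptmul_rankOne_le (ψ : StrongDual ℂ (BPiT H K)) (a : H →L[ℂ] H) (x y : K) :
    ‖ψ (ptmul a (TraceClass.rankOne (conjBasis e y) (conjBasis e x)))‖ ≤
      ‖ψ‖ * ‖a‖ * ‖x‖ * ‖y‖ := by
  have h1 := TraceClass.norm_rankOne_le (conjBasis e y) (conjBasis e x)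
  rw [norm_conjBasis, norm_conjBasis] at h1
  calc _ ≤ ‖ψ‖ * ‖ptmul a (TraceClass.rankOne (conjBasis e y) (conjBasis e x))‖ := ψ.le_opNorm _
    _ ≤ ‖ψ‖ * (‖a‖ * (‖y‖ * ‖x‖)) := by
        gcongr
        exact (norm_ptmul_le _ _).trans (by gcongr)
    _ = _ := by ring

variable [CompleteSpace K]

theorem exists_functional_of_map (φ : (H →L[ℂ] H) →L[ℂ] (K →L[ℂ] K)) :
    ∃ ψ : StrongDual ℂ (BPiT H K),
      (∀ a b, ψ (ptmul a b) = tracePairing (TraceClass.transpose e b) (φ a)) ∧ ‖ψ‖ ≤ ‖φ‖ :=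
  exists_projective_lift
    (LinearMap.mk₂ ℂ (fun a b => tracePairing (TraceClass.transpose e b) (φ a))
      (fun a a' b => by rw [map_add, map_add])
      (fun c a b => by rw [map_smul, map_smul])
      (fun a b b' => by rw [map_add, map_add, add_apply])
      (fun c a b => by rw [map_smul, map_smul, smul_apply]))
    (norm_nonneg φ) fun a b => by
      refine (norm_tracePairing_le _ _).trans ?_
      calc _ ≤ ‖b‖ * (‖φ‖ * ‖a‖) := mul_le_mul (TraceClass.norm_transpose_le e b) (φ.le_opNorm a)
              (norm_nonneg _) (norm_nonneg _)
        _ = _ := by ring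

variable (H) in
/-- The functional `φ̃` on `B(H) ⊗_π 𝔗(K)`, `φ̃(a ⊗ b) = Tr (φ(a) bᵗ)`, of the map `φ`. -/
def mapFunctional : ((H →L[ℂ] H) →L[ℂ] (K →L[ℂ] K)) →ₗ[ℂ] StrongDual ℂ (BPiT H K) where
  toFun φ := (exists_functional_of_map e φ).choose
  map_add' φ χ := ProjectiveTensor.clm_ext fun a b => by
    rw [(exists_functional_of_map e _).choose_spec.1, add_apply, add_apply,
      (exists_functional_of_map e _).choose_spec.1, (exists_functional_of_map e _).choose_spec.1,
      map_add]
  map_smul' c φ := ProjectiveTensor.clm_ext fun a b => by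
    rw [(exists_functional_of_map e _).choose_spec.1, smul_apply, RingHom.id_apply, smul_apply,
      (exists_functional_of_map e _).choose_spec.1, map_smul]

theorem mapFunctional_ptmul (φ : (H →L[ℂ] H) →L[ℂ] (K →L[ℂ] K)) (a : H →L[ℂ] H)
    (b : TraceClass K) : mapFunctional H e φ (ptmul a b) = trace (φ a ∘L transpose e b.op) :=
  ((exists_functional_of_map e φ).choose_spec.1 a b).trans
    (trace_comp_comm (TraceClass.transpose e b) (φ a))

theorem norm_mapFunctional_le (φ : (H →L[ℂ] H) →L[ℂ] (K →L[ℂ] K)) :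
    ‖mapFunctional H e φ‖ ≤ ‖φ‖ :=
  (exists_functional_of_map e φ).choose_spec.2

theorem mapFunctional_ptmul_rankOne (φ : (H →L[ℂ] H) →L[ℂ] (K →L[ℂ] K)) (a : H →L[ℂ] H)
    (x y : K) : mapFunctional H e φ (ptmul a (TraceClass.rankOne x y)) =
      ⟪conjBasis e x, φ a (conjBasis e y)⟫_ℂ := by
  rw [mapFunctional_ptmul, ← TraceClass.op_transpose, TraceClass.transpose_rankOne,
    TraceClass.op_rankOne, InnerProductSpace.comp_rankOne, trace_rankOne]

/-- The map `φ` is recovered from its functional. -/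
theorem inner_map_apply (φ : (H →L[ℂ] H) →L[ℂ] (K →L[ℂ] K)) (a : H →L[ℂ] H) (x y : K) :
    ⟪y, φ a x⟫_ℂ =
      mapFunctional H e φ (ptmul a (TraceClass.rankOne (conjBasis e y) (conjBasis e x))) := by
  rw [mapFunctional_ptmul_rankOne, conjBasis_conjBasis, conjBasis_conjBasis]

theorem norm_mapFunctional (φ : (H →L[ℂ] H) →L[ℂ] (K →L[ℂ] K)) :
    ‖mapFunctional H e φ‖ = ‖φ‖ := by
  refine le_antisymm (norm_mapFunctional_le e φ) ?_
  refine φ.opNorm_le_bound (norm_nonneg _) fun a => ?_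
  refine opNorm_le_of_inner (by positivity) fun x y => ?_
  rw [inner_map_apply e]
  exact norm_apply_ptmul_rankOne_le e _ a x y

/-- Every bounded functional on `B(H) ⊗_π 𝔗(K)` comes from a map, because the operators of finite
rank are dense in the trace class. -/
theorem mapFunctional_surjective : Function.Surjective (mapFunctional H e) := by
  intro ψ
  have hB : ∀ a : H →L[ℂ] H, ∃ T : K →L[ℂ] K, (∀ x y, ⟪y, T x⟫_ℂ =
      ψ (ptmulRight a (TraceClass.rankOne (conjBasis e y) (conjBasis e x)))) ∧
      ‖T‖ ≤ ‖ψ‖ * ‖a‖ := by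
    intro a
    refine exists_op_of_sesquilinear
      (LinearMap.mk₂'ₛₗ (starRingEnd ℂ) (RingHom.id ℂ)
        (fun y x => ψ (ptmulRight a (TraceClass.rankOne (conjBasis e y) (conjBasis e x))))
        (fun y y' x => ?_) (fun c y x => ?_) (fun y x x' => ?_) (fun c y x => ?_))
      (by positivity) fun y x => ?_
    · rw [← map_add, ← map_add]
      congr 2
      exact TraceClass.op_injective (by ext; simp)
    · rw [← map_smul, ← map_smul]
      congr 2
      exact TraceClass.op_injective (by ext; simp)
    · rw [← map_add, ← map_add]
      congr 2
      exact TraceClass.op_injective (by ext; simp)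
    · rw [← map_smul, ← map_smul]
      congr 2
      exact TraceClass.op_injective (by ext; simp)
    · exact (norm_apply_ptmul_rankOne_le e ψ a x y).trans_eq (by ring)
  choose T hT hTn using hB
  let φ : (H →L[ℂ] H) →L[ℂ] (K →L[ℂ] K) := LinearMap.mkContinuous
    { toFun := T
      map_add' := fun a a' => by
        ext x
        refine ext_inner_left ℂ fun y => ?_
        rw [add_apply, inner_add_right, hT, hT, hT, ptmulRight_apply, ptmulRight_apply,
          ptmulRight_apply, ptmul_add_left, map_add]
      map_smul' := fun c a => by
        ext x
        refine ext_inner_left ℂ fun y => ?_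
        rw [RingHom.id_apply, smul_apply, inner_smul_right, hT, hT, ptmulRight_apply,
          ptmulRight_apply, ptmul_smul_left, map_smul, smul_eq_mul] } ‖ψ‖ hTn
  refine ⟨φ, ProjectiveTensor.clm_ext fun a b => ?_⟩
  have h : mapFunctional H e φ ∘L ptmulRight a = ψ ∘L ptmulRight a := by
    refine TraceClass.clm_ext fun x y => ?_
    rw [ContinuousLinearMap.comp_apply, ptmulRight_apply, mapFunctional_ptmul_rankOne]
    refine (hT a _ _).trans ?_
    rw [conjBasis_conjBasis, conjBasis_conjBasis]
    rfl
  exact congrArg (fun F => F b) h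

theorem mapFunctional_bijective : Function.Bijective (mapFunctional H e) := by
  refine ⟨fun φ χ h => ?_, mapFunctional_surjective e⟩
  have h1 := norm_mapFunctional e (φ - χ)
  rw [map_sub, h, sub_self, norm_zero] at h1
  exact sub_eq_zero.1 (norm_eq_zero.1 h1.symm)

variable (H) in
/-- The isometric isomorphism `φ ↦ φ̃` from the bounded maps `B(H) → B(K)` onto the dual of
`B(H) ⊗_π 𝔗(K)`. -/
def mapEquiv : ((H →L[ℂ] H) →L[ℂ] (K →L[ℂ] K)) ≃ₗᵢ[ℂ] StrongDual ℂ (BPiT H K) where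
  toLinearEquiv := LinearEquiv.ofBijective (mapFunctional H e) (mapFunctional_bijective e)
  norm_map' φ := by
    rw [LinearEquiv.ofBijective_apply, norm_mapFunctional]

theorem mapEquiv_apply (φ : (H →L[ℂ] H) →L[ℂ] (K →L[ℂ] K)) :
    mapEquiv H e φ = mapFunctional H e φ := rfl

theorem mapEquiv_ptmul (φ : (H →L[ℂ] H) →L[ℂ] (K →L[ℂ] K)) (a : H →L[ℂ] H) (b : TraceClass K) :
    mapEquiv H e φ (ptmul a b) = trace (φ a ∘L transpose e b.op) := by
  rw [mapEquiv_apply, mapFunctional_ptmul]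

/-- If `φ` is positive, so is `Tr (φ(a) bᵗ)`, because transposition preserves positivity; conversely
`φ(a) ≥ 0` follows from the case in which `b` has rank one. -/
theorem isPositiveMap_iff (φ : (H →L[ℂ] H) →L[ℂ] (K →L[ℂ] K)) :
    IsPositiveMap φ ↔ IsPositiveOnCone (mapEquiv H e φ) := by
  refine ⟨fun h a b ha hb => ?_, fun h a ha => nonneg_of_inner_nonneg fun x => ?_⟩
  · rw [mapEquiv_apply, mapFunctional_ptmul, ← TraceClass.op_transpose]
    exact trace_comp_nonneg _ (transpose_nonneg e hb) (h a ha)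
  · rw [inner_map_apply e, ← mapEquiv_apply]
    exact h a _ ha ((nonneg_iff_isPositive _).2 (isPositive_rankOne_self _))

end MapsAndFunctionals

/-! ### Maps with a density operator -/

section DensityMap

open InnerProductSpace ContinuousLinearMap

variable {H K ι : Type*} [NormedAddCommGroup H] [InnerProductSpace ℂ H]
  [NormedAddCommGroup K] [InnerProductSpace ℂ K] [CompleteSpace K] (e : HilbertBasis ι ℂ K)

/-- The map `φ_ϱ` with density operator `ϱ`. -/
def densityMap : TraceClass (HTensor H K) →ₗ[ℂ] ((H →L[ℂ] H) →L[ℂ] (K →L[ℂ] K)) where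
  toFun ϱ := (mapEquiv H e).symm (restrictFunctional (densityFunctional ϱ))
  map_add' ϱ σ := by
    rw [← map_add, map_add densityFunctional]
    rfl
  map_smul' c ϱ := by
    rw [RingHom.id_apply, ← map_smul, map_smul densityFunctional]
    rfl

theorem mapEquiv_densityMap (ϱ : TraceClass (HTensor H K)) :
    mapEquiv H e (densityMap e ϱ) = restrictFunctional (densityFunctional ϱ) :=
  (mapEquiv H e).apply_symm_apply _

theorem mapEquiv_densityMap_apply (ϱ : TraceClass (HTensor H K)) (u : BPiT H K) :
    mapEquiv H e (densityMap e ϱ) u = trace (ϱ.op ∘L (canonicalMap u : bkAlg H K).1) := by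
  rw [mapEquiv_densityMap]
  rfl

theorem norm_eq_sSup_div {E : Type*} [NormedAddCommGroup E] [NormedSpace ℂ E]
    (ψ : StrongDual ℂ E) : ‖ψ‖ = sSup {r | ∃ u : E, u ≠ 0 ∧ r = ‖ψ u‖ / ‖u‖} := by
  have hup : ‖ψ‖ ∈ upperBounds {r | ∃ u : E, u ≠ 0 ∧ r = ‖ψ u‖ / ‖u‖} := by
    rintro r ⟨u, hu, rfl⟩
    exact ψ.ratio_le_opNorm u
  have h0 : 0 ≤ sSup {r | ∃ u : E, u ≠ 0 ∧ r = ‖ψ u‖ / ‖u‖} :=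
    Real.sSup_nonneg (by rintro r ⟨u, hu, rfl⟩; positivity)
  refine le_antisymm (ψ.opNorm_le_bound h0 fun u => ?_) (Real.sSup_le hup (norm_nonneg _))
  rcases eq_or_ne u 0 with rfl | hu
  · simp
  · rw [← div_le_iff₀ (norm_pos_iff.2 hu)]
    exact le_csSup ⟨_, hup⟩ ⟨u, hu, rfl⟩

theorem norm_densityMap (ϱ : TraceClass (HTensor H K)) : ‖densityMap e ϱ‖ = alphaNorm ϱ := by
  rw [← LinearIsometryEquiv.norm_map (mapEquiv H e), mapEquiv_densityMap, norm_eq_sSup_div]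
  rfl

theorem range_densityMap :
    Set.range (densityMap (H := H) e) = {φ | IsNormal (mapEquiv H e φ)} := by
  ext φ
  rw [Set.mem_ofPred_eq, isNormal_iff_exists]
  constructor
  · rintro ⟨ϱ, rfl⟩
    exact ⟨ϱ, mapEquiv_densityMap_apply e ϱ⟩
  · rintro ⟨ϱ, h⟩
    refine ⟨ϱ, (mapEquiv H e).injective (ContinuousLinearMap.ext fun u => ?_)⟩
    rw [mapEquiv_densityMap_apply, h]

variable [CompleteSpace H]

theorem densityMap_injective : Function.Injective (densityMap (H := H) e) := by
  intro ϱ σ h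
  refine restrictFunctional_densityFunctional_injective fun u => ?_
  rw [← mapEquiv_densityMap_apply e, h, mapEquiv_densityMap_apply]

/-- The matrix elements of `φ_ϱ(a)`. -/
theorem inner_densityMap_apply (ϱ : TraceClass (HTensor H K)) (a : H →L[ℂ] H) (x y : K) :
    ⟪y, densityMap e ϱ a x⟫_ℂ =
      trace (ContinuousLinearMap.adjoint (tensorRight (conjBasis e x)) ∘L ϱ.op ∘L
        tensorRight (conjBasis e y) ∘L a) := by
  rw [inner_map_apply e, ← mapEquiv_apply, mapEquiv_densityMap_apply, canonicalMap_ptmul,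
    TraceClass.op_rankOne, tensorOp_rankOne, ← ContinuousLinearMap.comp_assoc (tensorRight _) a,
    trace_comp_comp_comm]

theorem inner_densityMap_rankOne (ϱ : TraceClass (HTensor H K)) (f f' : H) (x y : K) :
    ⟪y, densityMap e ϱ (rankOne ℂ f f') x⟫_ℂ =
      ⟪htmul f' (conjBasis e x), ϱ.op (htmul f (conjBasis e y))⟫_ℂ := by
  rw [inner_densityMap_apply, InnerProductSpace.comp_rankOne, InnerProductSpace.comp_rankOne,
    InnerProductSpace.comp_rankOne, trace_rankOne, adjoint_inner_right, tensorRight_apply,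
    tensorRight_apply]

/-- Positivity on the operators `|f⟩⟨f|` is block positivity of `ϱ`; it extends to positive `a`,
since `⟪x, φ_ϱ(a) x⟫` is the trace of `a^{1/2} T a^{1/2}` with `T` a compression of `ϱ`. -/
theorem isPositiveMap_densityMap_iff (ϱ : TraceClass (HTensor H K)) :
    IsPositiveMap (densityMap e ϱ) ↔ IsBlockPositive ϱ.op := by
  refine ⟨fun h f g => ?_, fun h a ha => nonneg_of_inner_nonneg fun x => ?_⟩
  · have h1 := inner_nonneg_of_nonneg
      (h _ ((nonneg_iff_isPositive _).2 (isPositive_rankOne_self f))) (conjBasis e g)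
    rwa [inner_densityMap_rankOne, conjBasis_conjBasis] at h1
  · obtain ⟨s, -, hs, rfl⟩ := exists_sqrt ha
    let T := TraceClass.conj (ContinuousLinearMap.adjoint (tensorRight (conjBasis e x)))
      (tensorRight (conjBasis e x)) ϱ
    have h1 : ⟪x, densityMap e ϱ (s ∘L s) x⟫_ℂ = trace (T.op ∘L s ∘L s) :=
      inner_densityMap_apply e ϱ (s ∘L s) x x
    rw [h1, trace_comp_comp_comm]
    refine trace_nonneg fun v => ?_
    rw [ContinuousLinearMap.comp_apply, ← adjoint_inner_left, hs, TraceClass.op_conj]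
    simp only [ContinuousLinearMap.comp_apply]
    rw [adjoint_inner_right]
    exact h _ _

end DensityMap

/-! ### The Russo–Dye theorem -/

section RussoDye

open InnerProductSpace ContinuousLinearMap Filter Topology

/-- Discrete orthogonality of the characters: averaging the resolvents `(1 - ζ ^ k x)⁻¹` over the
`m`-th roots of unity, with the weights `ζ ^ (k * c)`, picks out of the geometric series the powers
of `x` whose exponent is congruent to `-c` modulo `m`. -/
theorem sum_pow_smul_inverse {A : Type*} [Ring A] [Algebra ℂ A] {m : ℕ} {ζ : ℂ}
    (hζ : IsPrimitiveRoot ζ m) {x : A} {R : ℕ → A} {E : A}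
    (hR : ∀ k, R k * (1 - ζ ^ k • x) = 1)
    (hE : (1 - x ^ m) * E = 1) {c j : ℕ} (hj : j < m) (hc : m ∣ j + c) :
    ∑ k ∈ Finset.range m, ζ ^ (k * c) • R k = (m : ℂ) • (x ^ j * E) := by
  have h1 : ∀ k, R k = ∑ i ∈ Finset.range m, ζ ^ (k * i) • (x ^ i * E) := by
    intro k
    have h2 : (1 - ζ ^ k • x) * ∑ i ∈ Finset.range m, (ζ ^ k • x) ^ i = 1 - x ^ m := by
      rw [mul_neg_geom_sum, smul_pow, ← pow_mul, mul_comm, pow_mul, hζ.pow_eq_one, one_pow,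
        one_smul]
    calc R k = R k * ((1 - x ^ m) * E) := by rw [hE, mul_one]
      _ = (R k * (1 - ζ ^ k • x)) * ((∑ i ∈ Finset.range m, (ζ ^ k • x) ^ i) * E) := by
        rw [← h2]; simp only [mul_assoc]
      _ = _ := by
        rw [hR, one_mul, Finset.sum_mul]
        refine Finset.sum_congr rfl fun i _ => ?_
        rw [smul_pow, ← pow_mul, smul_mul_assoc]
  have h3 : ∀ i ∈ Finset.range m, i ≠ j → ∑ k ∈ Finset.range m, (ζ ^ (c + i)) ^ k = 0 := by
    intro i hi hij
    have hne : ζ ^ (c + i) ≠ 1 := by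
      rw [Ne, hζ.pow_eq_one_iff_dvd]
      intro hd
      rw [add_comm] at hd
      have h4 : i ≡ j [MOD m] := by
        have h5 : i + c ≡ j + c [MOD m] :=
          ((Nat.modEq_zero_iff_dvd).2 hd).trans ((Nat.modEq_zero_iff_dvd).2 hc).symm
        exact Nat.ModEq.add_right_cancel' c h5
      exact hij (Nat.ModEq.eq_of_lt_of_lt h4 (Finset.mem_range.1 hi) hj)
    have h6 := mul_neg_geom_sum (ζ ^ (c + i)) m
    rw [← pow_mul, mul_comm (c + i), pow_mul, hζ.pow_eq_one, one_pow, sub_self] at h6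
    exact (mul_eq_zero.1 h6).resolve_left (sub_ne_zero.2 hne.symm)
  calc ∑ k ∈ Finset.range m, ζ ^ (k * c) • R k
      = ∑ i ∈ Finset.range m, (∑ k ∈ Finset.range m, (ζ ^ (c + i)) ^ k) • (x ^ i * E) := by
        simp only [Finset.sum_smul]
        rw [Finset.sum_comm]
        refine Finset.sum_congr rfl fun k _ => ?_
        rw [h1, Finset.smul_sum]
        refine Finset.sum_congr rfl fun i _ => ?_
        rw [smul_smul, ← pow_add, ← mul_add, mul_comm, pow_mul]
    _ = _ := by
        rw [Finset.sum_eq_single_of_mem j (Finset.mem_range.2 hj)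
          fun i hi hij => by rw [h3 i hi hij, zero_smul]]
        have h7 : ζ ^ (c + j) = 1 := by rwa [hζ.pow_eq_one_iff_dvd, add_comm]
        simp [h7]

/-- The operator-valued Poisson kernel of a contraction is positive. -/
theorem poisson_nonneg {H : Type*} [NormedAddCommGroup H] [InnerProductSpace ℂ H] [CompleteSpace H]
    {a R : H →L[ℂ] H} (ha : ‖a‖ ≤ 1) (hR : (1 - a) * R = 1) : 0 ≤ R + star R - 1 := by
  have h1 : R + star R - 1 = star R * (1 - star a * a) * R := by
    have hR' : star R * (1 - star a) = 1 := by
      have := congrArg star hR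
      simpa using this
    have h2 : (1 : H →L[ℂ] H) - star a * a =
        (1 - star a) + (1 - a) - (1 - star a) * (1 - a) := by noncomm_ring
    rw [h2, mul_sub, mul_add, hR', ← mul_assoc, hR', one_mul, sub_mul, add_mul, mul_assoc, hR,
      one_mul, mul_one]
  rw [h1]
  refine star_left_conjugate_nonneg ?_ R
  rw [sub_nonneg, ← CStarAlgebra.norm_le_one_iff_of_nonneg _ (star_mul_self_nonneg a),
    CStarRing.norm_star_mul_self]
  exact mul_le_one₀ ha (norm_nonneg _) ha

theorem two_mul_norm_inner_le {K : Type*} [NormedAddCommGroup K] [InnerProductSpace ℂ K]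
    [CompleteSpace K] {Q : K →L[ℂ] K} (hQ : 0 ≤ Q) (x y : K) :
    2 * ‖⟪y, Q x⟫_ℂ‖ ≤ (⟪y, Q y⟫_ℂ + ⟪x, Q x⟫_ℂ).re := by
  obtain ⟨s, -, hs, rfl⟩ := exists_sqrt hQ
  have h : ∀ u v : K, ⟪u, (s ∘L s) v⟫_ℂ = ⟪s u, s v⟫_ℂ := fun u v => by
    rw [ContinuousLinearMap.comp_apply, ← adjoint_inner_left, hs]
  rw [h, h, h, Complex.add_re]
  have h1 := norm_inner_le_norm (𝕜 := ℂ) (s y) (s x)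
  have h2 := inner_self_eq_norm_sq (𝕜 := ℂ) (s y)
  have h3 := inner_self_eq_norm_sq (𝕜 := ℂ) (s x)
  simp only [RCLike.re_to_complex] at h2 h3
  nlinarith [sq_nonneg (‖s y‖ - ‖s x‖)]

variable {H K : Type*} [NormedAddCommGroup H] [InnerProductSpace ℂ H] [CompleteSpace H]
  [NormedAddCommGroup K] [InnerProductSpace ℂ K] [CompleteSpace K]

/-- The Poisson kernels of `ζ ^ k x` represent `1` and `x`, up to the errors `E` and `x ^ (m - 1)`,
as averages with positive operator weights. -/
theorem two_mul_norm_inner_average_le {φ : (H →L[ℂ] H) →L[ℂ] (K →L[ℂ] K)} (hφ : IsPositiveMap φ)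
    {x : H →L[ℂ] H} (hx : ‖x‖ < 1) {m : ℕ} (hm : 2 ≤ m) {E : H →L[ℂ] H}
    (hE : (1 - x ^ m) * E = 1) (u v : K) :
    2 * ‖⟪v, φ (x * E + star (x ^ (m - 1) * E)) u⟫_ℂ‖ ≤
      (⟪v, φ (E + star E - 1) v⟫_ℂ + ⟪u, φ (E + star E - 1) u⟫_ℂ).re := by
  have hm0 : m ≠ 0 := by omega
  have hmC : (m : ℂ) ≠ 0 := Nat.cast_ne_zero.2 hm0
  have hmR : (0 : ℝ) < m := Nat.cast_pos.2 (by omega)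
  let ζ : ℂ := Complex.exp (2 * Real.pi * Complex.I / m)
  have hζ : IsPrimitiveRoot ζ m := Complex.isPrimitiveRoot_exp m hm0
  have hζn : ‖ζ‖ = 1 := hζ.norm'_eq_one hm0
  have hn : ∀ k : ℕ, ‖ζ ^ k • x‖ < 1 := fun k => by
    rwa [norm_smul, norm_pow, hζn, one_pow, one_mul]
  let R : ℕ → (H →L[ℂ] H) := fun k => Ring.inverse (1 - ζ ^ k • x)
  have hun : ∀ k, IsUnit (1 - ζ ^ k • x) := fun k => isUnit_one_sub_of_norm_lt_one (hn k)
  have hR : ∀ k, (1 - ζ ^ k • x) * R k = 1 := fun k => Ring.mul_inverse_cancel _ (hun k)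
  have hR' : ∀ k, R k * (1 - ζ ^ k • x) = 1 := fun k => Ring.inverse_mul_cancel _ (hun k)
  let P : ℕ → (H →L[ℂ] H) := fun k => R k + star (R k) - 1
  have hP : ∀ k, 0 ≤ φ (P k) := fun k => hφ _ (poisson_nonneg (hn k).le (hR k))
  have hstar : ∀ k : ℕ, star ζ ^ k = ζ ^ (k * (m - 1)) := fun k => by
    have h1 : star ζ = ζ ^ (m - 1) := by
      have h2 : ζ * star ζ = 1 := by
        have := Complex.mul_conj ζ
        rw [Complex.normSq_eq_norm_sq, hζn] at this
        simpa using this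
      have h3 : ζ * ζ ^ (m - 1) = 1 := by
        rw [← pow_succ', Nat.sub_add_cancel (by omega), hζ.pow_eq_one]
      exact mul_left_cancel₀ (hζ.ne_zero hm0) (h2.trans h3.symm)
    rw [h1, ← pow_mul, mul_comm]
  have hs0 : ∑ k ∈ Finset.range m, P k = (m : ℂ) • (E + star E - 1) := by
    have h := sum_pow_smul_inverse hζ hR' hE (c := 0) (j := 0) (by omega) (by simp)
    simp only [mul_zero, pow_zero, one_smul, one_mul] at h
    simp only [P, Finset.sum_sub_distrib, Finset.sum_add_distrib, ← star_sum, h]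
    simp [smul_sub, smul_add, Nat.cast_smul_eq_nsmul]
    exact ((Nat.cast_commute m (star E)).eq).symm
  have hs1 : ∑ k ∈ Finset.range m, star ζ ^ k • P k =
      (m : ℂ) • (x * E + star (x ^ (m - 1) * E)) := by
    have h1 := sum_pow_smul_inverse hζ hR' hE (c := m - 1) (j := 1) (by omega)
      (by rw [Nat.add_sub_cancel' (by omega)])
    have h2 := sum_pow_smul_inverse hζ hR' hE (c := 1) (j := m - 1) (by omega)
      (by rw [Nat.sub_add_cancel (by omega)])
    have h3 : ∑ k ∈ Finset.range m, star ζ ^ k • star (R k) =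
        (m : ℂ) • star (x ^ (m - 1) * E) := by
      have := congrArg star h2
      simpa only [star_sum, star_smul, star_pow, mul_one, star_natCast] using this
    have h4 : ∑ k ∈ Finset.range m, star ζ ^ k = 0 := by
      rw [← star_eq_zero, star_sum]
      simpa using hζ.geom_sum_eq_zero (by omega)
    simp only [P, smul_sub, smul_add, Finset.sum_sub_distrib, Finset.sum_add_distrib, h3,
      ← Finset.sum_smul, h4, zero_smul, sub_zero]
    simp only [hstar, h1, pow_one]
  have hkey : 2 * ‖⟪v, φ (∑ k ∈ Finset.range m, star ζ ^ k • P k) u⟫_ℂ‖ ≤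
      (⟪v, φ (∑ k ∈ Finset.range m, P k) v⟫_ℂ + ⟪u, φ (∑ k ∈ Finset.range m, P k) u⟫_ℂ).re := by
    simp only [map_sum, sum_apply, inner_sum, ← Finset.sum_add_distrib,
      Complex.re_sum]
    refine (mul_le_mul_of_nonneg_left (norm_sum_le _ _) zero_le_two).trans ?_
    rw [Finset.mul_sum]
    refine Finset.sum_le_sum fun k _ => ?_
    rw [map_smul, smul_apply, inner_smul_right, norm_mul, norm_pow, norm_star,
      hζn, one_pow, one_mul]
    exact two_mul_norm_inner_le (hP k) u v
  rw [hs0, hs1] at hkey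
  simp only [map_smul, smul_apply, inner_smul_right, norm_mul,
    Complex.norm_natCast, ← mul_add] at hkey
  rw [← Complex.ofReal_natCast, Complex.re_ofReal_mul] at hkey
  refine le_of_mul_le_mul_left ?_ hmR
  linarith

/-- **Russo–Dye**: a unital positive map is a contraction. -/
theorem IsPositiveMap.norm_le_one {φ : (H →L[ℂ] H) →L[ℂ] (K →L[ℂ] K)} (hφ : IsPositiveMap φ)
    (h1 : φ 1 = 1) : ‖φ‖ ≤ 1 := by
  have hball : ∀ x : H →L[ℂ] H, ‖x‖ < 1 → ‖φ x‖ ≤ 1 := by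
    intro x hx
    have hpow : Tendsto (fun m : ℕ => x ^ m) atTop (𝓝 0) :=
      tendsto_pow_atTop_nhds_zero_of_norm_lt_one hx
    have hpow' : Tendsto (fun m : ℕ => x ^ (m - 1)) atTop (𝓝 0) :=
      hpow.comp (tendsto_sub_atTop_nat 1)
    have hE : Tendsto (fun m : ℕ => Ring.inverse (1 - x ^ m)) atTop (𝓝 1) := by
      have h2 : Tendsto (fun m : ℕ => 1 - x ^ m) atTop (𝓝 ((1 : (H →L[ℂ] H)ˣ) : H →L[ℂ] H)) := by
        simpa using hpow.const_sub 1
      have h3 := (NormedRing.inverse_continuousAt (1 : (H →L[ℂ] H)ˣ)).tendsto.comp h2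
      rwa [Units.val_one, Ring.inverse_one] at h3
    have hlim : ∀ u v : K, 2 * ‖⟪v, φ x u⟫_ℂ‖ ≤ ‖v‖ ^ 2 + ‖u‖ ^ 2 := by
      intro u v
      have hl : Tendsto (fun m : ℕ => x * Ring.inverse (1 - x ^ m) +
          star (x ^ (m - 1) * Ring.inverse (1 - x ^ m))) atTop (𝓝 x) := by
        simpa using (hE.const_mul x).add (hpow'.mul hE).star
      have hr : Tendsto (fun m : ℕ => Ring.inverse (1 - x ^ m) +
          star (Ring.inverse (1 - x ^ m)) - 1) atTop (𝓝 1) := by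
        simpa using (hE.add hE.star).sub_const 1
      have hc : ∀ w z : K, Continuous fun y : H →L[ℂ] H => ⟪w, φ y z⟫_ℂ := fun w z => by fun_prop
      have hl' := ((hc v u).tendsto x).comp hl
      have hr' := (((hc v v).tendsto 1).comp hr).add (((hc u u).tendsto 1).comp hr)
      have h3 := le_of_tendsto_of_tendsto (hl'.norm.const_mul 2)
        ((Complex.continuous_re.tendsto _).comp hr') (by
          filter_upwards [eventually_ge_atTop 2] with m hm
          refine two_mul_norm_inner_average_le hφ hx hm (Ring.mul_inverse_cancel _ ?_) u v
          refine isUnit_one_sub_of_norm_lt_one ((norm_pow_le' x (by omega)).trans_lt ?_)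
          exact pow_lt_one₀ (norm_nonneg x) hx (by omega))
      rw [h1, one_apply_eq_self, one_apply_eq_self, Complex.add_re] at h3
      have h4 := inner_self_eq_norm_sq (𝕜 := ℂ) v
      have h5 := inner_self_eq_norm_sq (𝕜 := ℂ) u
      rwa [← h4, ← h5]
    refine ContinuousLinearMap.opNorm_le_bound _ zero_le_one fun u => ?_
    rw [one_mul]
    rcases eq_or_ne (φ x u) 0 with h0 | h0
    · rw [h0, norm_zero]
      exact norm_nonneg u
    have ht : 0 < ‖φ x u‖ := norm_pos_iff.2 h0
    -- the vector of norm `‖u‖` in the direction of `φ x u`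
    have h2 := hlim u (((‖u‖ / ‖φ x u‖ : ℝ) : ℂ) • φ x u)
    rw [inner_smul_left, inner_self_eq_norm_sq_to_K, norm_smul] at h2
    simp only [norm_mul, RCLike.norm_conj, Complex.norm_real, norm_div, norm_norm, norm_pow,
      RCLike.norm_ofReal, abs_norm] at h2
    rw [div_mul_cancel₀ _ ht.ne', sq ‖φ x u‖, ← mul_assoc, ← mul_assoc, mul_assoc 2,
      div_mul_cancel₀ _ ht.ne'] at h2
    rcases (norm_nonneg u).eq_or_lt with hu | hu
    · rw [norm_eq_zero.1 hu.symm, map_zero, norm_zero]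
    · nlinarith
  refine φ.opNorm_le_of_unit_norm zero_le_one fun x hx => ?_
  by_contra! hlt
  obtain ⟨t, ht, ht1⟩ := exists_between (inv_lt_one_of_one_lt₀ hlt)
  have ht0 : 0 < t := (inv_nonneg.2 (norm_nonneg _)).trans_lt ht
  have h2 := hball ((t : ℂ) • x) (by simpa [norm_smul, hx, abs_of_pos ht0] using ht1)
  rw [map_smul, norm_smul, Complex.norm_real, Real.norm_of_nonneg ht0.le] at h2
  rw [inv_lt_iff_one_lt_mul₀ (zero_lt_one.trans hlt), mul_comm] at ht
  exact h2.not_gt (by rwa [mul_comm])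

end RussoDye

/-! ### Exposed points -/

section Exposed

/-- A norm preserving injective linear map carries exposed points to exposed points: a functional
on the range of the map extends to the whole space by the Hahn–Banach theorem. -/
theorem image_exposed {E F : Type*} [AddCommGroup E] [Module ℝ E] [NormedAddCommGroup F]
    [NormedSpace ℝ F] (S : E →ₗ[ℝ] F) (hS : Function.Injective S) {p : E → ℝ}
    (hp : ∀ x, ‖S x‖ = p x) (C : Set E) :
    S '' exposed p C = exposed (fun y => ‖y‖) (S '' C) := by
  ext y
  constructor
  · rintro ⟨x, ⟨hx, f, ⟨M, hM⟩, hf⟩, rfl⟩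
    let T := LinearEquiv.ofInjective S hS
    have hT : ∀ z, T.symm ⟨S z, z, rfl⟩ = z := fun z => T.symm_apply_apply z
    let f' : StrongDual ℝ (LinearMap.range S) :=
      LinearMap.mkContinuous (f ∘ₗ T.symm.toLinearMap) M (by
        rintro ⟨_, z, rfl⟩
        rw [LinearMap.comp_apply, LinearEquiv.coe_coe, hT, Real.norm_eq_abs, Submodule.coe_norm,
          hp]
        exact hM z)
    obtain ⟨g, hg, -⟩ := exists_extension_norm_eq _ f'
    have hgS : ∀ z, g (S z) = f z := fun z => by
      have h1 : f' ⟨S z, z, rfl⟩ = f z := congrArg f (hT z)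
      rw [← h1, ← hg]
    refine ⟨⟨x, hx, rfl⟩, g.toLinearMap, ⟨‖g‖, fun z => g.le_opNorm z⟩, ?_⟩
    rintro _ ⟨z, hz, rfl⟩ hne
    change g (S z) < g (S x)
    rw [hgS, hgS]
    exact hf z hz fun h => hne (h ▸ rfl)
  · rintro ⟨⟨x, hx, rfl⟩, f, ⟨M, hM⟩, hf⟩
    exact ⟨x, ⟨hx, f ∘ₗ S, ⟨M, fun z => (hM (S z)).trans_eq (by rw [← hp])⟩,
      fun z hz hne => hf _ ⟨z, hz, rfl⟩ (hS.ne hne)⟩, rfl⟩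

/-- The form of `image_exposed` for complex-linear maps into a space of operators. -/
theorem image_exposed_clm {E X Y : Type*} [AddCommGroup E] [Module ℝ E] [Module ℂ E]
    [IsScalarTower ℝ ℂ E] [NormedAddCommGroup X] [NormedSpace ℂ X] [NormedAddCommGroup Y]
    [NormedSpace ℂ Y] (S : E →ₗ[ℂ] (X →L[ℂ] Y)) (hS : Function.Injective S) {p : E → ℝ}
    (hp : ∀ x, ‖S x‖ = p x) (C : Set E) :
    S '' exposed p C = exposed (fun y => ‖y‖) (S '' C) :=
  image_exposed (S.restrictScalars ℝ) hS hp C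

end Exposed

/-! ### Block positive operators -/

section BlockPositive

open InnerProductSpace ContinuousLinearMap

variable {H K : Type*} [NormedAddCommGroup H] [InnerProductSpace ℂ H]
  [NormedAddCommGroup K] [InnerProductSpace ℂ K]

/-- Block positive operators are self-adjoint, by polarization in each of the two tensor factors. -/
theorem IsBlockPositive.adjoint_eq [CompleteSpace H] [CompleteSpace K] {T : HTensor H K →L[ℂ] HTensor H K} (hT : IsBlockPositive T) :
    ContinuousLinearMap.adjoint T = T := by
  let B : H → K → H → K → ℂ := fun f g f' g' =>
    ⟪htmul f g, T (htmul f' g')⟫_ℂ - ⟪T (htmul f g), htmul f' g'⟫_ℂ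
  have h1 : ∀ f f' g, B f g f' g = 0 := fun f f' g => by
    have h2 : 0 ≤ ContinuousLinearMap.adjoint (tensorRight g) ∘L T ∘L tensorRight g :=
      nonneg_of_inner_nonneg fun x => by
        simp only [ContinuousLinearMap.comp_apply]
        rw [adjoint_inner_right]
        exact hT x g
    have h3 := ((nonneg_iff_isPositive _).1 h2).isSelfAdjoint.isSymmetric f f'
    simp only [ContinuousLinearMap.coe_coe, ContinuousLinearMap.comp_apply] at h3
    rw [adjoint_inner_left, adjoint_inner_right] at h3
    exact sub_eq_zero.2 h3.symm
  refine HTensor.op_ext fun f g f' g' => ?_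
  have h4 := h1 f' f (g' + g)
  have h5 := h1 f' f (g' + Complex.I • g)
  have h6 := h1 f' f g
  have h7 := h1 f' f g'
  simp only [B, htmul_add, htmul_smul, map_add, map_smul, inner_add_left, inner_add_right,
    inner_smul_left, inner_smul_right, Complex.conj_I] at h4 h5 h6 h7
  rw [adjoint_inner_right]
  have h8 : Complex.I * Complex.I = -1 := Complex.I_mul_I
  linear_combination (-1 / 2 : ℂ) * h4 + (Complex.I / 2 : ℂ) * h5 + (h7 + h6) / 2
    - Complex.I / 2 * (h7 + h6) + h8 / 2 * (⟪T (htmul f' g'), htmul f g⟫_ℂ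
    - ⟪htmul f' g', T (htmul f g)⟫_ℂ + ⟪htmul f' g, T (htmul f g')⟫_ℂ
    - ⟪T (htmul f' g), htmul f g'⟫_ℂ + Complex.I * (⟪htmul f' g, T (htmul f g)⟫_ℂ
    - ⟪T (htmul f' g), htmul f g⟫_ℂ))

theorem isBlockPositive_rankOne (z : HTensor H K) : IsBlockPositive (TraceClass.rankOne z z).op := by
  rw [TraceClass.op_rankOne]
  exact fun _ _ => inner_nonneg_of_nonneg
    ((nonneg_iff_isPositive _).2 (isPositive_rankOne_self z)) _

theorem IsBlockPositive.sum {κ : Type*} {T : κ → TraceClass (HTensor H K)} (s : Finset κ)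
    (hT : ∀ i ∈ s, IsBlockPositive (T i).op) : IsBlockPositive (∑ i ∈ s, T i).op := fun f g => by
  rw [map_sum, sum_apply, inner_sum]
  exact Finset.sum_nonneg fun i hi => hT i hi f g

theorem htmul_ne_zero {f : H} {g : K} (hf : f ≠ 0) (hg : g ≠ 0) : htmul f g ≠ 0 := fun h => by
  have h1 := inner_htmul f f g g
  rw [h, inner_zero_left] at h1
  exact mul_ne_zero (inner_self_ne_zero.2 hf) (inner_self_ne_zero.2 hg) h1.symm

end BlockPositive

/-! ### The partial trace -/

section PartialTrace

open InnerProductSpace ContinuousLinearMap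

variable {H K : Type*} [NormedAddCommGroup H] [InnerProductSpace ℂ H] [CompleteSpace H]
  [NormedAddCommGroup K] [InnerProductSpace ℂ K]

theorem partialTraceForm_eq_trace (ϱ : TraceClass (HTensor H K)) (g g' : K) :
    partialTraceForm ϱ.op g g' =
      trace (ContinuousLinearMap.adjoint (tensorRight g) ∘L ϱ.op ∘L tensorRight g') :=
  tsum_congr fun v => by
    simp only [ContinuousLinearMap.comp_apply]
    rw [adjoint_inner_right, tensorRight_apply, tensorRight_apply]

theorem partialTraceForm_sum {κ : Type*} (T : κ → TraceClass (HTensor H K)) (s : Finset κ)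
    (g g' : K) :
    partialTraceForm (∑ i ∈ s, T i).op g g' = ∑ i ∈ s, partialTraceForm (T i).op g g' := by
  simp only [partialTraceForm_eq_trace]
  rw [← TraceClass.op_conj, ← traceCLM_apply, map_sum, map_sum]
  rfl

theorem partialTraceForm_rankOne {f : H} (hf : ‖f‖ = 1) (k g g' : K) :
    partialTraceForm (TraceClass.rankOne (htmul f k) (htmul f k)).op g g' =
      ⟪g, k⟫_ℂ * ⟪k, g'⟫_ℂ := by
  rw [partialTraceForm_eq_trace, ← TraceClass.op_conj, TraceClass.conj_rankOne,
    TraceClass.op_rankOne, trace_rankOne, adjoint_tensorRight_htmul, adjoint_tensorRight_htmul,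
    inner_smul_left, inner_smul_right, inner_self_eq_norm_sq_to_K, hf, inner_conj_symm]
  simp [mul_comm]

theorem tracePairing_tensorOp_one_rankOne (ϱ : TraceClass (HTensor H K)) (g g' : K) :
    tracePairing ϱ (tensorOp 1 (rankOne ℂ g g')) = partialTraceForm ϱ.op g' g := by
  rw [tracePairing_apply, tensorOp_rankOne, trace_comp_comp_comm, partialTraceForm_eq_trace]
  rfl

end PartialTrace

section ProjectionsOntoBasisVectors

open InnerProductSpace ContinuousLinearMap

variable {K ι : Type*} [NormedAddCommGroup K] [InnerProductSpace ℂ K] (e : HilbertBasis ι ℂ K)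

theorem sum_rankOne_eq_one [Fintype ι] : ∑ i, rankOne ℂ (e i) (e i) = 1 :=
  ContinuousLinearMap.ext fun x => by
    rw [sum_apply, one_apply_eq_self]
    simpa [rankOne_apply, e.repr_apply_apply] using (hasSum_fintype _).unique (e.hasSum_repr x)

theorem norm_sum_rankOne_le (s : Finset ι) : ‖∑ i ∈ s, rankOne ℂ (e i) (e i)‖ ≤ 1 := by
  refine ContinuousLinearMap.opNorm_le_bound _ zero_le_one fun x => ?_
  rw [one_mul, ← sq_le_sq₀ (norm_nonneg _) (norm_nonneg _), sum_apply, ← Finset.sum_coe_sort]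
  simp only [rankOne_apply]
  rw [norm_sum_smul_sq_of_orthonormal (e := fun i : s => e i)
      (e.orthonormal.comp _ Subtype.val_injective),
    Finset.sum_coe_sort s fun i => ‖⟪e i, x⟫_ℂ‖ ^ 2]
  exact e.orthonormal.sum_inner_products_le x

theorem finite_index_of_finiteDimensional (e : HilbertBasis ι ℂ K) [FiniteDimensional ℂ K] : Finite ι :=
  e.orthonormal.linearIndependent.finite

/-- A contraction with the largest possible trace is the identity. -/
theorem eq_one_of_sum_inner_eq_card [Fintype ι] {q : K →L[ℂ] K} (hq : ‖q‖ ≤ 1)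
    (h : ∑ i, ⟪e i, q (e i)⟫_ℂ = Fintype.card ι) : q = 1 := by
  have h1 : ∀ i, (⟪e i, q (e i)⟫_ℂ).re ≤ 1 := fun i => by
    refine (Complex.re_le_norm _).trans ((norm_inner_le_norm _ _).trans ?_)
    rw [e.orthonormal.1, one_mul]
    exact (q.le_of_opNorm_le hq _).trans (by rw [e.orthonormal.1, one_mul])
  have h2 : ∀ i, (⟪e i, q (e i)⟫_ℂ).re = 1 := by
    have h3 := congrArg Complex.re h
    rw [Complex.re_sum, Complex.natCast_re] at h3
    have h4 : ∑ i : ι, (1 - (⟪e i, q (e i)⟫_ℂ).re) = 0 := by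
      rw [Finset.sum_sub_distrib, h3]
      simp
    intro i
    have := (Finset.sum_eq_zero_iff_of_nonneg fun i _ => sub_nonneg.2 (h1 i)).1 h4 i
      (Finset.mem_univ i)
    linarith
  have h5 : ∀ i, q (e i) = e i := fun i => by
    have h6 : ‖q (e i)‖ ≤ 1 :=
      (q.le_of_opNorm_le hq _).trans (by rw [e.orthonormal.1, one_mul])
    have h7 := norm_sub_sq (𝕜 := ℂ) (e i) (q (e i))
    rw [RCLike.re_to_complex, h2, e.orthonormal.1] at h7
    have h8 : ‖e i - q (e i)‖ ^ 2 ≤ 0 := by nlinarith [norm_nonneg (q (e i))]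
    have h9 : ‖e i - q (e i)‖ = 0 := pow_eq_zero_iff two_ne_zero |>.1 (le_antisymm h8 (sq_nonneg _))
    exact (sub_eq_zero.1 (norm_eq_zero.1 h9)).symm
  refine ContinuousLinearMap.ext fun x => ?_
  have h10 := congrArg (fun F : K →L[ℂ] K => F x) (sum_rankOne_eq_one e)
  simp only [sum_apply, rankOne_apply, one_apply_eq_self] at h10
  rw [one_apply_eq_self]
  nth_rewrite 1 [← h10]
  rw [map_sum]
  simp only [map_smul, h5]
  exact h10

end ProjectionsOntoBasisVectors

/-! ### The sets `𝔇₀` and `𝔇` -/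

section DensityMatrices

open InnerProductSpace ContinuousLinearMap

variable {H K ι : Type*} [NormedAddCommGroup H] [InnerProductSpace ℂ H] [CompleteSpace H]
  [NormedAddCommGroup K] [InnerProductSpace ℂ K] [CompleteSpace K] (e : HilbertBasis ι ℂ K)

theorem mem_D₀_iff (ϱ : TraceClass (HTensor H K)) :
    ϱ ∈ D₀ H K ↔ IsPositiveMap (densityMap e ϱ) ∧ ‖densityMap e ϱ‖ = 1 := by
  rw [isPositiveMap_densityMap_iff, norm_densityMap]
  exact ⟨fun h => ⟨h.2.2, h.1⟩, fun h => ⟨h.2, h.1.adjoint_eq, h.1⟩⟩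

theorem image_D₀ : densityMap e '' D₀ H K =
    {φ | IsPositiveMap φ ∧ ‖φ‖ = 1 ∧ IsNormal (mapEquiv H e φ)} := by
  ext φ
  constructor
  · rintro ⟨ϱ, hϱ, rfl⟩
    have h := (mem_D₀_iff e ϱ).1 hϱ
    exact ⟨h.1, h.2, (range_densityMap e).subset ⟨ϱ, rfl⟩⟩
  · rintro ⟨h1, h2, h3⟩
    obtain ⟨ϱ, rfl⟩ := (range_densityMap e).superset h3
    exact ⟨ϱ, (mem_D₀_iff e ϱ).2 ⟨h1, h2⟩, rfl⟩

theorem image_exposed_densityMap (C : Set (TraceClass (HTensor H K))) :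
    densityMap e '' exposed alphaNorm C = exposed (fun φ => ‖φ‖) (densityMap e '' C) := by
  have h := image_exposed_clm (densityMap (H := H) e) (p := alphaNorm) (densityMap_injective e)
  have h' := h (norm_densityMap e) C
  with_reducible exact h'

theorem image_exposed_D₀ : densityMap e '' exposed alphaNorm (D₀ H K) =
    exposed (fun φ => ‖φ‖) {φ | IsPositiveMap φ ∧ ‖φ‖ = 1 ∧ IsNormal (mapEquiv H e φ)} :=
  (image_exposed_densityMap e _).trans (congrArg _ (image_D₀ e))

/-- The partial trace of `ϱ` is, up to transposition, the operator `φ_ϱ(1)`. -/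
theorem inner_densityMap_one (ϱ : TraceClass (HTensor H K)) (x y : K) :
    ⟪y, densityMap e ϱ 1 x⟫_ℂ = partialTraceForm ϱ.op (conjBasis e x) (conjBasis e y) := by
  rw [inner_densityMap_apply, partialTraceForm_eq_trace]
  rfl

theorem densityMap_one_eq_one_iff (ϱ : TraceClass (HTensor H K)) :
    densityMap e ϱ 1 = 1 ↔ ∀ g g' : K, partialTraceForm ϱ.op g g' = ⟪g, g'⟫_ℂ := by
  constructor
  · intro h g g'
    have h1 := inner_densityMap_one e ϱ (conjBasis e g) (conjBasis e g')
    rw [conjBasis_conjBasis, conjBasis_conjBasis, h, one_apply_eq_self,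
      inner_conjBasis_conjBasis] at h1
    exact h1.symm
  · intro h
    refine ContinuousLinearMap.ext fun x => ext_inner_left ℂ fun y => ?_
    rw [inner_densityMap_one, h, inner_conjBasis_conjBasis, one_apply_eq_self]

theorem tracePairing_tensorOp_one_sum (ϱ : TraceClass (HTensor H K)) (s : Finset ι) :
    tracePairing ϱ (tensorOp 1 (∑ i ∈ s, rankOne ℂ (e i) (e i))) =
      ∑ i ∈ s, ⟪e i, densityMap e ϱ 1 (e i)⟫_ℂ := by
  rw [← tensorOpRight_apply, map_sum, map_sum]
  refine Finset.sum_congr rfl fun i _ => ?_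
  rw [tensorOpRight_apply, tracePairing_tensorOp_one_rankOne, inner_densityMap_one, conjBasis_self]

/-- The trace of `ϱ` is the trace of `φ_ϱ(1)`. -/
theorem trace_eq_sum_inner_densityMap_one [Fintype ι] (ϱ : TraceClass (HTensor H K)) :
    trace ϱ.op = ∑ i, ⟪e i, densityMap e ϱ 1 (e i)⟫_ℂ := by
  rw [← tracePairing_tensorOp_one_sum, sum_rankOne_eq_one, tracePairing_apply]
  congr 1
  exact HTensor.clm_ext fun f g => by
    rw [ContinuousLinearMap.comp_apply, tensorOp_htmul, one_apply_eq_self, one_apply_eq_self]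

theorem IsPositiveMap.normalize {φ : (H →L[ℂ] H) →L[ℂ] (K →L[ℂ] K)} (hφ : IsPositiveMap φ)
    (h0 : φ ≠ 0) : IsPositiveMap (((‖φ‖⁻¹ : ℝ) : ℂ) • φ) ∧ ‖((‖φ‖⁻¹ : ℝ) : ℂ) • φ‖ = 1 := by
  refine ⟨fun a ha => ?_, ?_⟩
  · rw [smul_apply]
    refine smul_nonneg ?_ (hφ a ha)
    exact_mod_cast inv_nonneg.2 (norm_nonneg φ)
  · rw [norm_smul, Complex.norm_real, norm_inv, norm_norm, inv_mul_cancel₀ (norm_ne_zero_iff.2 h0)]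

variable [Nontrivial H] [Nontrivial K]

theorem IsPositiveMap.norm_eq_one {φ : (H →L[ℂ] H) →L[ℂ] (K →L[ℂ] K)} (hφ : IsPositiveMap φ)
    (h1 : φ 1 = 1) : ‖φ‖ = 1 := by
  refine le_antisymm (hφ.norm_le_one h1) ?_
  have h := φ.le_opNorm 1
  rwa [h1, norm_one, norm_one, mul_one] at h

theorem mem_D_iff (ϱ : TraceClass (HTensor H K)) :
    ϱ ∈ D H K ↔ IsPositiveMap (densityMap e ϱ) ∧ densityMap e ϱ 1 = 1 := by
  rw [densityMap_one_eq_one_iff]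
  refine ⟨fun h => ⟨((mem_D₀_iff e ϱ).1 h.1).1, h.2⟩, fun h => ⟨(mem_D₀_iff e ϱ).2 ⟨h.1, ?_⟩, h.2⟩⟩
  exact h.1.norm_eq_one ((densityMap_one_eq_one_iff e ϱ).2 h.2)

theorem image_D : densityMap e '' D H K =
    {φ | IsPositiveMap φ ∧ φ 1 = 1 ∧ IsNormal (mapEquiv H e φ)} := by
  ext φ
  constructor
  · rintro ⟨ϱ, hϱ, rfl⟩
    have h := (mem_D_iff e ϱ).1 hϱ
    exact ⟨h.1, h.2, (range_densityMap e).subset ⟨ϱ, rfl⟩⟩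
  · rintro ⟨h1, h2, h3⟩
    obtain ⟨ϱ, rfl⟩ := (range_densityMap e).superset h3
    exact ⟨ϱ, (mem_D_iff e ϱ).2 ⟨h1, h2⟩, rfl⟩

theorem image_exposed_D : densityMap e '' exposed alphaNorm (D H K) =
    exposed (fun φ => ‖φ‖) {φ | IsPositiveMap φ ∧ φ 1 = 1 ∧ IsNormal (mapEquiv H e φ)} :=
  (image_exposed_densityMap e _).trans (congrArg _ (image_D e))

theorem convex_D (e : HilbertBasis ι ℂ K) : Convex ℝ (D H K) := by
  intro ϱ hϱ σ hσ a b ha hb hab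
  rw [mem_D_iff e] at hϱ hσ ⊢
  have h : densityMap e (a • ϱ + b • σ) = (a : ℂ) • densityMap e ϱ + (b : ℂ) • densityMap e σ := by
    rw [← map_smul, ← map_smul, ← map_add]
    rfl
  rw [h]
  refine ⟨fun x hx => ?_, ?_⟩
  · exact add_nonneg (smul_nonneg (by exact_mod_cast ha) (hϱ.1 x hx))
      (smul_nonneg (by exact_mod_cast hb) (hσ.1 x hx))
  · rw [add_apply, smul_apply, smul_apply, hϱ.2, hσ.2, ← add_smul, ← Complex.ofReal_add, hab,
      Complex.ofReal_one, one_smul]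

/-- A positive operator of rank one on `H ⊗ K`, suitably normalized, lies in `𝔇₀`. -/
theorem nonempty_D₀ (e : HilbertBasis ι ℂ K) : (D₀ H K).Nonempty := by
  obtain ⟨f, hf⟩ := exists_ne (0 : H)
  obtain ⟨g, hg⟩ := exists_ne (0 : K)
  have hω := (isPositiveMap_densityMap_iff e _).2 (isBlockPositive_rankOne (htmul f g))
  have hne : densityMap e (TraceClass.rankOne (htmul f g) (htmul f g)) ≠ 0 := by
    intro h
    have h1 : TraceClass.rankOne (htmul f g) (htmul f g) = 0 :=
      densityMap_injective e (by rw [h, map_zero])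
    have h2 := TraceClass.op_rankOne (htmul f g) (htmul f g)
    rw [h1, map_zero] at h2
    have h3 := rankOne_eq_zero.1 h2.symm
    exact htmul_ne_zero hf hg (h3.elim id id)
  have h := hω.normalize hne
  rw [← map_smul] at h
  exact ⟨_, (mem_D₀_iff e _).2 h⟩

end DensityMatrices

/-! ### Finite-dimensional `K` -/

section FiniteDimensional

open InnerProductSpace ContinuousLinearMap

variable {H K ι : Type*} [NormedAddCommGroup H] [InnerProductSpace ℂ H] [CompleteSpace H]
  [NormedAddCommGroup K] [InnerProductSpace ℂ K] [CompleteSpace K] [Nontrivial H] [Nontrivial K]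
  (e : HilbertBasis ι ℂ K)

/-- In finite dimensions the condition on the partial trace reduces to one on the trace, since
`φ_ϱ(1)` is a contraction with the trace of `ϱ`. -/
theorem D_eq_of_finiteDimensional (e : HilbertBasis ι ℂ K) [FiniteDimensional ℂ K] : D H K =
    {ϱ | ϱ ∈ D₀ H K ∧ trace ϱ.op = (Module.finrank ℂ K : ℂ)} := by
  have := finite_index_of_finiteDimensional e
  have := Fintype.ofFinite ι
  have hcard : Module.finrank ℂ K = Fintype.card ι :=
    Module.finrank_eq_card_basis e.toOrthonormalBasis.toBasis
  ext ϱ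
  rw [Set.mem_ofPred_eq, hcard, trace_eq_sum_inner_densityMap_one e]
  constructor
  · intro h
    refine ⟨h.1, ?_⟩
    rw [((mem_D_iff e ϱ).1 h).2]
    simp [inner_self_eq_norm_sq_to_K, e.orthonormal.1]
  · rintro ⟨h, ht⟩
    have h1 := (mem_D₀_iff e ϱ).1 h
    refine (mem_D_iff e ϱ).2 ⟨h1.1, eq_one_of_sum_inner_eq_card e ?_ ht⟩
    refine (ContinuousLinearMap.le_opNorm _ _).trans ?_
    rw [h1.2, norm_one, one_mul]

/-- The trace norm of `ϱ` bounds the number of vectors in an orthonormal family of `K`. -/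
theorem finiteDimensional_of_mem_D (e : HilbertBasis ι ℂ K) {ϱ : TraceClass (HTensor H K)} (h : ϱ ∈ D H K) :
    FiniteDimensional ℂ K := by
  have hcard : ∀ s : Finset ι, (s.card : ℝ) ≤ ‖ϱ‖ := by
    intro s
    have h1 := tracePairing_tensorOp_one_sum e ϱ s
    rw [((mem_D_iff e ϱ).1 h).2] at h1
    have h2 : ∑ i ∈ s, ⟪e i, (1 : K →L[ℂ] K) (e i)⟫_ℂ = s.card := by
      simp [inner_self_eq_norm_sq_to_K, e.orthonormal.1]
    rw [h2] at h1
    have h3 := norm_tracePairing_le ϱ (tensorOp 1 (∑ i ∈ s, rankOne ℂ (e i) (e i)))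
    rw [h1, Complex.norm_natCast] at h3
    refine h3.trans (mul_le_of_le_one_right (norm_nonneg _) ((norm_tensorOp_le _ _).trans ?_))
    rw [norm_one, one_mul]
    exact norm_sum_rankOne_le e s
  have hfin : Finite ι := by
    by_contra hinf
    have : Infinite ι := not_finite_iff_infinite.1 hinf
    obtain ⟨n, hn⟩ := exists_nat_gt ‖ϱ‖
    obtain ⟨s, hs⟩ := Infinite.exists_subset_card_eq ι n
    exact (hcard s).not_gt (by rwa [hs])
  have := Fintype.ofFinite ι
  exact e.toOrthonormalBasis.toBasis.finiteDimensional_of_finite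

/-- For a unit vector `f` and finite-dimensional `K`, the density operator `|f⟩⟨f| ⊗ 1` belongs to
the unital positive map `a ↦ ⟪f, a f⟫ 1`. -/
theorem nonempty_D (e : HilbertBasis ι ℂ K) [FiniteDimensional ℂ K] : (D H K).Nonempty := by
  have := finite_index_of_finiteDimensional e
  have := Fintype.ofFinite ι
  obtain ⟨f, hf⟩ := exists_norm_eq H zero_le_one
  refine ⟨∑ i, TraceClass.rankOne (htmul f (e i)) (htmul f (e i)), (mem_D_iff e _).2
    ⟨(isPositiveMap_densityMap_iff e _).2 (IsBlockPositive.sum _ fun i _ => ?_),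
      (densityMap_one_eq_one_iff e _).2 fun g g' => ?_⟩⟩
  · exact isBlockPositive_rankOne _
  · rw [partialTraceForm_sum, ← e.tsum_inner_mul_inner, tsum_fintype]
    exact Finset.sum_congr rfl fun i _ => partialTraceForm_rankOne hf _ _ _

end FiniteDimensional

end PosMaps

end

/-! ### The correspondence of density operators and positive maps -/

theorem corollary12 {H K ι : Type*}
    [NormedAddCommGroup H] [InnerProductSpace ℂ H] [CompleteSpace H] [Nontrivial H]
    [NormedAddCommGroup K] [InnerProductSpace ℂ K] [CompleteSpace K] [Nontrivial K]
    (e : HilbertBasis ι ℂ K) :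
    -- the inclusions of the dual spaces
    (Function.Injective (PosMaps.restrictFunctional (H := H) (K := K)) ∧
      (∀ ρ : StrongDual ℂ (PosMaps.bkAlg H K), ‖PosMaps.restrictFunctional ρ‖ ≤ ‖ρ‖) ∧
      ∃ J : StrongDual ℂ (PosMaps.BEpsK H K) →ₗ[ℂ] StrongDual ℂ (PosMaps.bkAlg H K),
        Function.Injective J ∧ (∀ ζ, ‖J ζ‖ ≤ ‖ζ‖) ∧
        ∀ ζ a k, J ζ (PosMaps.bkTmul a k) = ζ (PosMaps.itmul a k)) ∧
    -- the decomposition into a normal and a singular part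
    (∀ ρ : StrongDual ℂ (PosMaps.bkAlg H K),
      ∃! p : StrongDual ℂ (PosMaps.bkAlg H K) × StrongDual ℂ (PosMaps.bkAlg H K),
        PosMaps.IsUltraweaklyContinuous p.1 ∧ PosMaps.IsSingular p.2 ∧ ρ = p.1 + p.2) ∧
    -- the normal functionals are those with a density matrix, which is unique
    (∀ ψ : StrongDual ℂ (PosMaps.BPiT H K), PosMaps.IsNormal ψ ↔
      ∃! ϱ : PosMaps.TraceClass (PosMaps.HTensor H K), ∀ u : PosMaps.BPiT H K,
        ψ u = PosMaps.trace (ϱ.op ∘L (PosMaps.canonicalMap u : PosMaps.bkAlg H K).1)) ∧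
    -- functionals and maps
    ∃ Φ : ((H →L[ℂ] H) →L[ℂ] (K →L[ℂ] K)) ≃ₗᵢ[ℂ] StrongDual ℂ (PosMaps.BPiT H K),
      (∀ φ a b, Φ φ (PosMaps.ptmul a b) =
        PosMaps.trace (φ a ∘L PosMaps.transpose e b.op)) ∧
      (∀ φ, PosMaps.IsPositiveMap φ ↔ PosMaps.IsPositiveOnCone (Φ φ)) ∧
      -- density matrices and the maps whose functional is normal
      ∃ S : PosMaps.TraceClass (PosMaps.HTensor H K) →ₗ[ℂ] ((H →L[ℂ] H) →L[ℂ] (K →L[ℂ] K)),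
        (∀ ϱ u, Φ (S ϱ) u =
          PosMaps.trace (ϱ.op ∘L (PosMaps.canonicalMap u : PosMaps.bkAlg H K).1)) ∧
        Function.Injective S ∧
        Set.range S = {φ | PosMaps.IsNormal (Φ φ)} ∧
        (∀ ϱ, ‖S ϱ‖ = PosMaps.alphaNorm ϱ) ∧
        (∀ ϱ, PosMaps.IsPositiveMap (S ϱ) ↔ PosMaps.IsBlockPositive ϱ.op) ∧
        -- the set of block positive density matrices of norm one, and its exposed points
        S '' PosMaps.D₀ H K =
          {φ | PosMaps.IsPositiveMap φ ∧ ‖φ‖ = 1 ∧ PosMaps.IsNormal (Φ φ)} ∧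
        S '' PosMaps.exposed PosMaps.alphaNorm (PosMaps.D₀ H K) =
          PosMaps.exposed (fun φ => ‖φ‖)
            {φ | PosMaps.IsPositiveMap φ ∧ ‖φ‖ = 1 ∧ PosMaps.IsNormal (Φ φ)} ∧
        (PosMaps.D₀ H K).Nonempty ∧
        -- the normalized density matrices, the unital positive maps, and the exposed points
        Convex ℝ (PosMaps.D H K) ∧
        S '' PosMaps.D H K =
          {φ | PosMaps.IsPositiveMap φ ∧ φ 1 = 1 ∧ PosMaps.IsNormal (Φ φ)} ∧
        S '' PosMaps.exposed PosMaps.alphaNorm (PosMaps.D H K) =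
          PosMaps.exposed (fun φ => ‖φ‖)
            {φ | PosMaps.IsPositiveMap φ ∧ φ 1 = 1 ∧ PosMaps.IsNormal (Φ φ)} ∧
        (FiniteDimensional ℂ K → PosMaps.D H K =
          {ϱ | ϱ ∈ PosMaps.D₀ H K ∧ PosMaps.trace ϱ.op = (Module.finrank ℂ K : ℂ)}) ∧
        ((PosMaps.D H K).Nonempty ↔ FiniteDimensional ℂ K) := by
  refine ⟨⟨PosMaps.restrictFunctional_injective, PosMaps.norm_restrictFunctional_le,
    PosMaps.exists_extension_of_injective⟩, PosMaps.existsUnique_normal_add_singular,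
    PosMaps.isNormal_iff_existsUnique, PosMaps.mapEquiv H e, PosMaps.mapEquiv_ptmul e, PosMaps.isPositiveMap_iff e,
    PosMaps.densityMap e, PosMaps.mapEquiv_densityMap_apply e, PosMaps.densityMap_injective e,
    PosMaps.range_densityMap e, PosMaps.norm_densityMap e, PosMaps.isPositiveMap_densityMap_iff e,
    PosMaps.image_D₀ e, PosMaps.image_exposed_D₀ e, PosMaps.nonempty_D₀ e, PosMaps.convex_D e, PosMaps.image_D e,
    PosMaps.image_exposed_D e,
    fun _ => PosMaps.D_eq_of_finiteDimensional e,
    fun ⟨_, h⟩ => PosMaps.finiteDimensional_of_mem_D e h, fun _ => PosMaps.nonempty_D e⟩
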